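/- Throughout, $d,m\in\mathbb N$, $|\cdot|$ is the Euclidean norm, and on $\mathbb{R}^{d\times m}$ in particular the Frobenius norm. The barycenter of a probability measure $\nu$ on $\mathbb{R}^{d\times m}$ with finite first moment is $\bar\nu=\int X\,d\nu(X)$. *Laminates.* $\mu$ is obtained from $\nu$ by elementary splitting if $\nu=\lambda\delta_A+(1-\lambda)\tilde\nu$ and $\mu=\lambda(\lambda'\delta_B+(1-\lambda')\delta_{B'})+(1-\lambda)\tilde\nu$ with $\tilde\nu$ a probability measure, $\lambda\in[0,1]$, $\lambda'\in(0,1)$, $A=\lambda'B+(1-\lambda')B'$, $\operatorname{rank}(B'-B)=1$. The laminates of finite order are the elements of the smallest set of measures containing all Dirac masses and invariant under elementary splitting. *Staircase laminates.* Let $K\subset\mathbb{R}^{d\times m}$. A staircase laminate supported in $K$ with barycenter $A$ is a probability measure $\nu^\infty$ with $\overline{\nu^\infty}=A$ for which there are matrices $A_n\notin K$ ($n\ge 0$) with $A_0=A$, probability measures $\mu_n$ supported in $K$ and $\gamma_n\in(0,1)$ ($n\ge1$) such that: $\omega_n=(1-\gamma_n)\mu_n+\gamma_n\delta_{A_n}$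 is a laminate of finite order with barycenter $A_{n-1}$ for every $n\ge 1$; $|A_n|$ is non-decreasing with $|A_n|\to\infty$; $\beta_n:=\prod_{k=1}^n\gamma_k\to0$; and $\nu^\infty(E)=\lim_{N\to\infty}\big(\sum_{n=1}^N\beta_{n-1}(1-\gamma_n)\mu_n+\beta_N\delta_{A_N}\big)(E)$ for every Borel set $E$. *Domains and norms.* A regular domain is an open, bounded, connected (non-empty) set $\Omega\subset\mathbb{R}^m$ with $|\partial\Omega|=0$. Let $l_{A,b}(x)=Ax+b$. The norm $\|v\|_{C^\alpha(\overline\Omega)}$ is the supremum of $|v|$ plus the $\alpha$-Hölder seminorm of $v$ on $\overline\Omega$ (for $\alpha=0$ this is equivalent to the supremum norm). **Statement.** Let $K\subset\mathbb{R}^{d\times m}$, $1<p\le r<\infty$, $0\le\rho\le r$ and $M>1$. Suppose that for every $A\in\mathbb{R}^{d\times m}$ there is a probability measure $\nu_A^\infty$, supported on $K$ and with barycenter $A$, of the form $$\nu_A^\infty=\sum_{j=1}^{J'}\lambda_j\delta_{B_j}+\sum_{j=J'+1}^{J}\lambda_j\tilde\nu_j^\infty,$$ where $\lambda_j\ge0$,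 $\sum_{j=1}^J\lambda_j\delta_{B_j}$ is a laminate of finite order with barycenter $A$, $B_j\in K$ for $j\le J'$, and for $j>J'$ the measure $\tilde\nu_j^\infty$ is a staircase laminate supported in $K$ with barycenter $B_j$, and such that $$M^{-p}(1+|A|^\rho)t^{-p}\le\nu_A^\infty(\{X:|X|>t\})\le M^p(1+|A|^r)t^{-p}\qquad\text{for all }t>1+|A|.$$ Then for every regular domain $\Omega\subset\mathbb{R}^m$, every $A\in\mathbb{R}^{d\times m}$, $b\in\mathbb{R}^d$, $\delta>0$ and $\alpha\in[0,1)$ there exists $u\in W^{1,1}(\Omega;\mathbb R^d)\cap C^\alpha(\overline\Omega;\mathbb R^d)$ such that $u=l_{A,b}$ on $\partial\Omega$, $$\nabla u\in K\ \text{ a.e. in }\Omega,\qquad \|u-l_{A,b}\|_{C^\alpha(\overline\Omega)}<\delta,$$ and $$\int_B|\nabla u|^p\,dx=\infty\qquad\text{for every open ball }B\subset\Omega.$$ -/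

import Mathlib

open MeasureTheory Filter Set
open scoped NNReal ENNReal Topology Matrix Matrix.Norms.Frobenius

/-- The space of real `d × m` matrices. The norm `‖X‖` used below is the Euclidean (Frobenius)
norm. -/
abbrev Mat (d m : ℕ) := Matrix (Fin d) (Fin m) ℝ

/-- The Borel σ-algebra on matrices, as the product σ-algebra over the entries. -/
instance instMeasurableSpaceMat (d m : ℕ) : MeasurableSpace (Mat d m) :=
  inferInstanceAs (MeasurableSpace (Fin d → Fin m → ℝ))

noncomputable section

/-! ### Laminates -/

/-- `A` is the barycenter (center of mass) `∫ X dν(X)` of `ν`; the first moment is required to be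
finite. -/
def HasBarycenter {d m : ℕ} (ν : Measure (Mat d m)) (A : Mat d m) : Prop :=
  ∀ i j, Integrable (fun X : Mat d m => X i j) ν ∧ ∫ X : Mat d m, X i j ∂ν = A i j

/-- `μ` is obtained from `ν` by elementary splitting: `ν = l δ_A + (1 - l) ν'`, and
`μ = l (l' δ_B + (1 - l') δ_B') + (1 - l) ν'`, where `A = l' B + (1 - l') B'` and `B' - B` has
rank one. -/
def ElementarySplitting {d m : ℕ} (ν μ : Measure (Mat d m)) : Prop :=
  ∃ (ν' : Measure (Mat d m)) (A B B' : Mat d m) (l l' : ℝ),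
    IsProbabilityMeasure ν' ∧ l ∈ Icc (0 : ℝ) 1 ∧ l' ∈ Ioo (0 : ℝ) 1 ∧
    A = l' • B + (1 - l') • B' ∧ (B' - B).rank = 1 ∧
    ν = ENNReal.ofReal l • Measure.dirac A + ENNReal.ofReal (1 - l) • ν' ∧
    μ = ENNReal.ofReal l •
          (ENNReal.ofReal l' • Measure.dirac B + ENNReal.ofReal (1 - l') • Measure.dirac B') +
        ENNReal.ofReal (1 - l) • ν'

/-- Laminates of finite order: the smallest class of measures that contains all Dirac masses and is
invariant under elementary splitting. -/
inductive IsFiniteLaminate {d m : ℕ} : Measure (Mat d m) → Prop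
  | dirac (A : Mat d m) : IsFiniteLaminate (Measure.dirac A)
  | split {ν μ : Measure (Mat d m)} (hν : IsFiniteLaminate ν) (h : ElementarySplitting ν μ) :
      IsFiniteLaminate μ

/-- `β_n = γ_1 ⋯ γ_n`. The sequences are indexed from zero here: `γ n` and `μ n` are the
quantities usually called `γ_{n+1}` and `μ_{n+1}`. -/
def staircaseBeta (γ : ℕ → ℝ) (n : ℕ) : ℝ := ∏ k ∈ Finset.range n, γ k

/-- The finite-step staircase measure
`ν^N = ∑_{n=1}^N β_{n-1} (1 - γ_n) μ_n + β_N δ_{A_N}`. -/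
def staircaseStep {d m : ℕ} (A : ℕ → Mat d m) (μ : ℕ → Measure (Mat d m)) (γ : ℕ → ℝ) (N : ℕ) :
    Measure (Mat d m) :=
  ∑ n ∈ Finset.range N, ENNReal.ofReal (staircaseBeta γ n * (1 - γ n)) • μ n +
    ENNReal.ofReal (staircaseBeta γ N) • Measure.dirac (A N)

/-- `ν` is a staircase laminate supported in `K` with barycenter `A`: there are matrices
`A_n ∉ K` with `A_0 = A`, probability measures `μ_n` supported in `K` and numbers `γ_n ∈ (0,1)` such
that `ω_n = (1 - γ_n) μ_n + γ_n δ_{A_n}` is a laminate of finite order with barycenter `A_{n-1}`,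
`|A_n|` increases to infinity, `β_n → 0`, and `ν` is the setwise limit of the measures `ν^N`.
The last clause says that `A` is also the barycenter of the limit measure `ν` itself. -/
def IsStaircaseLaminate {d m : ℕ} (K : Set (Mat d m)) (A : Mat d m) (ν : Measure (Mat d m)) :
    Prop :=
  (∃ (As : ℕ → Mat d m) (μ : ℕ → Measure (Mat d m)) (γ : ℕ → ℝ),
    As 0 = A ∧
    (∀ n, As n ∉ K) ∧
    (∀ n, IsProbabilityMeasure (μ n) ∧ μ n Kᶜ = 0) ∧
    (∀ n, γ n ∈ Ioo (0 : ℝ) 1) ∧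
    (∀ n, IsFiniteLaminate
            (ENNReal.ofReal (1 - γ n) • μ n + ENNReal.ofReal (γ n) • Measure.dirac (As (n + 1))) ∧
          HasBarycenter
            (ENNReal.ofReal (1 - γ n) • μ n + ENNReal.ofReal (γ n) • Measure.dirac (As (n + 1)))
            (As n)) ∧
    Monotone (fun n => ‖As n‖) ∧
    Tendsto (fun n => ‖As n‖) atTop atTop ∧
    Tendsto (staircaseBeta γ) atTop (𝓝 0) ∧
    ∀ E : Set (Mat d m), MeasurableSet E →
      Tendsto (fun N => staircaseStep As μ γ N E) atTop (𝓝 (ν E))) ∧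
  HasBarycenter ν A

/-- `ν` is a finite mixture `∑_i λ_i δ_{B_i} + ∑_j κ_j ν_j`, where `∑_i λ_i δ_{B_i} + ∑_j κ_j δ_{C_j}`
is a laminate of finite order with barycenter `A`, all `B_i` lie in `K`, and each `ν_j` is a
staircase laminate supported in `K` with barycenter `C_j`. -/
def IsExtendedStaircaseLaminate {d m : ℕ} (K : Set (Mat d m)) (A : Mat d m)
    (ν : Measure (Mat d m)) : Prop :=
  ∃ (I J : ℕ) (lam : Fin I → ℝ) (B : Fin I → Mat d m) (kap : Fin J → ℝ) (C : Fin J → Mat d m)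
    (ν' : Fin J → Measure (Mat d m)),
    (∀ i, 0 ≤ lam i) ∧ (∀ j, 0 ≤ kap j) ∧
    IsFiniteLaminate (∑ i, ENNReal.ofReal (lam i) • Measure.dirac (B i) +
      ∑ j, ENNReal.ofReal (kap j) • Measure.dirac (C j)) ∧
    HasBarycenter (∑ i, ENNReal.ofReal (lam i) • Measure.dirac (B i) +
      ∑ j, ENNReal.ofReal (kap j) • Measure.dirac (C j)) A ∧
    (∀ i, B i ∈ K) ∧
    (∀ j, IsStaircaseLaminate K (C j) (ν' j)) ∧
    ν = ∑ i, ENNReal.ofReal (lam i) • Measure.dirac (B i) + ∑ j, ENNReal.ofReal (kap j) • ν' j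

/-! ### Domains and function spaces -/

/-- Regular domains: open, bounded, connected, with Lebesgue-null boundary. -/
structure IsRegularDomain {m : ℕ} (Ω : Set (EuclideanSpace ℝ (Fin m))) : Prop where
  isOpen : IsOpen Ω
  isBounded : Bornology.IsBounded Ω
  isConnected : IsConnected Ω
  volume_frontier : volume (frontier Ω) = 0

/-- The affine map `l_{A,b}(x) = A x + b`. -/
def affineMap {d m : ℕ} (A : Mat d m) (b : EuclideanSpace ℝ (Fin d))
    (x : EuclideanSpace ℝ (Fin m)) : EuclideanSpace ℝ (Fin d) :=
  WithLp.toLp 2 (A *ᵥ x.ofLp) + b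

/-- The `C^α` norm on a set `S`, with values in `[0,∞]`: the supremum of `|v|` over `S` plus the
`α`-Hölder seminorm of the restriction of `v` to `S`. (For `α = 0` the seminorm is the oscillation,
so that this is equivalent to the supremum norm.) -/
def holderNormOn {m d : ℕ} (α : ℝ≥0) (S : Set (EuclideanSpace ℝ (Fin m)))
    (v : EuclideanSpace ℝ (Fin m) → EuclideanSpace ℝ (Fin d)) : ℝ≥0∞ :=
  (⨆ x ∈ S, ‖v x‖ₑ) + eHolderNorm α (S.domRestrict v)

/-- `u ∈ C^α(S)`. -/
def MemHolderOn {m d : ℕ} (α : ℝ≥0) (S : Set (EuclideanSpace ℝ (Fin m)))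
    (u : EuclideanSpace ℝ (Fin m) → EuclideanSpace ℝ (Fin d)) : Prop :=
  ContinuousOn u S ∧ holderNormOn α S u < ⊤

/-- `u ∈ W^{1,1}(Ω)` with weak gradient `∇u = G`, where `(∇u)_{ij} = ∂_j u_i`. -/
structure IsSobolevW11 {m d : ℕ} (Ω : Set (EuclideanSpace ℝ (Fin m)))
    (u : EuclideanSpace ℝ (Fin m) → EuclideanSpace ℝ (Fin d))
    (G : EuclideanSpace ℝ (Fin m) → Mat d m) : Prop where
  integrable : IntegrableOn u Ω
  integrable_grad : ∀ i j, IntegrableOn (fun x => G x i j) Ω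
  weak_grad : ∀ φ : EuclideanSpace ℝ (Fin m) → ℝ, ContDiff ℝ (⊤ : ℕ∞) φ → HasCompactSupport φ →
    tsupport φ ⊆ Ω → ∀ i j,
      ∫ x in Ω, u x i * fderiv ℝ φ x (EuclideanSpace.single j 1) = -∫ x in Ω, G x i j * φ x

end

/-!
The map `u` is built by convex integration. For `H` of rank one, superposed tents on a tiling by
homothetic copies of a small thin polytope give a tiny Lipschitz perturbation with gradients in two
prescribed multiples of `H`, up to a small exceptional set on which the gradient still takes only
finitely many values. Substituting such perturbations into each other realizes the weights of every
laminate of finite order, and truncating a staircase laminate after many steps puts almost all of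
its mass in `K` while its remaining mass sits on one matrix of tiny weight.

Starting from the affine map, each stage modifies a piecewise affine map in two ways. Inside a small
ball it resolves one gradient so far along the staircase that the integral of `|∇u|^p` over the
part with gradient in `K` is at least two, which the heavy tail permits. Outside that ball it pushes
the unresolved gradients into `K`. Pieces with gradient in `K` are never touched again, apart from
sets of summable measure, so the gradients become stationary almost everywhere with limit in `K`.
Since every open set hosts infinitely many balls, over each of them the limit has infinite energy.
Measuring unresolved gradients by the price of resolving them keeps the changes of the gradient
summable in `L¹`.
-/

/-- Euclidean space of dimension `n`. -/
abbrev Euc (n : ℕ) := EuclideanSpace ℝ (Fin n)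

instance instMeasurableSingletonClassMat (d m : ℕ) : MeasurableSingletonClass (Mat d m) :=
  inferInstanceAs (MeasurableSingletonClass (Fin d → Fin m → ℝ))

/-! ### Locally affine maps -/

section LocallyAffine

variable {d m : ℕ} {u v : Euc m → Euc d} {X Y : Mat d m} {x : Euc m}

theorem affineMap_apply (A : Mat d m) (b : Euc d) (x : Euc m) (i : Fin d) :
    affineMap A b x i = ∑ j, A i j * x j + b i := by
  simp [affineMap, Matrix.mulVec, dotProduct]

theorem affineMap_add (A B : Mat d m) (b c : Euc d) (x : Euc m) :
    affineMap (A + B) (b + c) x = affineMap A b x + affineMap B c x := by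
  ext i
  simp only [affineMap_apply, PiLp.add_apply, Matrix.add_apply, add_mul, Finset.sum_add_distrib]
  ring

theorem affineMap_zero_left (b : Euc d) (x : Euc m) : affineMap (0 : Mat d m) b x = b := by
  ext i
  simp [affineMap_apply]

theorem exists_lipschitzWith_affineMap (A : Mat d m) (b : Euc d) :
    ∃ L, LipschitzWith L (affineMap A b) :=
  ⟨_, (LinearMap.toContinuousLinearMap (Matrix.toEuclideanLin A)).lipschitz.add
    (LipschitzWith.const b)⟩

/-- The open set of points near which `u` is affine with gradient `X`. -/
def affineSet (u : Euc m → Euc d) (X : Mat d m) : Set (Euc m) :=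
  {x | ∃ c, u =ᶠ[𝓝 x] affineMap X c}

theorem isOpen_affineSet (u : Euc m → Euc d) (X : Mat d m) : IsOpen (affineSet u X) := by
  rw [isOpen_iff_eventually]
  rintro x ⟨c, hc⟩
  filter_upwards [eventually_eventually_nhds.2 hc] with y hy using ⟨c, hy⟩

theorem measurableSet_affineSet (u : Euc m → Euc d) (X : Mat d m) :
    MeasurableSet (affineSet u X) := (isOpen_affineSet u X).measurableSet

theorem affineSet_congr (h : u =ᶠ[𝓝 x] v) : x ∈ affineSet u X ↔ x ∈ affineSet v X :=
  ⟨fun ⟨c, hc⟩ => ⟨c, h.symm.trans hc⟩, fun ⟨c, hc⟩ => ⟨c, h.trans hc⟩⟩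

theorem mem_affineSet_affineMap (A : Mat d m) (b : Euc d) (x : Euc m) :
    x ∈ affineSet (affineMap A b) A := ⟨b, EventuallyEq.rfl⟩

theorem mem_affineSet_zero (h : u =ᶠ[𝓝 x] 0) : x ∈ affineSet u 0 :=
  ⟨0, h.trans (Eventually.of_forall fun y => (affineMap_zero_left 0 y).symm)⟩

theorem add_mem_affineSet (hu : x ∈ affineSet u X) (hv : x ∈ affineSet v Y) :
    x ∈ affineSet (u + v) (X + Y) := by
  obtain ⟨c, hc⟩ := hu
  obtain ⟨c', hc'⟩ := hv
  refine ⟨c + c', ?_⟩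
  filter_upwards [hc, hc'] with y hy hy'
  rw [Pi.add_apply, hy, hy', affineMap_add]

/-- The matrix of partial derivatives of `u`. They are taken as line derivatives, which are
measurable functions for every continuous `u`. -/
noncomputable def grad (u : Euc m → Euc d) (x : Euc m) : Mat d m :=
  Matrix.of fun i j => lineDeriv ℝ (fun y => u y i) x (EuclideanSpace.single j 1)

theorem grad_congr (h : u =ᶠ[𝓝 x] v) : grad u x = grad v x := by
  ext i j
  simp only [grad, Matrix.of_apply]
  refine EventuallyEq.lineDeriv_eq ?_
  filter_upwards [h] with y hy
  rw [hy]

theorem grad_affineMap (A : Mat d m) (b : Euc d) (x : Euc m) : grad (affineMap A b) x = A := by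
  ext i j
  have hline : (fun t : ℝ => affineMap A b (x + t • EuclideanSpace.single j 1) i) =
      fun t : ℝ => affineMap A b x i + t * A i j := by
    funext t
    simp only [affineMap_apply, PiLp.add_apply, PiLp.smul_apply, mul_add, Finset.sum_add_distrib,
      PiLp.single_apply, smul_eq_mul, mul_ite, mul_one, mul_zero, Finset.sum_ite_eq',
      Finset.mem_univ, if_true]
    ring
  simp only [grad, Matrix.of_apply, lineDeriv, hline]
  simp

theorem grad_eq_of_mem_affineSet (h : x ∈ affineSet u X) : grad u x = X := by
  obtain ⟨c, hc⟩ := h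
  rw [grad_congr hc, grad_affineMap]

theorem affineSet_unique (hX : x ∈ affineSet u X) (hY : x ∈ affineSet u Y) : X = Y :=
  (grad_eq_of_mem_affineSet hX).symm.trans (grad_eq_of_mem_affineSet hY)

theorem disjoint_affineSet (u : Euc m → Euc d) (h : X ≠ Y) :
    Disjoint (affineSet u X) (affineSet u Y) :=
  Set.disjoint_left.2 fun _ hX hY => h (affineSet_unique hX hY)

theorem measurable_grad (hu : Continuous u) : Measurable (grad u) := by
  refine measurable_pi_iff.2 fun i => measurable_pi_iff.2 fun j => ?_
  have hui : Continuous fun y => u y i := by fun_prop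
  exact measurable_lineDeriv hui

end LocallyAffine

/-! ### Small perturbations -/

section Perturbation

variable {E F : Type*} [PseudoMetricSpace E] [SeminormedAddCommGroup F] {α τ τ₁ τ₂ : ℝ≥0}
  {U V : Set E} {w v : E → F}

/-- `w` is a Lipschitz map which vanishes outside `U`, and whose supremum and `α`-Hölder seminorm
are at most `τ`: the maps that are added to the current one in the construction. -/
structure IsPerturbation (α τ : ℝ≥0) (U : Set E) (w : E → F) : Prop where
  lip : ∃ L, LipschitzWith L w
  zero : ∀ x ∉ U, w x = 0
  bound : ∀ x, ‖w x‖ ≤ τ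
  holder : HolderWith τ α w

theorem IsPerturbation.mono (h : IsPerturbation α τ₁ U w) (hτ : τ₁ ≤ τ₂) (hU : U ⊆ V) :
    IsPerturbation α τ₂ V w :=
  ⟨h.lip, fun x hx => h.zero x fun hx' => hx (hU hx'), fun x =>
    (h.bound x).trans (by exact_mod_cast hτ), h.holder.mono hτ⟩

theorem IsPerturbation.add (h : IsPerturbation α τ₁ U w) (h' : IsPerturbation α τ₂ U v) :
    IsPerturbation α (τ₁ + τ₂) U (w + v) := by
  obtain ⟨L, hL⟩ := h.lip
  obtain ⟨L', hL'⟩ := h'.lip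
  refine ⟨⟨L + L', hL.add hL'⟩, fun x hx => ?_, fun x => ?_, h.holder.add h'.holder⟩
  · simp [h.zero x hx, h'.zero x hx]
  · exact (norm_add_le _ _).trans (by push_cast; exact add_le_add (h.bound x) (h'.bound x))

theorem IsPerturbation.of_zero : IsPerturbation α τ U (0 : E → F) :=
  ⟨⟨0, LipschitzWith.const' 0⟩, fun _ _ => rfl, fun _ => by simp, HolderWith.zero⟩

theorem IsPerturbation.sum {ι : Type*} (s : Finset ι) {t : ι → ℝ≥0} {W : ι → E → F}
    (h : ∀ i ∈ s, IsPerturbation α (t i) U (W i)) :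
    IsPerturbation α (∑ i ∈ s, t i) U (∑ i ∈ s, W i) := by
  classical
  induction s using Finset.induction_on with
  | empty => simpa using IsPerturbation.of_zero
  | insert a s ha ih =>
    rw [Finset.sum_insert ha, Finset.sum_insert ha]
    exact (h a (Finset.mem_insert_self _ _)).add
      (ih fun i hi => h i (Finset.mem_insert_of_mem hi))

theorem IsPerturbation.eventuallyEq_zero (h : IsPerturbation α τ U w) {x : E}
    (hx : x ∉ closure U) : w =ᶠ[𝓝 x] 0 := by
  filter_upwards [isClosed_closure.isOpen_compl.mem_nhds hx] with y hy
  exact h.zero y fun hy' => hy (subset_closure hy')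

theorem holderWith_of_norm_le_of_lipschitzWith (hα : α ≤ 1) {L η : ℝ≥0} (hb : ∀ x, ‖w x‖ ≤ η)
    (hL : LipschitzWith L w) : HolderWith ((2 * η) ^ ((1 : ℝ) - α) * L ^ (α : ℝ)) α w := by
  have hosc : HolderWith (2 * η) 0 w := fun x y => by
    have h : nndist (w x) (w y) ≤ 2 * η := by
      rw [← NNReal.coe_le_coe, coe_nndist]
      push_cast
      linarith [dist_le_norm_add_norm (w x) (w y), hb x, hb y]
    rw [edist_nndist]
    simpa using ENNReal.coe_le_coe.2 h
  simpa [NNReal.coe_sub hα] using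
    hosc.interpolate (holderWith_one.2 hL) (tsub_add_cancel_of_le hα)

theorem exists_isPerturbation_of_lipschitzWith (hα : α < 1) (L : ℝ≥0) (hτ : 0 < τ) :
    ∃ η : ℝ≥0, 0 < η ∧ ∀ (U : Set E) (w : E → F), LipschitzWith L w →
      (∀ x ∉ U, w x = 0) → (∀ x, ‖w x‖ ≤ η) → IsPerturbation α τ U w := by
  have hα' : (0 : ℝ) < 1 - α := sub_pos.2 (by exact_mod_cast hα)
  have hcont : Continuous fun η : ℝ≥0 => (2 * η) ^ ((1 : ℝ) - α) * L ^ (α : ℝ) :=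
    ((NNReal.continuous_rpow_const hα'.le).comp (by fun_prop)).mul continuous_const
  have hlim : Tendsto (fun η : ℝ≥0 => (2 * η) ^ ((1 : ℝ) - α) * L ^ (α : ℝ)) (𝓝[>] 0) (𝓝 0) := by
    simpa [NNReal.zero_rpow hα'.ne'] using (hcont.tendsto 0).mono_left nhdsWithin_le_nhds
  obtain ⟨η, ⟨hητ, hη⟩, hη0 : 0 < η⟩ :=
    ((hlim.eventually (gt_mem_nhds hτ)).and (nhdsWithin_le_nhds (gt_mem_nhds hτ))).and
      self_mem_nhdsWithin |>.exists
  exact ⟨η, hη0, fun U w hL h0 hb => ⟨⟨L, hL⟩, h0, fun x => (hb x).trans (by exact_mod_cast hη.le),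
    (holderWith_of_norm_le_of_lipschitzWith hα.le hb hL).mono hητ.le⟩⟩

end Perturbation

/-! ### Tents and tilings -/

section Tent

variable {E : Type*} [NormedAddCommGroup E] [InnerProductSpace ℝ E]

/-- The open set of points near which `H` is affine with slope `ξ`: the scalar analogue of
`affineSet`. -/
def slopeSet (H : E → ℝ) (ξ : E) : Set E := {x | ∃ c, H =ᶠ[𝓝 x] fun y => inner ℝ ξ y + c}

theorem isOpen_slopeSet (H : E → ℝ) (ξ : E) : IsOpen (slopeSet H ξ) :=
  isOpen_iff_eventually.2 fun _ ⟨c, hc⟩ => (eventually_eventually_nhds.2 hc).mono fun _ h => ⟨c, h⟩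

theorem slopeSet_congr {H H' : E → ℝ} {ξ x : E} (h : H =ᶠ[𝓝 x] H') :
    x ∈ slopeSet H ξ ↔ x ∈ slopeSet H' ξ :=
  ⟨fun ⟨c, hc⟩ => ⟨c, h.symm.trans hc⟩, fun ⟨c, hc⟩ => ⟨c, h.trans hc⟩⟩

variable {ι : Type*} [Fintype ι] [Nonempty ι] {ξ : ι → E} {c : ι → ℝ} {x : E}

/-- The minimum of finitely many affine functions. Its superlevel sets are the convex bodies by
scaled copies of which open sets are tiled. -/
def minAffine (ξ : ι → E) (c : ι → ℝ) (x : E) : ℝ :=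
  Finset.univ.inf' Finset.univ_nonempty fun k => inner ℝ (ξ k) x + c k

/-- The tent over the body `{x | 0 ≤ minAffine ξ c x}`: the positive part of the minimum of finitely
many affine functions. -/
def cutoff (ξ : ι → E) (c : ι → ℝ) (x : E) : ℝ := max 0 (minAffine ξ c x)

theorem minAffine_le (ξ : ι → E) (c : ι → ℝ) (x : E) (k : ι) :
    minAffine ξ c x ≤ inner ℝ (ξ k) x + c k :=
  Finset.inf'_le (fun k => inner ℝ (ξ k) x + c k) (Finset.mem_univ k)

theorem exists_minAffine_eq (ξ : ι → E) (c : ι → ℝ) (x : E) :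
    ∃ k, minAffine ξ c x = inner ℝ (ξ k) x + c k := by
  obtain ⟨k, -, hk⟩ := Finset.exists_mem_eq_inf' Finset.univ_nonempty
    (fun k => inner ℝ (ξ k) x + c k)
  exact ⟨k, hk⟩

theorem minAffine_eq_of_le {k : ι}
    (h : ∀ l, inner ℝ (ξ k) x + c k ≤ inner ℝ (ξ l) x + c l) :
    minAffine ξ c x = inner ℝ (ξ k) x + c k :=
  le_antisymm (minAffine_le ξ c x k) (Finset.le_inf' _ _ fun l _ => h l)

theorem lipschitzWith_minAffine (hξ : ∀ k, ‖ξ k‖ ≤ 1) (c : ι → ℝ) :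
    LipschitzWith 1 (minAffine ξ c) := by
  refine LipschitzWith.of_le_add fun x y => ?_
  obtain ⟨k, hk⟩ := exists_minAffine_eq ξ c y
  have hinner : inner ℝ (ξ k) (x - y) ≤ dist x y := by
    rw [dist_eq_norm]
    exact (real_inner_le_norm _ _).trans (mul_le_of_le_one_left (norm_nonneg _) (hξ k))
  rw [inner_sub_right] at hinner
  linarith [minAffine_le ξ c x k]

theorem lipschitzWith_cutoff (hξ : ∀ k, ‖ξ k‖ ≤ 1) (c : ι → ℝ) : LipschitzWith 1 (cutoff ξ c) :=
  (lipschitzWith_minAffine hξ c).const_max 0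

theorem cutoff_eq_zero (hx : ¬0 ≤ minAffine ξ c x) : cutoff ξ c x = 0 :=
  max_eq_left (not_le.1 hx).le

theorem mem_slopeSet_cutoff {k : ι}
    (h : minAffine ξ c =ᶠ[𝓝 x] fun y => inner ℝ (ξ k) y + c k) (hx : 0 < minAffine ξ c x) :
    x ∈ slopeSet (cutoff ξ c) (ξ k) := by
  have hcont : ContinuousAt (fun y => inner ℝ (ξ k) y + c k) x := by fun_prop
  have hpos : 0 < inner ℝ (ξ k) x + c k := hx.trans_eq h.self_of_nhds
  refine ⟨c k, ?_⟩
  filter_upwards [h, hcont.eventually (lt_mem_nhds hpos)] with y hy hy'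
  rw [cutoff, hy, max_eq_right hy'.le]

variable [FiniteDimensional ℝ E] [MeasurableSpace E] [BorelSpace E] (μ : Measure E)
  [μ.IsAddHaarMeasure]

theorem measure_setOf_inner_eq {η : E} (hη : η ≠ 0) (t : ℝ) : μ {x : E | inner ℝ η x = t} = 0 := by
  set p : E := (t / ‖η‖ ^ 2) • η
  have hp : inner ℝ η p = t := by
    rw [inner_smul_right, real_inner_self_eq_norm_sq]
    field_simp [norm_ne_zero_iff.2 hη]
  have htranslate : {x : E | inner ℝ η x = t} =
      (fun x => x + (-p)) ⁻¹' ((LinearMap.ker (innerₛₗ ℝ η) : Submodule ℝ E) : Set E) := by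
    ext x
    simp [← sub_eq_add_neg, inner_sub_right, hp, sub_eq_zero]
  rw [htranslate, measure_preimage_add_right]
  refine Measure.addHaar_submodule _ _ fun h => hη ?_
  have hmem : η ∈ LinearMap.ker (innerₛₗ ℝ η) := h ▸ Submodule.mem_top
  simpa using hmem

theorem ae_inner_add_ne {ξ ξ' : E} {c c' : ℝ} (h : ξ ≠ ξ' ∨ c ≠ c') :
    ∀ᵐ x ∂μ, inner ℝ ξ x + c ≠ inner ℝ ξ' x + c' := by
  by_cases hξ : ξ = ξ'
  · subst hξ
    exact Eventually.of_forall fun x hx => by simp_all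
  · rw [ae_iff]
    refine measure_mono_null (fun x hx => ?_)
      (measure_setOf_inner_eq μ (sub_ne_zero.2 hξ) (c' - c))
    simp only [ne_eq, not_not, mem_ofPred_eq, inner_sub_left] at hx ⊢
    linarith

theorem ae_exists_minAffine_eventuallyEq (ξ : ι → E) (c : ι → ℝ) :
    ∀ᵐ x ∂μ, ∃ k, minAffine ξ c =ᶠ[𝓝 x] fun y => inner ℝ (ξ k) y + c k := by
  have hsep : ∀ᵐ x ∂μ, ∀ k l, (ξ k ≠ ξ l ∨ c k ≠ c l) →
      inner ℝ (ξ k) x + c k ≠ inner ℝ (ξ l) x + c l := by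
    refine ae_all_iff.2 fun k => ae_all_iff.2 fun l => ?_
    by_cases hkl : ξ k ≠ ξ l ∨ c k ≠ c l
    · filter_upwards [ae_inner_add_ne μ hkl] with x hx _ using hx
    · exact Eventually.of_forall fun x h => absurd h hkl
  filter_upwards [hsep] with x hx
  obtain ⟨k, hk⟩ := exists_minAffine_eq ξ c x
  have hmin : ∀ l, ∀ᶠ y in 𝓝 x, inner ℝ (ξ k) y + c k ≤ inner ℝ (ξ l) y + c l := by
    intro l
    by_cases hkl : ξ k ≠ ξ l ∨ c k ≠ c l
    · have hlt : inner ℝ (ξ k) x + c k < inner ℝ (ξ l) x + c l :=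
        lt_of_le_of_ne (hk ▸ minAffine_le ξ c x l) (hx k l hkl)
      have hck : ContinuousAt (fun y => inner ℝ (ξ k) y + c k) x := by fun_prop
      have hcl : ContinuousAt (fun y => inner ℝ (ξ l) y + c l) x := by fun_prop
      exact (hck.eventually_lt hcl hlt).mono fun _ => le_of_lt
    · push Not at hkl
      simp [hkl.1, hkl.2]
  exact ⟨k, by filter_upwards [eventually_all.2 hmin] with y hy using minAffine_eq_of_le hy⟩

theorem ae_minAffine_ne_zero (hξ : ∀ k, ξ k ≠ 0) (c : ι → ℝ) : ∀ᵐ x ∂μ, minAffine ξ c x ≠ 0 := by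
  have h : ∀ᵐ x ∂μ, ∀ k, inner ℝ (ξ k) x + c k ≠ inner ℝ (0 : E) x + 0 :=
    ae_all_iff.2 fun k => ae_inner_add_ne μ (Or.inl (hξ k))
  filter_upwards [h] with x hx
  obtain ⟨k, hk⟩ := exists_minAffine_eq ξ c x
  rw [hk]
  simpa using hx k

theorem ae_exists_mem_slopeSet_cutoff (hξ : ∀ k, ξ k ≠ 0) (c : ι → ℝ) :
    ∀ᵐ x ∂μ, 0 ≤ minAffine ξ c x →
      0 < minAffine ξ c x ∧ ∃ k, x ∈ slopeSet (cutoff ξ c) (ξ k) := by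
  filter_upwards [ae_exists_minAffine_eventuallyEq μ ξ c, ae_minAffine_ne_zero μ hξ c]
    with x ⟨k, hk⟩ hne hx
  have hpos := lt_of_le_of_ne hx hne.symm
  exact ⟨hpos, k, mem_slopeSet_cutoff hk hpos⟩

end Tent

section Tiling

variable {E : Type*} [NormedAddCommGroup E] [NormedSpace ℝ E]

/-- The map that takes the copy of a body with position `a.1` and scale `a.2` back to the body
itself: the copy of `Q` is `rescale a ⁻¹' Q`. -/
noncomputable def rescale (a : E × ℝ) (x : E) : E := a.2⁻¹ • (x - a.1)

@[fun_prop]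
theorem continuous_rescale (a : E × ℝ) : Continuous (rescale a) := by
  unfold rescale
  fun_prop

theorem rescale_preimage_closedBall {a : E × ℝ} (ha : 0 < a.2) (s : ℝ) :
    rescale a ⁻¹' Metric.closedBall 0 s = Metric.closedBall a.1 (a.2 * s) := by
  ext x
  rw [mem_preimage, Metric.mem_closedBall, Metric.mem_closedBall, dist_zero_right, rescale,
    norm_smul, norm_inv, Real.norm_eq_abs, abs_of_pos ha, dist_eq_norm, inv_mul_le_iff₀ ha]

theorem lipschitzWith_mul_comp_rescale {F : E → ℝ} {L : ℝ≥0} (hF : LipschitzWith L F) {a : E × ℝ}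
    (ha : 0 < a.2) : LipschitzWith L fun x => a.2 * F (rescale a x) := by
  refine LipschitzWith.of_dist_le_mul fun x y => ?_
  have hdist : dist (rescale a x) (rescale a y) = a.2⁻¹ * dist x y := by
    rw [rescale, rescale, dist_smul₀, dist_sub_right, norm_inv, Real.norm_of_nonneg ha.le]
  calc dist (a.2 * F (rescale a x)) (a.2 * F (rescale a y))
      = a.2 * dist (F (rescale a x)) (F (rescale a y)) := by
        rw [Real.dist_eq, ← mul_sub, abs_mul, abs_of_pos ha, Real.dist_eq]
    _ ≤ a.2 * (L * dist (rescale a x) (rescale a y)) := by gcongr; exact hF.dist_le_mul _ _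
    _ = L * dist x y := by rw [hdist]; field_simp

theorem exists_rescale_preimage_subset {Q U : Set E} {D : ℝ} (hD : 0 < D)
    (hQD : Q ⊆ Metric.closedBall 0 D) (hU : IsOpen U) {x : E} (hx : x ∈ U) {ε : ℝ} (hε : 0 < ε) :
    ∃ r, 0 < r ∧ r ≤ ε ∧ rescale (x, r) ⁻¹' Q ⊆ U := by
  obtain ⟨s, hs, hsU⟩ := Metric.isOpen_iff.1 hU x hx
  set r := min ε (s / (2 * D))
  have hr : 0 < r := by positivity
  refine ⟨r, hr, min_le_left _ _, (preimage_mono hQD).trans ?_⟩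
  rw [rescale_preimage_closedBall (a := (x, r)) hr]
  refine (Metric.closedBall_subset_ball ?_).trans hsU
  calc r * D ≤ s / (2 * D) * D := by gcongr; exact min_le_right _ _
    _ = s / 2 := by field_simp
    _ < s := half_lt_self hs

theorem tsum_eq_of_disjoint {α ι : Type*} {h : ι → α → ℝ} {S : ι → Set α}
    (hS : Pairwise fun k l => Disjoint (S k) (S l)) (h0 : ∀ k, ∀ x ∉ S k, h k x = 0)
    {k : ι} {x : α} (hx : x ∈ S k) : ∑' l, h l x = h k x :=
  tsum_eq_single k fun l hl => h0 l x fun hxl => Set.disjoint_left.1 (hS hl) hxl hx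

theorem lipschitzWith_tsum_of_disjoint {α ι : Type*} [PseudoMetricSpace α] {L : ℝ≥0}
    {h : ι → α → ℝ} {S : ι → Set α}
    (hS : Pairwise fun k l => Disjoint (S k) (S l)) (h0 : ∀ k, ∀ x ∉ S k, h k x = 0)
    (hpos : ∀ k x, 0 ≤ h k x) (hL : ∀ k, LipschitzWith L (h k)) :
    LipschitzWith L fun x => ∑' k, h k x := by
  have hle : ∀ k y, h k y ≤ ∑' l, h l y := by
    intro k y
    by_cases hy : y ∈ S k
    · exact (tsum_eq_of_disjoint hS h0 hy).ge
    · exact (h0 k y hy).trans_le (tsum_nonneg fun l => hpos l y)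
  refine LipschitzWith.of_le_add_mul _ fun x y => ?_
  by_cases hx : ∃ k, x ∈ S k
  · obtain ⟨k, hk⟩ := hx
    rw [tsum_eq_of_disjoint hS h0 hk]
    linarith [hle k y, (le_abs_self _).trans ((hL k).dist_le_mul x y)]
  · push Not at hx
    simp only [h0 _ _ (hx _), tsum_zero]
    exact add_nonneg (tsum_nonneg fun l => hpos l y) (by positivity)

/-- The sum of the copies of the profile `F` over the tiles of `t`, scaled so as to keep the slopes
of `F`. -/
noncomputable def tileSum (F : E → ℝ) (t : Set (E × ℝ)) (x : E) : ℝ :=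
  ∑' a : t, a.1.2 * F (rescale a.1 x)

variable {Q U : Set E} {r₀ : ℝ} {t : Set (E × ℝ)} {F : E → ℝ}

theorem tileSum_eq_zero (hF0 : ∀ x ∉ Q, F x = 0) {x : E} (hx : ∀ a ∈ t, rescale a x ∉ Q) :
    tileSum F t x = 0 := by
  simp [tileSum, hF0 _ (hx _ (Subtype.prop _))]

variable [MeasurableSpace E]

/-- `t` is a set of positions and scales of disjoint copies of `Q`, of scale at most `r₀`, which
fill the set `U` up to a null set. -/
structure IsTiling (μ : Measure E) (Q U : Set E) (r₀ : ℝ) (t : Set (E × ℝ)) : Prop where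
  countable : t.Countable
  scale_pos : ∀ a ∈ t, 0 < a.2
  scale_le : ∀ a ∈ t, a.2 ≤ r₀
  subset : ∀ a ∈ t, rescale a ⁻¹' Q ⊆ U
  pairwiseDisjoint : t.PairwiseDisjoint fun a => rescale a ⁻¹' Q
  measure_diff : μ (U \ ⋃ a ∈ t, rescale a ⁻¹' Q) = 0

variable {μ : Measure E}

theorem IsTiling.ae_exists_mem (ht : IsTiling μ Q U r₀ t) (hU : MeasurableSet U) :
    ∀ᵐ x ∂μ.restrict U, ∃ a ∈ t, rescale a x ∈ Q := by
  rw [ae_restrict_iff' hU, ae_iff]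
  refine measure_mono_null (fun x hx => ?_) ht.measure_diff
  simpa using hx

theorem IsTiling.tileSum_eq (ht : IsTiling μ Q U r₀ t) (hF0 : ∀ x ∉ Q, F x = 0) {a : E × ℝ}
    (ha : a ∈ t) {x : E} (hx : rescale a x ∈ Q) : tileSum F t x = a.2 * F (rescale a x) :=
  tsum_eq_of_disjoint (h := fun (a : t) x => a.1.2 * F (rescale a.1 x)) (k := ⟨a, ha⟩)
    (S := fun a : t => rescale a.1 ⁻¹' Q)
    (fun a b hab => ht.pairwiseDisjoint a.2 b.2 fun h => hab (Subtype.ext h))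
    (fun a x hx => by rw [hF0 _ hx, mul_zero]) hx

theorem IsTiling.lipschitzWith_tileSum (ht : IsTiling μ Q U r₀ t) {L : ℝ≥0}
    (hF : LipschitzWith L F) (hF0 : ∀ x ∉ Q, F x = 0) (hpos : ∀ x, 0 ≤ F x) :
    LipschitzWith L (tileSum F t) :=
  lipschitzWith_tsum_of_disjoint (S := fun a : t => rescale a.1 ⁻¹' Q)
    (fun a b hab => ht.pairwiseDisjoint a.2 b.2 fun h => hab (Subtype.ext h))
    (fun a x hx => by rw [hF0 _ hx, mul_zero])
    (fun a x => mul_nonneg (ht.scale_pos a.1 a.2).le (hpos _))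
    fun a => lipschitzWith_mul_comp_rescale hF (ht.scale_pos a.1 a.2)

theorem IsTiling.abs_tileSum_le (ht : IsTiling μ Q U r₀ t) (hr₀ : 0 ≤ r₀)
    (hF0 : ∀ x ∉ Q, F x = 0) {S : ℝ} (hS : ∀ x, |F x| ≤ S) (x : E) :
    |tileSum F t x| ≤ r₀ * S := by
  by_cases hx : ∃ a ∈ t, rescale a x ∈ Q
  · obtain ⟨a, ha, hax⟩ := hx
    rw [ht.tileSum_eq hF0 ha hax, abs_mul, abs_of_pos (ht.scale_pos a ha)]
    exact mul_le_mul (ht.scale_le a ha) (hS _) (abs_nonneg _) hr₀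
  · push Not at hx
    rw [tileSum_eq_zero hF0 hx, abs_zero]
    exact mul_nonneg hr₀ ((abs_nonneg _).trans (hS 0))

variable [FiniteDimensional ℝ E] [BorelSpace E] (μ) [μ.IsAddHaarMeasure]

theorem measure_rescale_preimage {a : E × ℝ} (ha : 0 < a.2) (S : Set E) :
    μ (rescale a ⁻¹' S) = ENNReal.ofReal (a.2 ^ Module.finrank ℝ E) * μ S := by
  have hcomp : rescale a ⁻¹' S = (fun x => x + (-a.1)) ⁻¹' ((fun x => a.2⁻¹ • x) ⁻¹' S) := by
    ext x; simp [rescale, sub_eq_add_neg]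
  rw [hcomp, measure_preimage_add_right, Measure.addHaar_preimage_smul _ (inv_ne_zero ha.ne')]
  simp [abs_of_pos ha]

theorem ae_rescale {p : E → Prop} (hp : ∀ᵐ x ∂μ, p x) {a : E × ℝ} (ha : 0 < a.2) :
    ∀ᵐ x ∂μ, p (rescale a x) := by
  have h := measure_rescale_preimage μ ha {x | ¬p x}
  rwa [ae_iff.1 hp, mul_zero] at h

theorem exists_isTiling (hQ : IsClosed Q) (hQi : (interior Q).Nonempty)
    (hQb : Bornology.IsBounded Q) (hU : IsOpen U) (hr₀ : 0 < r₀) :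
    ∃ t, IsTiling μ Q U r₀ t := by
  obtain ⟨D, hD, hQD⟩ := hQb.subset_closedBall_lt 0 0
  have hQpos : μ Q ≠ 0 := (Measure.measure_pos_of_nonempty_interior _ hQi).ne'
  set C : ℝ≥0 := (μ (Metric.closedBall (0 : E) (3 * D)) / μ Q).toNNReal
  have hC : (C : ℝ≥0∞) = μ (Metric.closedBall (0 : E) (3 * D)) / μ Q :=
    ENNReal.coe_toNNReal (ENNReal.div_ne_top measure_closedBall_lt_top.ne hQpos)
  have hball : ∀ a : E × ℝ, 0 < a.2 →
      μ (Metric.closedBall a.1 (3 * (a.2 * D))) ≤ C * μ (rescale a ⁻¹' Q) := fun a ha => by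
    rw [show 3 * (a.2 * D) = a.2 * (3 * D) by ring, ← rescale_preimage_closedBall ha,
      measure_rescale_preimage μ ha, measure_rescale_preimage μ ha, hC, mul_left_comm,
      ENNReal.div_mul_cancel hQpos hQb.measure_lt_top.ne]
  have hfine : ∀ x ∈ U, ∀ ε > 0, ∃ a ∈ {a : E × ℝ | 0 < a.2 ∧ a.2 ≤ r₀ ∧ rescale a ⁻¹' Q ⊆ U},
      a.2 * D ≤ ε ∧ a.1 = x := by
    intro x hx ε hε
    obtain ⟨r, hr, hrε, hrU⟩ :=
      exists_rescale_preimage_subset hD hQD hU hx (lt_min hr₀ (div_pos hε hD))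
    exact ⟨(x, r), ⟨hr, hrε.trans (min_le_left _ _), hrU⟩,
      (le_div_iff₀ hD).1 (hrε.trans (min_le_right _ _)), rfl⟩
  obtain ⟨t, ht, htc, htd, ht0⟩ := Vitali.exists_disjoint_covering_ae μ U
    {a : E × ℝ | 0 < a.2 ∧ a.2 ≤ r₀ ∧ rescale a ⁻¹' Q ⊆ U} C (fun a => a.2 * D) Prod.fst
    (fun a => rescale a ⁻¹' Q)
    (fun a ha => rescale_preimage_closedBall ha.1 D ▸ preimage_mono hQD)
    (fun a ha => hball a ha.1)
    (fun a ha => by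
      obtain ⟨y, hy⟩ := hQi
      refine ⟨a.1 + a.2 • y,
        preimage_interior_subset_interior_preimage (continuous_rescale a) ?_⟩
      simpa [rescale, smul_smul, inv_mul_cancel₀ ha.1.ne'] using hy)
    (fun a _ => hQ.preimage (continuous_rescale a)) hfine
  exact ⟨t, htc, fun a ha => (ht ha).1, fun a ha => (ht ha).2.1, fun a ha => (ht ha).2.2, htd,
    ht0⟩

variable {μ}

theorem IsTiling.mul_measure_le (ht : IsTiling μ Q U r₀ t) {P : Set E} (hPQ : P ⊆ Q)
    (hP : MeasurableSet P) {θ : ℝ≥0∞} (hθ : θ * μ Q ≤ μ P) :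
    θ * μ U ≤ μ (⋃ a ∈ t, rescale a ⁻¹' P) := by
  have := ht.countable.to_subtype
  have hcover : μ U ≤ ∑' a : t, μ (rescale a.1 ⁻¹' Q) := by
    refine (measure_le_inter_add_sdiff μ U (⋃ a ∈ t, rescale a ⁻¹' Q)).trans ?_
    rw [ht.measure_diff, add_zero, biUnion_eq_iUnion]
    exact (measure_mono inter_subset_right).trans (measure_iUnion_le _)
  rw [measure_biUnion ht.countable
    (fun a ha b hb hab => (ht.pairwiseDisjoint ha hb hab).mono (preimage_mono hPQ)
      (preimage_mono hPQ)) fun a _ => hP.preimage (continuous_rescale a).measurable]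
  calc θ * μ U ≤ ∑' a : t, θ * μ (rescale a.1 ⁻¹' Q) := by
        rw [ENNReal.tsum_mul_left]; gcongr
    _ ≤ ∑' a : t, μ (rescale a.1 ⁻¹' P) := ENNReal.tsum_le_tsum fun a => by
        have ha := ht.scale_pos a.1 a.2
        rw [measure_rescale_preimage μ ha, measure_rescale_preimage μ ha, mul_left_comm]
        gcongr

end Tiling

section TentSum

variable {E : Type*} [NormedAddCommGroup E] [InnerProductSpace ℝ E]

theorem mem_slopeSet_rescale {F : E → ℝ} {ξ x : E} {a : E × ℝ} (ha : a.2 ≠ 0)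
    (h : rescale a x ∈ slopeSet F ξ) : x ∈ slopeSet (fun y => a.2 * F (rescale a y)) ξ := by
  obtain ⟨c, hc⟩ := h
  refine ⟨a.2 * c - inner ℝ ξ a.1, ?_⟩
  filter_upwards [(continuous_rescale a).continuousAt.eventually hc] with y hy
  rw [hy, rescale, inner_smul_right, inner_sub_right]
  field_simp
  ring

variable [MeasurableSpace E] {μ : Measure E} {Q U : Set E} {F : E → ℝ}

theorem IsTiling.mem_slopeSet_tileSum {r₀ : ℝ} {t : Set (E × ℝ)} (ht : IsTiling μ Q U r₀ t)
    (hF0 : ∀ x ∉ Q, F x = 0) {a : E × ℝ} (ha : a ∈ t) {x ξ : E} (hx : rescale a x ∈ interior Q)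
    (hξ : rescale a x ∈ slopeSet F ξ) : x ∈ slopeSet (tileSum F t) ξ := by
  refine (slopeSet_congr ?_).2 (mem_slopeSet_rescale (ht.scale_pos a ha).ne' hξ)
  filter_upwards [(continuous_rescale a).continuousAt.eventually (isOpen_interior.mem_nhds hx)]
    with y hy using ht.tileSum_eq hF0 ha (interior_subset hy)

variable [FiniteDimensional ℝ E] [BorelSpace E] [μ.IsAddHaarMeasure]

theorem exists_lipschitzWith_forall_slopeSet {ι : Type*} (hQ : IsClosed Q)
    (hQi : (interior Q).Nonempty) (hQb : Bornology.IsBounded Q) {L : ℝ≥0} (hF : LipschitzWith L F)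
    (hF0 : ∀ x ∉ Q, F x = 0) (hpos : ∀ x, 0 ≤ F x) {ξ : ι → E}
    (hξ : ∀ᵐ x ∂μ, x ∈ Q → x ∈ interior Q ∧ ∃ k, x ∈ slopeSet F (ξ k)) (hU : IsOpen U) {η : ℝ}
    (hη : 0 < η) :
    ∃ H : E → ℝ, LipschitzWith L H ∧ (∀ x ∉ U, H x = 0) ∧ (∀ x, |H x| ≤ η) ∧
      (∀ᵐ x ∂μ.restrict U, ∃ k, x ∈ slopeSet H (ξ k)) ∧
      ∀ (ζ : E) (θ : ℝ≥0∞), θ * μ Q ≤ μ (interior Q ∩ slopeSet F ζ) →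
        θ * μ U ≤ μ (U ∩ slopeSet H ζ) := by
  obtain ⟨S, hS⟩ := (Metric.isCompact_of_isClosed_isBounded hQ hQb).exists_bound_of_continuousOn
    hF.continuous.continuousOn
  have hFS : ∀ x, |F x| ≤ |S| + 1 := fun x => by
    by_cases hx : x ∈ Q
    · linarith [hS x hx, le_abs_self S, Real.norm_eq_abs (F x)]
    · rw [hF0 x hx, abs_zero]
      positivity
  obtain ⟨t, ht⟩ := exists_isTiling μ hQ hQi hQb hU (r₀ := η / (|S| + 1)) (by positivity)
  have := ht.countable.to_subtype
  refine ⟨tileSum F t, ht.lipschitzWith_tileSum hF hF0 hpos,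
    fun x hx => tileSum_eq_zero hF0 fun a ha hax => hx (ht.subset a ha hax),
    fun x => (ht.abs_tileSum_le (by positivity) hF0 hFS x).trans_eq (by field_simp), ?_,
    fun ζ θ hθ => ?_⟩
  · have hae : ∀ᵐ x ∂μ.restrict U, ∀ a : t, rescale a.1 x ∈ Q →
        rescale a.1 x ∈ interior Q ∧ ∃ k, rescale a.1 x ∈ slopeSet F (ξ k) :=
      ae_restrict_of_ae (ae_all_iff.2 fun a => ae_rescale μ hξ (ht.scale_pos a.1 a.2))
    filter_upwards [hae, ht.ae_exists_mem hU.measurableSet] with x hx ⟨a, ha, hax⟩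
    obtain ⟨hint, k, hk⟩ := hx ⟨a, ha⟩ hax
    exact ⟨k, ht.mem_slopeSet_tileSum hF0 ha hint hk⟩
  · refine (ht.mul_measure_le (inter_subset_left.trans interior_subset)
      (isOpen_interior.inter (isOpen_slopeSet F ζ)).measurableSet hθ).trans (measure_mono ?_)
    refine iUnion₂_subset fun a ha x hx =>
      ⟨ht.subset a ha (interior_subset (s := Q) hx.1), ?_⟩
    exact ht.mem_slopeSet_tileSum hF0 ha hx.1 hx.2

end TentSum

/-! ### The basic block -/

section Block

variable {E ι : Type*} [NormedAddCommGroup E] [InnerProductSpace ℝ E] [Fintype ι]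

theorem exists_orthonormalBasis_apply_eq [FiniteDimensional ℝ E]
    (hι : Module.finrank ℝ E = Fintype.card ι) {n : E} (hn : ‖n‖ = 1) (i₀ : ι) :
    ∃ b : OrthonormalBasis ι ℝ E, b i₀ = n := by
  have h : Orthonormal ℝ (({i₀} : Set ι).domRestrict fun _ => n) :=
    ⟨fun _ => by simpa using hn, fun _ _ hij => absurd (Subsingleton.elim _ _) hij⟩
  obtain ⟨b, hb⟩ := Orthonormal.exists_orthonormalBasis_extension_of_card_eq hι h
  exact ⟨b, hb i₀ rfl⟩

theorem exists_pow_sub_one_ge (N : ℕ) {ε : ℝ} (hε : 0 < ε) :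
    ∃ R : ℝ, 1 < R ∧ (1 - ε) * (2 * R) ^ N ≤ (2 * (R - 1)) ^ N := by
  have h0 : (0 : ℝ) ≤ N / ε := by positivity
  have hR : (0 : ℝ) < N / ε + 2 := by positivity
  refine ⟨N / ε + 2, by linarith, ?_⟩
  set R := N / ε + 2
  have hbernoulli : (1 : ℝ) + N * (-(1 / R)) ≤ (1 + -(1 / R)) ^ N := by
    refine one_add_mul_le_pow ?_ N
    have : 1 / R ≤ 1 := by rw [div_le_one hR]; linarith
    linarith
  have hNR : N * (1 / R) ≤ ε := by
    rw [mul_one_div, div_le_iff₀ hR]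
    have : ε * (N / ε) = N := by field_simp
    simp only [R]
    nlinarith
  have hfactor : 2 * (R - 1) = (1 + -(1 / R)) * (2 * R) := by field_simp; ring
  rw [hfactor, mul_pow (1 + -(1 / R))]
  exact mul_le_mul_of_nonneg_right (by linarith) (by positivity)

variable [DecidableEq ι] {b : OrthonormalBasis ι ℝ E} {i₀ : ι} {l R ε : ℝ} {σ : Bool}

/-- The points whose coordinate along `b i₀` lies in `I` and whose other coordinates lie in `J`. -/
noncomputable def coordBox (b : OrthonormalBasis ι ℝ E) (i₀ : ι) (I J : Set ℝ) : Set E :=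
  {x | ∀ i, inner ℝ (b i) x ∈ if i = i₀ then I else J}

theorem inner_mem_of_mem_coordBox {I J : Set ℝ} {x : E} (hx : x ∈ coordBox b i₀ I J) :
    inner ℝ (b i₀) x ∈ I := by
  simpa using hx i₀

theorem inner_mem_of_mem_coordBox_of_ne {I J : Set ℝ} {x : E} (hx : x ∈ coordBox b i₀ I J)
    {i : ι} (hi : i ≠ i₀) : inner ℝ (b i) x ∈ J := by
  simpa [hi] using hx i

theorem isOpen_coordBox {I J : Set ℝ} (hI : IsOpen I) (hJ : IsOpen J) :
    IsOpen (coordBox b i₀ I J) := by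
  rw [coordBox, ofPred_forall]
  refine isOpen_iInter_of_finite fun i => ?_
  refine IsOpen.preimage (f := fun x : E => (inner ℝ (b i) x : ℝ)) (by fun_prop) ?_
  split_ifs
  exacts [hI, hJ]

theorem isBounded_coordBox {I J : Set ℝ} (hI : Bornology.IsBounded I)
    (hJ : Bornology.IsBounded J) : Bornology.IsBounded (coordBox b i₀ I J) := by
  obtain ⟨C, hC⟩ := (hI.union hJ).exists_norm_le
  refine isBounded_iff_forall_norm_le.2 ⟨∑ _i : ι, C, fun x hx => ?_⟩
  rw [← b.sum_repr x]
  refine norm_sum_le_of_le _ fun i _ => ?_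
  rw [norm_smul, b.norm_eq_one, mul_one, b.repr_apply_apply]
  refine hC _ ?_
  have hi := hx i
  split_ifs at hi
  exacts [Or.inl hi, Or.inr hi]

theorem volume_coordBox [FiniteDimensional ℝ E] [MeasurableSpace E] [BorelSpace E]
    {I J : Set ℝ} (hI : MeasurableSet I) (hJ : MeasurableSet J) :
    volume (coordBox b i₀ I J) = volume I * volume J ^ (Fintype.card ι - 1) := by
  have hpres := ((PiLp.volume_preserving_ofLp ι).comp b.measurePreserving_repr)
  have hbox : coordBox b i₀ I J =
      (WithLp.ofLp ∘ b.repr) ⁻¹' (univ.pi fun i => if i = i₀ then I else J) := by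
    ext x
    simp [coordBox, b.repr_apply_apply]
  have hmeas : ∀ i, MeasurableSet (if i = i₀ then I else J) := fun i => by
    split_ifs
    exacts [hI, hJ]
  rw [hbox, hpres.measure_preimage (MeasurableSet.univ_pi hmeas).nullMeasurableSet,
    volume_pi_pi, ← Finset.mul_prod_erase _ _ (Finset.mem_univ i₀), if_pos rfl,
    Finset.prod_congr rfl fun i hi => by rw [if_neg (Finset.ne_of_mem_erase hi)],
    Finset.prod_const, Finset.card_erase_of_mem (Finset.mem_univ i₀), Finset.card_univ]

/-- The two slopes of the one-dimensional tent on `[-(1 - l), l]` with apex `l * (1 - l)` at `0`. -/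
noncomputable def tentSlope (l : ℝ) (σ : Bool) : ℝ := if σ then l else -(1 - l)

/-- The interval on which the one-dimensional tent has slope `tentSlope l σ`. -/
noncomputable def tentSide (l : ℝ) (σ : Bool) : Set ℝ := if σ then Ioo (-(1 - l)) 0 else Ioo 0 l

theorem isOpen_tentSide (l : ℝ) (σ : Bool) : IsOpen (tentSide l σ) := by
  cases σ <;> exact isOpen_Ioo

theorem tent_pos (hl : l ∈ Ioo (0 : ℝ) 1) {s : ℝ} (hs : s ∈ tentSide l σ) :
    0 < tentSlope l σ * s + l * (1 - l) := by
  obtain ⟨h0, h1⟩ := hl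
  cases σ
  all_goals
    simp only [tentSide, tentSlope, Bool.false_eq_true, if_true, if_false, mem_Ioo] at hs ⊢
    nlinarith

theorem tent_le_one (hl : l ∈ Ioo (0 : ℝ) 1) {s : ℝ} (hs : s ∈ tentSide l σ) :
    tentSlope l σ * s + l * (1 - l) ≤ 1 := by
  obtain ⟨h0, h1⟩ := hl
  cases σ
  all_goals
    simp only [tentSide, tentSlope, Bool.false_eq_true, if_true, if_false, mem_Ioo] at hs ⊢
    nlinarith

theorem tentSlope_mul_le {s : ℝ} (hs : s ∈ tentSide l σ) (τ : Bool) :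
    tentSlope l σ * s ≤ tentSlope l τ * s := by
  cases σ <;> cases τ
  all_goals
    simp only [tentSide, tentSlope, Bool.false_eq_true, if_true, if_false, mem_Ioo] at hs ⊢
    nlinarith

/-- The gradients of the basic block: a tent in the direction `b i₀`, cut off by functions of slope
one in the directions of the other basis vectors. -/
noncomputable def blockGrad (b : OrthonormalBasis ι ℝ E) (i₀ : ι) (l : ℝ) (k : ι × Bool) : E :=
  if k.1 = i₀ then tentSlope l k.2 • b i₀ else (if k.2 then (1 : ℝ) else -1) • b k.1

/-- The constants of the basic block. Its cut-off takes place at distance `R` from the axis. -/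
noncomputable def blockConst (i₀ : ι) (l R : ℝ) (k : ι × Bool) : ℝ :=
  if k.1 = i₀ then l * (1 - l) else R

theorem inner_blockGrad_add (x : E) (k : ι × Bool) :
    inner ℝ (blockGrad b i₀ l k) x + blockConst i₀ l R k =
      if k.1 = i₀ then tentSlope l k.2 * inner ℝ (b i₀) x + l * (1 - l)
      else (if k.2 then (1 : ℝ) else -1) * inner ℝ (b k.1) x + R := by
  unfold blockGrad blockConst
  split_ifs <;> simp [real_inner_smul_left]

theorem norm_blockGrad_le (b : OrthonormalBasis ι ℝ E) (i₀ : ι) (hl : l ∈ Ioo (0 : ℝ) 1)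
    (k : ι × Bool) : ‖blockGrad b i₀ l k‖ ≤ 1 := by
  obtain ⟨h0, h1⟩ := hl
  unfold blockGrad tentSlope
  split_ifs <;> rw [norm_smul, b.norm_eq_one, mul_one, Real.norm_eq_abs, abs_le] <;>
    constructor <;> linarith

theorem blockGrad_ne_zero (b : OrthonormalBasis ι ℝ E) (i₀ : ι) (hl : l ∈ Ioo (0 : ℝ) 1)
    (k : ι × Bool) : blockGrad b i₀ l k ≠ 0 := by
  obtain ⟨h0, h1⟩ := hl
  unfold blockGrad tentSlope
  split_ifs <;> refine smul_ne_zero ?_ (b.orthonormal.ne_zero _) <;> linarith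

variable [Nonempty ι]

/-- The convex body on which the basic block lives. -/
noncomputable def blockBody (b : OrthonormalBasis ι ℝ E) (i₀ : ι) (l R : ℝ) : Set E :=
  {x | 0 ≤ minAffine (blockGrad b i₀ l) (blockConst i₀ l R) x}

/-- The basic block: a tent over `blockBody`. -/
noncomputable def block (b : OrthonormalBasis ι ℝ E) (i₀ : ι) (l R : ℝ) : E → ℝ :=
  cutoff (blockGrad b i₀ l) (blockConst i₀ l R)

theorem lipschitzWith_block (b : OrthonormalBasis ι ℝ E) (i₀ : ι) (hl : l ∈ Ioo (0 : ℝ) 1)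
    (R : ℝ) : LipschitzWith 1 (block b i₀ l R) :=
  lipschitzWith_cutoff (norm_blockGrad_le b i₀ hl) _

theorem isClosed_blockBody (hl : l ∈ Ioo (0 : ℝ) 1) : IsClosed (blockBody b i₀ l R) :=
  isClosed_le continuous_const (lipschitzWith_minAffine (norm_blockGrad_le b i₀ hl) _).continuous

theorem mem_interior_blockBody (hl : l ∈ Ioo (0 : ℝ) 1) {x : E}
    (hx : 0 < minAffine (blockGrad b i₀ l) (blockConst i₀ l R) x) :
    x ∈ interior (blockBody b i₀ l R) :=
  interior_maximal (fun _ hy => le_of_lt hy) (isOpen_lt continuous_const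
    (lipschitzWith_minAffine (norm_blockGrad_le b i₀ hl) _).continuous) hx

theorem zero_mem_interior_blockBody (hl : l ∈ Ioo (0 : ℝ) 1) (hR : 0 < R) :
    0 ∈ interior (blockBody b i₀ l R) := by
  obtain ⟨k, hk⟩ := exists_minAffine_eq (blockGrad b i₀ l) (blockConst i₀ l R) 0
  refine mem_interior_blockBody hl ?_
  rw [hk, inner_zero_right, zero_add, blockConst]
  split_ifs
  exacts [mul_pos hl.1 (sub_pos.2 hl.2), hR]

theorem blockBody_subset (hl : l ∈ Ioo (0 : ℝ) 1) :
    blockBody b i₀ l R ⊆ coordBox b i₀ (Icc (-(1 - l)) l) (Icc (-R) R) := by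
  obtain ⟨h0, h1⟩ := hl
  intro x hx i
  have ht := hx.trans (minAffine_le _ _ x (i, true))
  have hf := hx.trans (minAffine_le _ _ x (i, false))
  rw [inner_blockGrad_add] at ht hf
  by_cases hi : i = i₀
  · subst hi
    simp only [tentSlope, if_true, Bool.false_eq_true, if_false] at ht hf ⊢
    constructor <;> nlinarith
  · simp only [if_neg hi, if_true, Bool.false_eq_true, if_false] at ht hf ⊢
    constructor <;> linarith

theorem minAffine_block_eq (hl : l ∈ Ioo (0 : ℝ) 1) {x : E}
    (hx : x ∈ coordBox b i₀ (tentSide l σ) (Ioo (-(R - 1)) (R - 1))) :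
    minAffine (blockGrad b i₀ l) (blockConst i₀ l R) x =
      inner ℝ (blockGrad b i₀ l (i₀, σ)) x + blockConst i₀ l R (i₀, σ) := by
  have hx₀ := inner_mem_of_mem_coordBox hx
  refine minAffine_eq_of_le fun k => ?_
  rw [inner_blockGrad_add, inner_blockGrad_add, if_pos rfl]
  by_cases hk : k.1 = i₀
  · rw [if_pos hk]
    linarith [tentSlope_mul_le hx₀ k.2]
  · rw [if_neg hk]
    have hxk := inner_mem_of_mem_coordBox_of_ne hx hk
    refine (tent_le_one hl hx₀).trans ?_
    cases k.2 <;> simp only [Bool.false_eq_true, if_false, if_true] <;> linarith [hxk.1, hxk.2]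

theorem coordBox_subset_slopeSet_block (hl : l ∈ Ioo (0 : ℝ) 1) :
    coordBox b i₀ (tentSide l σ) (Ioo (-(R - 1)) (R - 1)) ⊆
      interior (blockBody b i₀ l R) ∩ slopeSet (block b i₀ l R) (tentSlope l σ • b i₀) := by
  intro x hx
  have hpos : 0 < minAffine (blockGrad b i₀ l) (blockConst i₀ l R) x := by
    rw [minAffine_block_eq hl hx, inner_blockGrad_add, if_pos rfl]
    exact tent_pos hl (inner_mem_of_mem_coordBox hx)
  refine ⟨mem_interior_blockBody hl hpos, ?_⟩
  rw [show tentSlope l σ • b i₀ = blockGrad b i₀ l (i₀, σ) by simp [blockGrad]]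
  refine mem_slopeSet_cutoff ?_ hpos
  filter_upwards [(isOpen_coordBox (isOpen_tentSide l σ) isOpen_Ioo).mem_nhds hx] with y hy
  exact minAffine_block_eq hl hy

variable [FiniteDimensional ℝ E] [MeasurableSpace E] [BorelSpace E]

theorem ae_mem_slopeSet_block (hl : l ∈ Ioo (0 : ℝ) 1) (R : ℝ) :
    ∀ᵐ x : E, x ∈ blockBody b i₀ l R →
      x ∈ interior (blockBody b i₀ l R) ∧
        ∃ k, x ∈ slopeSet (block b i₀ l R) (blockGrad b i₀ l k) := by
  filter_upwards [ae_exists_mem_slopeSet_cutoff volume (blockGrad_ne_zero b i₀ hl)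
    (blockConst i₀ l R)] with x h hx
  exact ⟨mem_interior_blockBody hl (h hx).1, (h hx).2⟩

theorem le_volume_slopeSet_block (hl : l ∈ Ioo (0 : ℝ) 1) (hR : 1 < R)
    (hRε : (1 - ε) * (2 * R) ^ (Fintype.card ι - 1) ≤ (2 * (R - 1)) ^ (Fintype.card ι - 1))
    (σ : Bool) :
    volume (tentSide l σ) * ENNReal.ofReal (1 - ε) * volume (blockBody b i₀ l R) ≤
      volume (interior (blockBody b i₀ l R) ∩
        slopeSet (block b i₀ l R) (tentSlope l σ • b i₀)) := by
  have hR0 : 0 ≤ 2 * R := by linarith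
  have hR1 : 0 ≤ 2 * (R - 1) := by linarith
  refine (mul_le_mul_right (measure_mono (blockBody_subset hl)) _).trans
    (le_trans ?_ (measure_mono (coordBox_subset_slopeSet_block hl)))
  rw [volume_coordBox measurableSet_Icc measurableSet_Icc,
    volume_coordBox (isOpen_tentSide l σ).measurableSet measurableSet_Ioo, Real.volume_Icc,
    Real.volume_Icc, Real.volume_Ioo, mul_assoc, show l - -(1 - l) = 1 by ring,
    show R - -R = 2 * R by ring, show R - 1 - -(R - 1) = 2 * (R - 1) by ring, ENNReal.ofReal_one,
    one_mul, ← ENNReal.ofReal_pow hR0, ← ENNReal.ofReal_pow hR1,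
    ← ENNReal.ofReal_mul' (pow_nonneg hR0 _)]
  gcongr

theorem exists_lipschitzWith_tentSlope {n : E} (hn : ‖n‖ = 1) (hl : l ∈ Ioo (0 : ℝ) 1) :
    ∃ s : Finset E, ∀ {ε η : ℝ} {U : Set E}, 0 < ε → 0 < η → IsOpen U →
      ∃ H : E → ℝ, LipschitzWith 1 H ∧ (∀ x ∉ U, H x = 0) ∧ (∀ x, |H x| ≤ η) ∧
        (∀ᵐ x ∂volume.restrict U, ∃ ξ ∈ s, x ∈ slopeSet H ξ) ∧
        ∀ σ, volume (tentSide l σ) * ENNReal.ofReal (1 - ε) * volume U ≤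
          volume (U ∩ slopeSet H (tentSlope l σ • n)) := by
  classical
  have : Nontrivial E := ⟨n, 0, fun h => by simp [h] at hn⟩
  let i₀ : Fin (Module.finrank ℝ E) := ⟨0, Module.finrank_pos⟩
  have : Nonempty (Fin (Module.finrank ℝ E)) := ⟨i₀⟩
  obtain ⟨b, rfl⟩ := exists_orthonormalBasis_apply_eq (by simp) hn i₀
  refine ⟨Finset.univ.image (blockGrad b i₀ l), fun {ε η U} hε hη hU => ?_⟩
  obtain ⟨R, hR, hRε⟩ :=
    exists_pow_sub_one_ge (Fintype.card (Fin (Module.finrank ℝ E)) - 1) hε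
  obtain ⟨H, hL, h0, hη, hae, hvol⟩ := exists_lipschitzWith_forall_slopeSet
    (isClosed_blockBody hl) ⟨0, zero_mem_interior_blockBody hl (zero_lt_one.trans hR)⟩
    ((isBounded_coordBox (Metric.isBounded_Icc _ _) (Metric.isBounded_Icc _ _)).subset
      (blockBody_subset hl))
    (lipschitzWith_block b i₀ hl R) (fun _ => cutoff_eq_zero) (fun _ => le_max_left _ _)
    (ae_mem_slopeSet_block hl R) hU hη
  refine ⟨H, hL, h0, hη, hae.mono fun x ⟨k, hk⟩ =>
    ⟨_, Finset.mem_image_of_mem _ (Finset.mem_univ k), hk⟩,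
    fun σ => hvol _ _ (le_volume_slopeSet_block hl hR hRε σ)⟩

end Block

/-! ### Realizable weights -/

section Realizable

variable {d m : ℕ} {α : ℝ≥0}

/-- The finitely supported weights `f` are realizable at `A` if `A + ∇w` can take the value `X` on
a portion of volume almost `f X` of any given bounded open set, where `w` is a perturbation which
vanishes outside of this set, is small in `C^α`, and is such that `A + ∇w` takes almost everywhere
one of finitely many values depending on `A` and `f` only. -/
structure IsRealizable (α : ℝ≥0) (A : Mat d m) (f : Mat d m →₀ ℝ) : Prop where
  nonneg : ∀ X, 0 ≤ f X
  mass : Finsupp.linearCombination ℝ (fun _ => (1 : ℝ)) f = 1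
  mean : Finsupp.linearCombination ℝ id f = A
  exists_isPerturbation : ∃ F : Finset (Mat d m), f.support ⊆ F ∧
    ∀ (ε : ℝ) (τ : ℝ≥0) (U : Set (Euc m)), 0 < ε → 0 < τ → IsOpen U → Bornology.IsBounded U →
      ∃ w : Euc m → Euc d, IsPerturbation α τ U w ∧
        (∀ᵐ x ∂volume.restrict U, ∃ X ∈ F, x ∈ affineSet w (X - A)) ∧
        ∀ X, (1 - ε) * f X * volume.real U ≤ volume.real (U ∩ affineSet w (X - A))

theorem exists_vecMulVec_of_rank_eq_one {C : Mat d m} (hC : C.rank = 1) :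
    ∃ (a : Euc d) (n : Euc m), ‖n‖ = 1 ∧ C = Matrix.vecMulVec a n := by
  obtain ⟨⟨v, hv⟩, -, hspan⟩ := finrank_eq_one_iff'.1 hC
  have hcol : ∀ j, ∃ c : ℝ, ∀ i, C i j = v i * c := by
    intro j
    obtain ⟨c, hc⟩ := hspan ⟨C.mulVecLin (Pi.single j 1), ⟨_, rfl⟩⟩
    refine ⟨c, fun i => ?_⟩
    have hi := congrFun (congrArg Subtype.val hc) i
    simp only [SetLike.mk_smul_mk, Pi.smul_apply, smul_eq_mul, Matrix.mulVecLin_apply,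
      Matrix.mulVec_single, MulOpposite.op_one, Matrix.col_apply, one_smul] at hi
    linarith
  choose c hc using hcol
  set n : Euc m := WithLp.toLp 2 c
  have hn0 : ‖n‖ ≠ 0 := by
    rw [norm_ne_zero_iff]
    intro h
    have hC0 : C = 0 := by
      ext i j
      have : c j = 0 := congrFun (congrArg WithLp.ofLp h) j
      simp [hc, this]
    simp [hC0] at hC
  refine ⟨‖n‖ • WithLp.toLp 2 v, ‖n‖⁻¹ • n, ?_, ?_⟩
  · rw [norm_smul, norm_inv, norm_norm, inv_mul_cancel₀ hn0]
  · ext i j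
    simp only [Matrix.vecMulVec_apply, PiLp.smul_apply, smul_eq_mul, hc]
    rw [show n j = c j from rfl, mul_mul_mul_comm, mul_inv_cancel₀ hn0, one_mul]

theorem smul_mem_affineSet {H : Euc m → ℝ} {ξ x : Euc m} (h : x ∈ slopeSet H ξ) (a : Euc d) :
    x ∈ affineSet (fun y => H y • a) (Matrix.vecMulVec a ξ) := by
  obtain ⟨c, hc⟩ := h
  refine ⟨c • a, ?_⟩
  filter_upwards [hc] with y hy
  ext i
  rw [hy, affineMap_apply]
  simp only [Matrix.vecMulVec_apply, PiLp.smul_apply, smul_eq_mul, PiLp.inner_apply, add_mul,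
    Finset.sum_mul]
  congr 1
  refine Finset.sum_congr rfl fun j _ => ?_
  simp only [RCLike.inner_apply, Real.ringHom_apply]
  ring

theorem exists_isPerturbation_smul {E F : Type*} [PseudoMetricSpace E] [SeminormedAddCommGroup F]
    [NormedSpace ℝ F] (hα : α < 1) (a : F) {τ : ℝ≥0} (hτ : 0 < τ) :
    ∃ η : ℝ, 0 < η ∧ ∀ (U : Set E) (H : E → ℝ), LipschitzWith 1 H → (∀ x ∉ U, H x = 0) →
      (∀ x, |H x| ≤ η) → IsPerturbation α τ U fun x => H x • a := by
  obtain ⟨η, hη, hpert⟩ := exists_isPerturbation_of_lipschitzWith (E := E) (F := F) hα ‖a‖₊ hτ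
  refine ⟨η / (‖a‖ + 1), by positivity, fun U H hL h0 hb => hpert U _ ?_ ?_ ?_⟩
  · refine LipschitzWith.of_dist_le_mul fun x y => ?_
    rw [dist_eq_norm, ← sub_smul, norm_smul, mul_comm, coe_nnnorm]
    refine mul_le_mul_of_nonneg_left ?_ (norm_nonneg _)
    simpa [Real.dist_eq] using hL.dist_le_mul x y
  · exact fun x hx => by rw [h0 x hx, zero_smul]
  · intro x
    calc ‖H x • a‖ = |H x| * ‖a‖ := by rw [norm_smul, Real.norm_eq_abs]
      _ ≤ η / (‖a‖ + 1) * (‖a‖ + 1) := by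
        gcongr
        exacts [hb x, by linarith]
      _ = η := by field_simp

theorem exists_isPerturbation_tentSlope (hα : α < 1) (a : Euc d) {n : Euc m} (hn : ‖n‖ = 1) {l : ℝ}
    (hl : l ∈ Ioo (0 : ℝ) 1) :
    ∃ s : Finset (Mat d m), ∀ {ε : ℝ} {τ : ℝ≥0} {U : Set (Euc m)}, 0 < ε → 0 < τ → IsOpen U →
      Bornology.IsBounded U → ∃ w : Euc m → Euc d, IsPerturbation α τ U w ∧
        (∀ᵐ x ∂volume.restrict U, ∃ X ∈ s, x ∈ affineSet w X) ∧
        ∀ σ, (1 - ε) * volume.real (tentSide l σ) * volume.real U ≤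
          volume.real (U ∩ affineSet w (Matrix.vecMulVec a (tentSlope l σ • n).ofLp)) := by
  classical
  obtain ⟨s, hs⟩ := exists_lipschitzWith_tentSlope hn hl
  refine ⟨s.image fun ξ => Matrix.vecMulVec a ξ.ofLp, fun {ε τ U} hε hτ hU hUb => ?_⟩
  obtain ⟨η, hη, hpert⟩ := exists_isPerturbation_smul (E := Euc m) hα a hτ
  obtain ⟨H, hL, h0, hHη, hae, hvol⟩ := hs hε hη hU
  refine ⟨fun x => H x • a, hpert U H hL h0 hHη, hae.mono fun x ⟨ξ, hξ, hx⟩ =>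
    ⟨_, Finset.mem_image_of_mem _ hξ, smul_mem_affineSet hx a⟩, fun σ => ?_⟩
  have hle := ENNReal.toReal_mono
    ((measure_mono inter_subset_left).trans_lt hUb.measure_lt_top).ne
    ((hvol σ).trans (measure_mono (inter_subset_inter_right U
      fun x hx => smul_mem_affineSet hx a)))
  rw [ENNReal.toReal_mul, ENNReal.toReal_mul, ENNReal.toReal_ofReal'] at hle
  refine le_trans ?_ hle
  rw [mul_comm (1 - ε)]
  exact mul_le_mul_of_nonneg_right (mul_le_mul_of_nonneg_left (le_max_left _ _) measureReal_nonneg)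
    measureReal_nonneg

theorem isRealizable_twoPoint (hα : α < 1) {B B' : Mat d m} (hB : (B' - B).rank = 1)
    {l : ℝ} (hl : l ∈ Ioo (0 : ℝ) 1) :
    IsRealizable α (l • B + (1 - l) • B')
      (Finsupp.single B l + Finsupp.single B' (1 - l)) := by
  classical
  obtain ⟨a, n, hn, hC⟩ := exists_vecMulVec_of_rank_eq_one hB
  obtain ⟨s, hs⟩ := exists_isPerturbation_tentSlope hα a hn hl
  set A := l • B + (1 - l) • B' with hA
  set f := Finsupp.single B l + Finsupp.single B' (1 - l) with hf
  have hne : B ≠ B' := by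
    rintro rfl
    simp at hB
  have hval : ∀ X, f X = volume.real (tentSide l false) ∧
        X - A = Matrix.vecMulVec a (tentSlope l false • n).ofLp ∨
      f X = volume.real (tentSide l true) ∧
        X - A = Matrix.vecMulVec a (tentSlope l true • n).ofLp ∨ f X = 0 := by
    intro X
    simp only [WithLp.ofLp_smul, Matrix.vecMulVec_smul, ← hC, tentSlope, tentSide,
      Bool.false_eq_true, if_true, if_false, Real.volume_real_Ioo, zero_sub, sub_zero, neg_neg,
      max_eq_left hl.1.le, max_eq_left (sub_nonneg.2 hl.2.le)]
    obtain rfl | hX := eq_or_ne X B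
    · exact .inl ⟨by simp [hf, hne], by rw [hA]; module⟩
    obtain rfl | hX' := eq_or_ne X B'
    · exact .inr (.inl ⟨by simp [hf, hne.symm], by rw [hA]; module⟩)
    · exact .inr (.inr (by simp [hf, hX, hX']))
  refine ⟨fun X => ?_, by simp [hf], by simp [hf, hA, sub_smul],
    f.support ∪ s.image (A + ·), Finset.subset_union_left, fun ε τ U hε hτ hU hUb => ?_⟩
  · obtain ⟨h, -⟩ | ⟨h, -⟩ | h := hval X <;> rw [h]
    exacts [measureReal_nonneg, measureReal_nonneg]
  obtain ⟨w, hw, hae, hvol⟩ := hs hε hτ hU hUb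
  refine ⟨w, hw, hae.mono fun x ⟨Y, hY, hx⟩ => ⟨A + Y, Finset.mem_union_right _
    (Finset.mem_image_of_mem _ hY), by rwa [add_sub_cancel_left]⟩, fun X => ?_⟩
  obtain ⟨h, hX⟩ | ⟨h, hX⟩ | h := hval X
  · rw [h, hX]; exact hvol false
  · rw [h, hX]; exact hvol true
  · rw [h, mul_zero, zero_mul]; exact measureReal_nonneg

end Realizable

/-! ### Substitution -/

section Substitution

variable {E : Type*} [NormedAddCommGroup E] [NormedSpace ℝ E] [FiniteDimensional ℝ E]
  [Nontrivial E] [MeasurableSpace E] [BorelSpace E] {μ : Measure E} [μ.IsAddHaarMeasure]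
  {V : Set E}

theorem ae_norm_ne (s : ℝ) : ∀ᵐ x ∂μ, ‖x‖ ≠ s := by
  rw [ae_iff]
  refine measure_mono_null (fun x hx => ?_) (Measure.addHaar_sphere μ (0 : E) s)
  simpa using hx

theorem continuous_measureReal_inter_ball (hV : μ V ≠ ⊤) :
    Continuous fun s => μ.real (V ∩ Metric.ball 0 s) := by
  have : IsFiniteMeasure (μ.restrict V) := ⟨by simpa using hV.lt_top⟩
  have hint : ∀ s, μ.real (V ∩ Metric.ball 0 s) =
      ∫ x in V, (Metric.ball (0 : E) s).indicator (fun _ => (1 : ℝ)) x ∂μ := fun s => by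
    rw [integral_indicator_const _ Metric.isOpen_ball.measurableSet, smul_eq_mul, mul_one,
      measureReal_restrict_apply Metric.isOpen_ball.measurableSet, inter_comm]
  simp only [hint]
  refine continuous_iff_continuousAt.2 fun s =>
    continuousAt_of_dominated (bound := fun _ => 1) ?_ ?_ (integrable_const _) ?_
  · exact .of_forall fun t => aestronglyMeasurable_const.indicator Metric.isOpen_ball.measurableSet
  · exact .of_forall fun t => .of_forall fun x =>
      (norm_indicator_le_norm_self _ _).trans (by simp)
  filter_upwards [ae_restrict_of_ae (ae_norm_ne s)] with x hx
  rcases lt_or_gt_of_ne hx with h | h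
  · refine (continuousAt_const (y := (1 : ℝ))).congr ?_
    filter_upwards [lt_mem_nhds h] with t ht
    rw [indicator_of_mem (by simpa using ht)]
  · refine (continuousAt_const (y := (0 : ℝ))).congr ?_
    filter_upwards [gt_mem_nhds h] with t ht
    rw [indicator_of_notMem (by simpa using ht.le)]

theorem exists_isOpen_subset_measureReal_eq (hV : IsOpen V) (hVb : Bornology.IsBounded V) {θ : ℝ}
    (hθ : θ ∈ Icc (0 : ℝ) 1) :
    ∃ W ⊆ V, IsOpen W ∧ μ (frontier W ∩ V) = 0 ∧ μ.real W = θ * μ.real V := by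
  obtain ⟨D, hD, hVD⟩ := hVb.subset_ball_lt 0 0
  obtain ⟨s, -, hs⟩ := intermediate_value_Icc hD.le
    (continuous_measureReal_inter_ball (μ := μ) hVb.measure_lt_top.ne).continuousOn
    (show θ * μ.real V ∈ _ by
      simp only [Metric.ball_zero, inter_empty, measureReal_empty, inter_eq_left.2 hVD]
      exact ⟨mul_nonneg hθ.1 measureReal_nonneg,
        mul_le_of_le_one_left measureReal_nonneg hθ.2⟩)
  refine ⟨V ∩ Metric.ball 0 s, inter_subset_left, hV.inter Metric.isOpen_ball, ?_, hs⟩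
  refine measure_mono_null (fun x ⟨hx, hxV⟩ => ?_) (Measure.addHaar_sphere μ (0 : E) s)
  obtain ⟨hxs, hxi⟩ := (hV.inter Metric.isOpen_ball).frontier_eq ▸ hx
  exact le_antisymm
    (Metric.closure_ball_subset_closedBall (closure_mono inter_subset_right hxs))
    (not_lt.1 fun h => hxi ⟨hxV, h⟩)

end Substitution

section Patch

variable {d m : ℕ} {α τ : ℝ≥0} {A₀ A X : Mat d m} {U V : Set (Euc m)} {w₁ w₂ : Euc m → Euc d}
  {x : Euc m}

theorem mem_affineSet_add_of_notMem_closure (hw₂ : IsPerturbation α τ V w₂) (hx : x ∉ closure V)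
    (hX : x ∈ affineSet w₁ X) : x ∈ affineSet (w₁ + w₂) X := by
  simpa using add_mem_affineSet hX (mem_affineSet_zero (hw₂.eventuallyEq_zero hx))

theorem mem_affineSet_add_of_mem (hA : x ∈ affineSet w₁ (A - A₀)) (hX : x ∈ affineSet w₂ (X - A)) :
    x ∈ affineSet (w₁ + w₂) (X - A₀) := by
  simpa using add_mem_affineSet hA hX

theorem notMem_closure_of_mem_affineSet {Y : Mat d m} (hV : V ⊆ affineSet w₁ Y) (hXY : X ≠ Y)
    (hx : x ∈ affineSet w₁ X) : x ∉ closure V := fun hxV =>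
  Set.disjoint_left.1 (((disjoint_affineSet w₁ hXY).mono_right hV).closure_right
    (isOpen_affineSet _ _)) hx hxV

theorem measureReal_patch_le (hU : volume U ≠ ⊤) (hV : IsOpen V) (hVU : V ⊆ U)
    (hVA : V ⊆ affineSet w₁ (A - A₀)) (hw₂ : IsPerturbation α τ V w₂) (X : Mat d m) :
    volume.real ((U ∩ affineSet w₁ (X - A₀)) \ closure V) +
      volume.real (V ∩ affineSet w₂ (X - A)) ≤ volume.real (U ∩ affineSet (w₁ + w₂) (X - A₀)) := by
  rw [← measureReal_union (Set.disjoint_left.2 fun x hx hx' => hx.2 (subset_closure hx'.1))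
    (hV.inter (isOpen_affineSet _ _)).measurableSet
    (ne_top_of_le_ne_top hU (measure_mono fun x hx => hx.1.1))
    (ne_top_of_le_ne_top hU (measure_mono fun x hx => hVU hx.1))]
  refine measureReal_mono ?_ (ne_top_of_le_ne_top hU (measure_mono inter_subset_left))
  rintro x (⟨⟨hxU, hx⟩, hxV⟩ | ⟨hxV, hx⟩)
  · exact ⟨hxU, mem_affineSet_add_of_notMem_closure hw₂ hxV hx⟩
  · exact ⟨hVU hxV, mem_affineSet_add_of_mem (hVA hxV) hx⟩

theorem ae_exists_mem_affineSet_patch (hU : MeasurableSet U) (hV : IsOpen V)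
    (hVA : V ⊆ affineSet w₁ (A - A₀)) (hVf : volume (frontier V ∩ (U ∩ affineSet w₁ (A - A₀))) = 0)
    (hw₂ : IsPerturbation α τ V w₂) {F₁ F₂ : Set (Mat d m)}
    (h₁ : ∀ᵐ x ∂volume.restrict U, ∃ X ∈ F₁, x ∈ affineSet w₁ (X - A₀))
    (h₂ : ∀ᵐ x ∂volume.restrict V, ∃ X ∈ F₂, x ∈ affineSet w₂ (X - A)) :
    ∀ᵐ x ∂volume.restrict U, ∃ X ∈ F₁ ∪ F₂, x ∈ affineSet (w₁ + w₂) (X - A₀) := by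
  filter_upwards [h₁, ae_restrict_of_ae ((ae_restrict_iff' hV.measurableSet).1 h₂),
    ae_restrict_of_ae (measure_eq_zero_iff_ae_notMem.1 hVf), ae_restrict_mem hU]
    with x ⟨X, hX, hxX⟩ hx₂ hxf hxU
  by_cases hxV : x ∈ V
  · obtain ⟨Y, hY, hxY⟩ := hx₂ hxV
    exact ⟨Y, .inr hY, mem_affineSet_add_of_mem (hVA hxV) hxY⟩
  refine ⟨X, .inl hX, mem_affineSet_add_of_notMem_closure hw₂ (fun hcl => ?_) hxX⟩
  by_cases hXA : X = A
  · exact hxf ⟨⟨hcl, fun hi => hxV (interior_subset hi)⟩, hxU, hXA ▸ hxX⟩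
  · exact notMem_closure_of_mem_affineSet hVA (fun h => hXA (sub_left_injective h)) hxX hcl

theorem measureReal_sdiff_closure_of_frontier (hV : IsOpen V) (hVU : V ⊆ U) (hU : volume U ≠ ⊤)
    (hVf : volume (frontier V ∩ U) = 0) :
    volume.real (U \ closure V) = volume.real U - volume.real V := by
  have hcl : volume.real (U ∩ closure V) = volume.real V := by
    refine measureReal_congr (EventuallyLE.antisymm ?_ (LE.le.eventuallyLE fun x hx =>
      ⟨hVU hx, subset_closure hx⟩))
    filter_upwards [measure_eq_zero_iff_ae_notMem.1 hVf] with x hxf ⟨hxU, hxV⟩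
    by_contra hx
    exact hxf ⟨hV.frontier_eq ▸ ⟨hxV, hx⟩, hxU⟩
  rw [← hcl, ← measureReal_inter_add_sdiff isClosed_closure.measurableSet hU]
  ring

theorem mul_le_measureReal_sdiff_closure {h : Mat d m →₀ ℝ} {l θ ε : ℝ} (hU : volume U ≠ ⊤)
    (hθ : θ ≤ 1) (hθl : θ * (l + h A) = l)
    (hw₁ : ∀ X, (1 - ε) * (Finsupp.single A l + h) X * volume.real U ≤
      volume.real (U ∩ affineSet w₁ (X - A₀)))
    (hV : IsOpen V) (hVU : V ⊆ U ∩ affineSet w₁ (A - A₀))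
    (hVf : volume (frontier V ∩ (U ∩ affineSet w₁ (A - A₀))) = 0)
    (hVθ : volume.real V = θ * volume.real (U ∩ affineSet w₁ (A - A₀))) (X : Mat d m) :
    (1 - ε) * h X * volume.real U ≤ volume.real ((U ∩ affineSet w₁ (X - A₀)) \ closure V) := by
  have hfin : ∀ S, volume (U ∩ S) ≠ ⊤ := fun S =>
    ne_top_of_le_ne_top hU (measure_mono inter_subset_left)
  by_cases hXA : X = A
  · subst hXA
    have hX := hw₁ X
    rw [Finsupp.add_apply, Finsupp.single_eq_same] at hX
    rw [measureReal_sdiff_closure_of_frontier hV hVU (hfin _) hVf, hVθ]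
    calc (1 - ε) * h X * volume.real U
        = (1 - θ) * ((1 - ε) * (l + h X) * volume.real U) := by
          linear_combination (1 - ε) * volume.real U * hθl
      _ ≤ (1 - θ) * volume.real (U ∩ affineSet w₁ (X - A₀)) :=
          mul_le_mul_of_nonneg_left hX (by linarith)
      _ = _ := by ring
  · have hX := hw₁ X
    rw [Finsupp.add_apply, Finsupp.single_apply, if_neg (Ne.symm hXA), zero_add] at hX
    refine hX.trans (measureReal_mono (fun x hx => ⟨hx, ?_⟩)
      (ne_top_of_le_ne_top (hfin _) (measure_mono sdiff_subset)))
    exact notMem_closure_of_mem_affineSet (hVU.trans inter_subset_right)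
      (fun e => hXA (sub_left_injective e)) hx.2

theorem support_smul_add_subset {h ω : Mat d m →₀ ℝ} {l : ℝ} (hl : 0 ≤ l) (hh : ∀ X, 0 ≤ h X) :
    (l • ω + h).support ⊆ (Finsupp.single A l + h).support ∪ ω.support := by
  classical
  intro X hX
  simp only [Finset.mem_union, Finsupp.mem_support_iff, Finsupp.add_apply, Finsupp.single_apply,
    Finsupp.smul_apply, smul_eq_mul] at hX ⊢
  by_contra! H
  have hX0 : h X = 0 := le_antisymm (by have := H.1; split_ifs at this <;> linarith) (hh X)
  simp [H.2, hX0] at hX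

theorem exists_mem_Icc_mul_add_eq {a b : ℝ} (ha : 0 ≤ a) (hb : 0 ≤ b) :
    ∃ θ ∈ Icc (0 : ℝ) 1, θ * (a + b) = a := by
  obtain h0 | h0 := (add_nonneg ha hb).eq_or_lt
  · exact ⟨0, by simp, by linarith⟩
  · exact ⟨a / (a + b), ⟨by positivity, div_le_one_of_le₀ (le_add_of_nonneg_right hb) h0.le⟩,
      div_mul_cancel₀ _ h0.ne'⟩

theorem exists_mul_self_ge {ε : ℝ} (hε : 0 < ε) :
    ∃ δ > 0, δ ≤ 1 ∧ 1 - ε ≤ 1 - δ ∧ 1 - ε ≤ (1 - δ) * (1 - δ) := by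
  refine ⟨min (ε / 2) 1, by positivity, min_le_right _ _, ?_, ?_⟩ <;>
  nlinarith [min_le_left (ε / 2) 1, min_le_right (ε / 2) 1]

theorem IsRealizable.subst [Nonempty (Fin m)] {h ω : Mat d m →₀ ℝ} {l : ℝ}
    (hf : IsRealizable α A₀ (Finsupp.single A l + h)) (hl : 0 ≤ l) (hh : ∀ X, 0 ≤ h X)
    (hω : IsRealizable α A ω) : IsRealizable α A₀ (l • ω + h) := by
  classical
  have hmass := hf.mass
  have hmean := hf.mean
  rw [map_add, Finsupp.linearCombination_single] at hmass hmean
  obtain ⟨F₁, hF₁, hex₁⟩ := hf.exists_isPerturbation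
  obtain ⟨F₂, hF₂, hex₂⟩ := hω.exists_isPerturbation
  refine ⟨fun X => add_nonneg (mul_nonneg hl (hω.nonneg X)) (hh X), ?_, ?_, F₁ ∪ F₂,
    (support_smul_add_subset hl hh).trans (Finset.union_subset_union hF₁ hF₂),
    fun ε τ U hε hτ hU hUb => ?_⟩
  · rw [map_add, map_smul, hω.mass, hmass]
  · rw [map_add, map_smul, hω.mean]
    exact hmean
  obtain ⟨ε', hε', hε'1, hεε', hεsq⟩ := exists_mul_self_ge hε
  have hUfin : volume U ≠ ⊤ := hUb.measure_lt_top.ne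
  obtain ⟨w₁, hw₁, hae₁, hvol₁⟩ := hex₁ ε' (τ / 2) U hε' (by positivity) hU hUb
  obtain ⟨θ, hθ, hθl⟩ := exists_mem_Icc_mul_add_eq hl (hh A)
  -- Only a portion `θ` of the set `{A₀ + ∇w₁ = A}` is modified, since `h` may charge `A` as well.
  obtain ⟨V, hVU, hV, hVf, hVθ⟩ := exists_isOpen_subset_measureReal_eq (μ := volume)
    (hU.inter (isOpen_affineSet w₁ (A - A₀))) (hUb.subset inter_subset_left) hθ
  obtain ⟨w₂, hw₂, hae₂, hvol₂⟩ := hex₂ ε' (τ / 2) V hε' (by positivity) hV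
    (hUb.subset (hVU.trans inter_subset_left))
  have hVA := hVU.trans inter_subset_right
  have hae := ae_exists_mem_affineSet_patch (F₁ := F₁) (F₂ := F₂) hU.measurableSet hV hVA hVf hw₂
    hae₁ hae₂
  refine ⟨w₁ + w₂, by simpa using hw₁.add (hw₂.mono le_rfl (hVU.trans inter_subset_left)),
    by simpa using hae, fun X => ?_⟩
  have hold := mul_le_measureReal_sdiff_closure hUfin hθ.2 hθl hvol₁ hV hVU hVf hVθ X
  have hnew : (1 - ε') * ω X * ((1 - ε') * l * volume.real U) ≤
      volume.real (V ∩ affineSet w₂ (X - A)) := by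
    refine le_trans (mul_le_mul_of_nonneg_left ?_
      (mul_nonneg (by linarith) (hω.nonneg X))) (hvol₂ X)
    have hA := mul_le_mul_of_nonneg_left (hvol₁ A) hθ.1
    rw [Finsupp.add_apply, Finsupp.single_eq_same, ← hVθ] at hA
    linear_combination hA - (1 - ε') * volume.real U * hθl
  have hpatch := measureReal_patch_le hUfin hV (hVU.trans inter_subset_left) hVA hw₂ X
  refine le_trans ?_ ((add_le_add hold hnew).trans hpatch)
  rw [Finsupp.add_apply, Finsupp.smul_apply, smul_eq_mul]
  have hhU : 0 ≤ h X * volume.real U := mul_nonneg (hh X) measureReal_nonneg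
  have hωU : 0 ≤ ω X * l * volume.real U := by have := hω.nonneg X; positivity
  linear_combination mul_le_mul_of_nonneg_right hεsq hωU + mul_le_mul_of_nonneg_right hεε' hhU

end Patch

/-! ### Finitely supported measures and their weights -/

section HasWeights

theorem support_subset_support_add {ι : Type*} {k k' : ι →₀ ℝ} (hk : ∀ x, 0 ≤ k x)
    (hk' : ∀ x, 0 ≤ k' x) : k.support ⊆ (k + k').support := fun x hx =>
  Finsupp.mem_support_iff.2 (add_pos_of_pos_of_nonneg
    ((hk x).lt_of_ne (Finsupp.mem_support_iff.1 hx).symm) (hk' x)).ne'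

variable {S : Type*} [MeasurableSpace S] {ν ν' : Measure S} {k k' : S →₀ ℝ}

/-- The measure `ν` is the finite combination of Dirac masses with weights `k`. -/
structure HasWeights (ν : Measure S) (k : S →₀ ℝ) : Prop where
  nonneg : ∀ x, 0 ≤ k x
  compl : ν (↑k.support)ᶜ = 0
  singleton : ∀ x, ν {x} = ENNReal.ofReal (k x)

theorem HasWeights.unique (h : HasWeights ν k) (h' : HasWeights ν k') : k = k' := by
  ext x
  have hx := (h.singleton x).symm.trans (h'.singleton x)
  rwa [ENNReal.ofReal_eq_ofReal_iff (h.nonneg x) (h'.nonneg x)] at hx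

theorem HasWeights.add (h : HasWeights ν k) (h' : HasWeights ν' k') :
    HasWeights (ν + ν') (k + k') := by
  refine ⟨fun x => add_nonneg (h.nonneg x) (h'.nonneg x), ?_, fun x => ?_⟩
  · rw [Measure.add_apply, add_eq_zero]
    have hsub := support_subset_support_add h.nonneg h'.nonneg
    have hsub' := add_comm k k' ▸ support_subset_support_add h'.nonneg h.nonneg
    exact ⟨measure_mono_null (compl_subset_compl.2 (Finset.coe_subset.2 hsub)) h.compl,
      measure_mono_null (compl_subset_compl.2 (Finset.coe_subset.2 hsub')) h'.compl⟩
  · rw [Measure.add_apply, h.singleton, h'.singleton, Finsupp.add_apply,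
      ENNReal.ofReal_add (h.nonneg x) (h'.nonneg x)]

theorem HasWeights.smul (h : HasWeights ν k) {c : ℝ} (hc : 0 ≤ c) :
    HasWeights (ENNReal.ofReal c • ν) (c • k) := by
  refine ⟨fun x => mul_nonneg hc (h.nonneg x), ?_, fun x => ?_⟩
  · rw [Measure.smul_apply, smul_eq_mul, mul_eq_zero]
    obtain h0 | h0 := hc.eq_or_lt
    · left; simp [← h0]
    · right
      rw [Finsupp.support_smul_eq h0.ne']
      exact h.compl
  · rw [Measure.smul_apply, smul_eq_mul, h.singleton, Finsupp.smul_apply, smul_eq_mul,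
      ENNReal.ofReal_mul hc]

theorem HasWeights.of_zero : HasWeights (0 : Measure S) 0 :=
  ⟨fun _ => le_rfl, by simp, fun _ => by simp⟩

theorem HasWeights.sum {ι : Type*} (s : Finset ι) {ν : ι → Measure S}
    {k : ι → S →₀ ℝ} (h : ∀ i ∈ s, HasWeights (ν i) (k i)) :
    HasWeights (∑ i ∈ s, ν i) (∑ i ∈ s, k i) := by
  classical
  induction s using Finset.induction_on with
  | empty => simpa using HasWeights.of_zero
  | insert a s ha ih =>
    rw [Finset.sum_insert ha, Finset.sum_insert ha]
    exact (h a (Finset.mem_insert_self _ _)).add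
      (ih fun i hi => h i (Finset.mem_insert_of_mem hi))

theorem HasWeights.exists_of_le (h : HasWeights ν k) (hν : ν' ≤ ν) :
    ∃ k', HasWeights ν' k' := by
  classical
  have hlt : ∀ x, ν' {x} ≠ ⊤ := fun x =>
    ((hν {x}).trans_lt (by rw [h.singleton]; exact ENNReal.ofReal_lt_top)).ne
  have hsupp : ∀ x, ν'.real {x} ≠ 0 → x ∈ k.support := by
    intro x
    contrapose!
    intro hx
    refine (measureReal_eq_zero_iff (hlt x)).2 (le_zero_iff.1 ((hν {x}).trans ?_))
    rw [h.singleton, Finsupp.notMem_support_iff.1 hx, ENNReal.ofReal_zero]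
  refine ⟨Finsupp.onFinset k.support (fun x => ν'.real {x}) hsupp, fun x => measureReal_nonneg, ?_,
    fun x => (ENNReal.ofReal_toReal (hlt x)).symm⟩
  have hcompl : ν' (↑k.support)ᶜ = 0 := le_zero_iff.1 ((hν _).trans h.compl.le)
  have hnull : ν' (⋃ x ∈ k.support.filter fun x => ν'.real {x} = 0, {x}) = 0 :=
    (measure_biUnion_null_iff (Finset.countable_toSet _)).2 fun x hx =>
      (measureReal_eq_zero_iff (hlt x)).1 (Finset.mem_filter.1 hx).2
  refine measure_mono_null (fun x hx => ?_) (measure_union_null hcompl hnull)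
  by_cases hxk : x ∈ k.support
  · right
    simp only [Finsupp.support_onFinset, Finset.coe_filter, mem_compl_iff, mem_ofPred_eq, not_and,
      not_not] at hx
    simpa using ⟨Finsupp.mem_support_iff.1 hxk, hx hxk⟩
  · left; simpa using hxk

theorem HasWeights.restrict_support (h : HasWeights ν k) :
    ν.restrict (↑k.support : Set S) = ν :=
  Measure.restrict_eq_self_of_ae_mem h.compl

variable [MeasurableSingletonClass S]

theorem HasWeights.dirac (a : S) : HasWeights (Measure.dirac a) (Finsupp.single a 1) := by
  classical
  refine ⟨fun x => ?_, ?_, fun x => ?_⟩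
  · rw [Finsupp.single_apply]; split_ifs <;> norm_num
  · rw [Finsupp.support_single a one_ne_zero]
    simp
  · rw [Measure.dirac_apply' _ (measurableSet_singleton x), Finsupp.single_apply]
    by_cases h : a = x <;> simp [h]

theorem HasWeights.smul_dirac (a : S) {c : ℝ} (hc : 0 ≤ c) :
    HasWeights (ENNReal.ofReal c • Measure.dirac a) (Finsupp.single a c) := by
  simpa using (HasWeights.dirac a).smul hc

theorem HasWeights.isFiniteMeasure (h : HasWeights ν k) : IsFiniteMeasure ν := by
  refine ⟨?_⟩
  rw [← h.restrict_support, Measure.restrict_apply_univ, ← sum_measure_singleton]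
  refine ENNReal.sum_lt_top.2 fun x _ => ?_
  rw [h.singleton]
  exact ENNReal.ofReal_lt_top

theorem HasWeights.integral_eq {F : Type*} [NormedAddCommGroup F] [NormedSpace ℝ F]
    [CompleteSpace F] (h : HasWeights ν k) (g : S → F) :
    ∫ x, g x ∂ν = Finsupp.linearCombination ℝ g k := by
  have := h.isFiniteMeasure
  rw [← h.restrict_support, setIntegral_finset _ IntegrableOn.finset,
    Finsupp.linearCombination_apply, Finsupp.sum]
  refine Finset.sum_congr rfl fun x _ => ?_
  rw [Measure.real, h.singleton, ENNReal.toReal_ofReal (h.nonneg x)]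

theorem linearCombination_nonneg {ι : Type*} {φ : ι → ℝ} {k : ι →₀ ℝ} (hφ : ∀ x, 0 ≤ φ x)
    (hk : ∀ x, 0 ≤ k x) : 0 ≤ Finsupp.linearCombination ℝ φ k := by
  rw [Finsupp.linearCombination_apply, Finsupp.sum]
  exact Finset.sum_nonneg fun x _ => mul_nonneg (hk x) (hφ x)

theorem HasWeights.lintegral_eq (h : HasWeights ν k) {φ : S → ℝ} (hφ : ∀ x, 0 ≤ φ x) :
    ∫⁻ x, ENNReal.ofReal (φ x) ∂ν = ENNReal.ofReal (Finsupp.linearCombination ℝ φ k) := by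
  rw [← h.restrict_support, lintegral_finset, Finsupp.linearCombination_apply, Finsupp.sum,
    ENNReal.ofReal_sum_of_nonneg fun x _ => smul_nonneg (h.nonneg x) (hφ x)]
  refine Finset.sum_congr rfl fun x _ => ?_
  rw [h.singleton, smul_eq_mul, ENNReal.ofReal_mul (h.nonneg x), mul_comm]

end HasWeights

/-! ### Laminates of finite order are realizable -/

section FiniteLaminate

variable {d m : ℕ} {α : ℝ≥0}

theorem isRealizable_single (α : ℝ≥0) (A : Mat d m) : IsRealizable α A (Finsupp.single A 1) := by
  have haff : ∀ x : Euc m, x ∈ affineSet (0 : Euc m → Euc d) (A - A) := fun x => by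
    rw [sub_self]; exact mem_affineSet_zero EventuallyEq.rfl
  refine ⟨(HasWeights.dirac A).nonneg, by simp, by simp, {A}, Finsupp.support_single_subset,
    fun ε τ U hε _ _ _ => ⟨0, IsPerturbation.of_zero,
      .of_forall fun x => ⟨A, Finset.mem_singleton_self A, haff x⟩, fun X => ?_⟩⟩
  obtain rfl | hX := eq_or_ne A X
  · rw [inter_eq_left.2 fun x _ => haff x, Finsupp.single_eq_same, mul_one]
    exact mul_le_of_le_one_left measureReal_nonneg (by linarith)
  · simp [hX]

theorem IsFiniteLaminate.exists_weights [Nonempty (Fin m)] (hα : α < 1) {ν : Measure (Mat d m)}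
    (hν : IsFiniteLaminate ν) : ∃ f A, IsRealizable α A f ∧ HasWeights ν f := by
  induction hν with
  | dirac A => exact ⟨Finsupp.single A 1, A, isRealizable_single α A, HasWeights.dirac A⟩
  | @split ν μ _ h ih =>
    obtain ⟨f, A₀, hf, hw⟩ := ih
    obtain ⟨ν', A, B, B', l, l', -, hl, hl', hA, hB, hν, hμ⟩ := h
    obtain ⟨h, hh⟩ := hw.exists_of_le (ν' := ENNReal.ofReal (1 - l) • ν')
      (by rw [hν]; exact Measure.le_add_left le_rfl)
    have hf' : f = Finsupp.single A l + h :=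
      hw.unique (by rw [hν]; exact (HasWeights.smul_dirac A hl.1).add hh)
    subst hf' hA
    refine ⟨_, _, hf.subst hl.1 hh.nonneg (isRealizable_twoPoint hα hB hl'), ?_⟩
    rw [hμ]
    exact (((HasWeights.smul_dirac B hl'.1.le).add
      (HasWeights.smul_dirac B' (by linarith [hl'.2]))).smul hl.1).add hh

theorem HasWeights.mean_eq {ν : Measure (Mat d m)} {k : Mat d m →₀ ℝ} {A : Mat d m}
    (h : HasWeights ν k) (hA : HasBarycenter ν A) : Finsupp.linearCombination ℝ id k = A := by
  ext i j
  rw [← (hA i j).2, h.integral_eq]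
  simp only [Finsupp.linearCombination_apply, Finsupp.sum]
  simp [Matrix.sum_apply]

theorem IsFiniteLaminate.exists_isRealizable [Nonempty (Fin m)] (hα : α < 1)
    {ν : Measure (Mat d m)} {A : Mat d m} (hν : IsFiniteLaminate ν) (hA : HasBarycenter ν A) :
    ∃ f, IsRealizable α A f ∧ HasWeights ν f := by
  obtain ⟨f, B, hf, hw⟩ := hν.exists_weights hα
  have : A = B := (hw.mean_eq hA).symm.trans hf.mean
  exact ⟨f, this ▸ hf, hw⟩

end FiniteLaminate

/-! ### Staircases -/

section Staircase

variable {d m : ℕ} {α : ℝ≥0} {K : Set (Mat d m)} {A : Mat d m}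

/-- The integral of `φ` with respect to the finitely supported weights `f`. -/
noncomputable abbrev moment {ι : Type*} (φ : ι → ℝ) (f : ι →₀ ℝ) : ℝ :=
  Finsupp.linearCombination ℝ φ f

theorem frobenius_norm_single (i : Fin d) (j : Fin m) (a : ℝ) :
    ‖Matrix.single i j a‖ = |a| := by
  rw [Matrix.frobenius_norm_def, Finset.sum_eq_single i, Finset.sum_eq_single j]
  · rw [Matrix.single_apply_same, Real.norm_eq_abs, ← Real.sqrt_eq_rpow, Real.rpow_two,
      Real.sqrt_sq (abs_nonneg a)]
  all_goals simp +contextual [Matrix.single_apply, eq_comm]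

theorem norm_le_sum_abs (X : Mat d m) : ‖X‖ ≤ ∑ i, ∑ j, |X i j| := by
  conv_lhs => rw [Matrix.matrix_eq_sum_single X]
  refine (norm_sum_le _ _).trans (Finset.sum_le_sum fun i _ => (norm_sum_le _ _).trans_eq ?_)
  exact Finset.sum_congr rfl fun j _ => frobenius_norm_single i j _

theorem HasBarycenter.lintegral_norm_lt_top {ν : Measure (Mat d m)} (h : HasBarycenter ν A) :
    ∫⁻ X, ENNReal.ofReal ‖X‖ ∂ν < ⊤ := by
  have hint : Integrable (fun X : Mat d m => ∑ i, ∑ j, |X i j|) ν :=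
    integrable_finsetSum _ fun i _ => integrable_finsetSum _ fun j _ => (h i j).1.abs
  exact (lintegral_mono fun X => ENNReal.ofReal_le_ofReal (norm_le_sum_abs X)).trans_lt
    hint.lintegral_lt_top

theorem staircaseBeta_pos {γ : ℕ → ℝ} (h : ∀ n, γ n ∈ Ioo (0 : ℝ) 1) (n : ℕ) :
    0 < staircaseBeta γ n :=
  Finset.prod_pos fun i _ => (h i).1

theorem staircaseBeta_succ (γ : ℕ → ℝ) (n : ℕ) :
    staircaseBeta γ (n + 1) = staircaseBeta γ n * γ n := Finset.prod_range_succ _ _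

theorem staircaseBeta_shift (γ : ℕ → ℝ) (N n : ℕ) :
    staircaseBeta γ (n + N) = staircaseBeta γ N * staircaseBeta (fun n => γ (n + N)) n := by
  rw [add_comm n N, staircaseBeta, Finset.prod_range_add]
  simp only [staircaseBeta, add_comm]

/-- The combinatorial data of a staircase laminate supported in `K` with barycenter `A`: the
matrices `A_n` are the nodes, and `weights n` are the weights of `(1 - γ_n) μ_n`. Realizability
replaces the requirement that `(1 - γ_n) μ_n + γ_n δ_{A_{n+1}}` be a laminate of finite order. -/
structure Staircase (α : ℝ≥0) (K : Set (Mat d m)) (A : Mat d m) where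
  node : ℕ → Mat d m
  weights : ℕ → Mat d m →₀ ℝ
  ratio : ℕ → ℝ
  node_zero : node 0 = A
  nonneg : ∀ n X, 0 ≤ weights n X
  eq_zero : ∀ n, ∀ X ∉ K, weights n X = 0
  ratio_mem : ∀ n, ratio n ∈ Ioo (0 : ℝ) 1
  isRealizable : ∀ n,
    IsRealizable α (node n) (weights n + Finsupp.single (node (n + 1)) (ratio n))
  tendsto_beta : Tendsto (staircaseBeta ratio) atTop (𝓝 0)
  tendsto_norm : Tendsto (fun n => staircaseBeta ratio n * ‖node n‖) atTop (𝓝 0)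
  summable : Summable fun n => staircaseBeta ratio n * moment norm (weights n)

namespace Staircase

variable (S : Staircase α K A)

/-- The mass `β_n` which has not been split off before the `n`-th node. -/
abbrev beta (n : ℕ) : ℝ := staircaseBeta S.ratio n

/-- The first moment of the staircase laminate. -/
noncomputable def cost : ℝ := ∑' n, S.beta n * moment norm (S.weights n)

/-- The part on `K` of the `N`-th finite-step staircase measure. -/
noncomputable def trunc (N : ℕ) : Mat d m →₀ ℝ :=
  ∑ n ∈ Finset.range N, S.beta n • S.weights n

theorem beta_pos (n : ℕ) : 0 < S.beta n := staircaseBeta_pos S.ratio_mem n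

theorem beta_mul_moment_nonneg {φ : Mat d m → ℝ} (hφ : ∀ X, 0 ≤ φ X) (n : ℕ) :
    0 ≤ S.beta n * moment φ (S.weights n) :=
  mul_nonneg (S.beta_pos n).le (linearCombination_nonneg hφ (S.nonneg n))

theorem cost_nonneg : 0 ≤ S.cost := tsum_nonneg fun n => S.beta_mul_moment_nonneg norm_nonneg n

theorem trunc_nonneg (N : ℕ) (X : Mat d m) : 0 ≤ S.trunc N X := by
  rw [trunc, Finsupp.finsetSum_apply]
  exact Finset.sum_nonneg fun n _ => mul_nonneg (S.beta_pos n).le (S.nonneg n X)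

theorem trunc_eq_zero (N : ℕ) {X : Mat d m} (hX : X ∉ K) : S.trunc N X = 0 := by
  rw [trunc, Finsupp.finsetSum_apply]
  exact Finset.sum_eq_zero fun n _ => by simp [S.eq_zero n X hX]

theorem moment_trunc (φ : Mat d m → ℝ) (N : ℕ) :
    moment φ (S.trunc N) = ∑ n ∈ Finset.range N, S.beta n * moment φ (S.weights n) := by
  simp [trunc, map_sum]

theorem moment_norm_trunc_le (N : ℕ) : moment norm (S.trunc N) ≤ S.cost := by
  rw [moment_trunc]
  exact S.summable.sum_le_tsum _ fun n _ => S.beta_mul_moment_nonneg norm_nonneg n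

theorem isRealizable_trunc [Nonempty (Fin m)] (N : ℕ) :
    IsRealizable α A (S.trunc N + Finsupp.single (S.node N) (S.beta N)) := by
  rw [add_comm]
  induction N with
  | zero => simpa [staircaseBeta, trunc, S.node_zero] using isRealizable_single α A
  | succ N ih =>
    convert ih.subst (S.beta_pos N).le (S.trunc_nonneg N) (S.isRealizable N) using 1
    rw [trunc, Finset.sum_range_succ, beta, staircaseBeta_succ, smul_add, Finsupp.smul_single,
      smul_eq_mul, trunc]
    abel

/-- The staircase that starts at the `N`-th node. -/
def shift (N : ℕ) : Staircase α K (S.node N) :=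
  have hbeta : ∀ n, staircaseBeta (fun n => S.ratio (n + N)) n =
      (S.beta N)⁻¹ * S.beta (n + N) := fun n => by
    rw [beta, beta, staircaseBeta_shift, inv_mul_cancel_left₀ (S.beta_pos N).ne']
  { node n := S.node (n + N)
    weights n := S.weights (n + N)
    ratio n := S.ratio (n + N)
    node_zero := by rw [zero_add]
    nonneg n := S.nonneg _
    eq_zero n := S.eq_zero _
    ratio_mem n := S.ratio_mem _
    isRealizable n := by simpa only [add_right_comm] using S.isRealizable (n + N)
    tendsto_beta := by
      simp_rw [funext hbeta]
      simpa using ((tendsto_add_atTop_iff_nat N).2 S.tendsto_beta).const_mul (S.beta N)⁻¹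
    tendsto_norm := by
      simp_rw [hbeta, mul_assoc]
      simpa using ((tendsto_add_atTop_iff_nat N).2 S.tendsto_norm).const_mul (S.beta N)⁻¹
    summable := by
      simp_rw [hbeta, mul_assoc]
      exact ((summable_nat_add_iff N).2 S.summable).mul_left _ }

theorem beta_mul_cost_shift (N : ℕ) :
    S.beta N * (S.shift N).cost = ∑' n, S.beta (n + N) * moment norm (S.weights (n + N)) := by
  rw [cost, ← tsum_mul_left]
  refine tsum_congr fun n => ?_
  rw [← mul_assoc]
  congr 1
  exact (staircaseBeta_shift S.ratio N n).symm

end Staircase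

theorem eq_sum_of_tendsto_staircaseStep {As : ℕ → Mat d m} {μ : ℕ → Measure (Mat d m)} {γ : ℕ → ℝ}
    {ν : Measure (Mat d m)} (hγ : ∀ n, γ n ∈ Ioo (0 : ℝ) 1)
    (hβ : Tendsto (staircaseBeta γ) atTop (𝓝 0))
    (hlim : ∀ E : Set (Mat d m), MeasurableSet E →
      Tendsto (fun N => staircaseStep As μ γ N E) atTop (𝓝 (ν E))) :
    ν = Measure.sum fun n =>
      ENNReal.ofReal (staircaseBeta γ n) • ENNReal.ofReal (1 - γ n) • μ n := by
  ext E hE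
  rw [Measure.sum_apply _ hE]
  refine tendsto_nhds_unique (hlim E hE) ?_
  have hβ' : Tendsto (fun N => ENNReal.ofReal (staircaseBeta γ N)) atTop (𝓝 0) := by
    simpa using ENNReal.tendsto_ofReal hβ
  have hdirac : Tendsto (fun N => ENNReal.ofReal (staircaseBeta γ N) * Measure.dirac (As N) E)
      atTop (𝓝 0) :=
    tendsto_of_tendsto_of_tendsto_of_le_of_le tendsto_const_nhds hβ' (fun _ => bot_le)
      fun N => mul_le_of_le_one_right bot_le prob_le_one
  have hsum := (ENNReal.tendsto_nat_tsum fun n =>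
    (ENNReal.ofReal (staircaseBeta γ n) • ENNReal.ofReal (1 - γ n) • μ n) E).add hdirac
  rw [add_zero] at hsum
  refine hsum.congr fun N => ?_
  rw [staircaseStep, Measure.add_apply, Measure.finsetSum_apply, Measure.smul_apply, smul_eq_mul]
  simp_rw [ENNReal.ofReal_mul (staircaseBeta_pos hγ _).le, mul_smul]

theorem staircaseBeta_smul_eq_sub {V : Type*} [AddCommGroup V] [Module ℝ V] {γ : ℕ → ℝ}
    {a c : ℕ → V} (h : ∀ n, a n = c n + γ n • a (n + 1)) (N : ℕ) :
    staircaseBeta γ N • a N = a 0 - ∑ n ∈ Finset.range N, staircaseBeta γ n • c n := by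
  induction N with
  | zero => simp [staircaseBeta]
  | succ N ih =>
    rw [Finset.sum_range_succ, ← sub_sub, ← ih, h N, staircaseBeta_succ, mul_smul, smul_add,
      add_sub_cancel_left]

theorem HasBarycenter.hasSum_mean {ν : Measure (Mat d m)} (hν : HasBarycenter ν A) {β : ℕ → ℝ}
    (hβ : ∀ n, 0 ≤ β n) {μ : ℕ → Measure (Mat d m)} {k : ℕ → Mat d m →₀ ℝ}
    (hk : ∀ n, HasWeights (μ n) (k n))
    (hsum : ν = Measure.sum fun n => ENNReal.ofReal (β n) • μ n) :
    HasSum (fun n => β n • Finsupp.linearCombination ℝ id (k n)) A := by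
  refine Pi.hasSum.2 fun i => Pi.hasSum.2 fun j => ?_
  obtain ⟨hint, hmean⟩ := hν i j
  rw [hsum] at hint
  have hentry := hasSum_integral_measure hint
  rw [← hsum, hmean] at hentry
  refine hentry.congr_fun fun n => ?_
  rw [integral_smul_measure, (hk n).integral_eq, ENNReal.toReal_ofReal (hβ n)]
  simp [Finsupp.linearCombination_apply, Finsupp.sum, Matrix.sum_apply]

/-- The remainder `β_N A_N` tends to zero because the barycenters of the first `N` steps tend to
the barycenter of the staircase laminate, which is `A_0`. -/
theorem tendsto_staircaseBeta_mul_norm {ν : Measure (Mat d m)} {As : ℕ → Mat d m}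
    {μ : ℕ → Measure (Mat d m)} {k : ℕ → Mat d m →₀ ℝ} {γ : ℕ → ℝ} (hν : HasBarycenter ν (As 0))
    (hγ : ∀ n, γ n ∈ Ioo (0 : ℝ) 1) (hk : ∀ n, HasWeights (μ n) (k n))
    (hsum : ν = Measure.sum fun n => ENNReal.ofReal (staircaseBeta γ n) • μ n)
    (hmean : ∀ n, As n = Finsupp.linearCombination ℝ id (k n) + γ n • As (n + 1)) :
    Tendsto (fun n => staircaseBeta γ n * ‖As n‖) atTop (𝓝 0) := by
  have hβ : ∀ n, 0 ≤ staircaseBeta γ n := fun n => (staircaseBeta_pos hγ n).le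
  have hlim := (hν.hasSum_mean hβ hk hsum).tendsto_sum_nat.const_sub (As 0)
  simp_rw [← staircaseBeta_smul_eq_sub hmean, sub_self] at hlim
  simpa [norm_smul, abs_of_nonneg, hβ] using hlim.norm

theorem summable_staircaseBeta_mul_moment_norm {ν : Measure (Mat d m)} (hν : HasBarycenter ν A)
    {β : ℕ → ℝ} (hβ : ∀ n, 0 ≤ β n) {μ : ℕ → Measure (Mat d m)} {k : ℕ → Mat d m →₀ ℝ}
    (hk : ∀ n, HasWeights (μ n) (k n))
    (hsum : ν = Measure.sum fun n => ENNReal.ofReal (β n) • μ n) :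
    Summable fun n => β n * moment norm (k n) := by
  have hfin := hν.lintegral_norm_lt_top
  rw [hsum, lintegral_sum_measure] at hfin
  refine (ENNReal.summable_toReal hfin.ne).congr fun n => ?_
  rw [lintegral_smul_measure, (hk n).lintegral_eq norm_nonneg, smul_eq_mul, ENNReal.toReal_mul,
    ENNReal.toReal_ofReal (hβ n),
    ENNReal.toReal_ofReal (linearCombination_nonneg norm_nonneg (hk n).nonneg)]

theorem Staircase.tendsto_moment_trunc (S : Staircase α K A) {ν : Measure (Mat d m)}
    {μ : ℕ → Measure (Mat d m)} (hk : ∀ n, HasWeights (μ n) (S.weights n))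
    (hsum : ν = Measure.sum fun n => ENNReal.ofReal (S.beta n) • μ n) {φ : Mat d m → ℝ}
    (hφ : ∀ X, 0 ≤ φ X) :
    Tendsto (fun N => ENNReal.ofReal (moment φ (S.trunc N))) atTop
      (𝓝 (∫⁻ X, ENNReal.ofReal (φ X) ∂ν)) := by
  rw [hsum, lintegral_sum_measure]
  refine (ENNReal.tendsto_nat_tsum _).congr fun N => ?_
  rw [S.moment_trunc, ENNReal.ofReal_sum_of_nonneg fun n _ => S.beta_mul_moment_nonneg hφ n]
  refine Finset.sum_congr rfl fun n _ => ?_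
  rw [lintegral_smul_measure, (hk n).lintegral_eq hφ, smul_eq_mul,
    ENNReal.ofReal_mul (S.beta_pos n).le]

theorem IsStaircaseLaminate.exists_staircase [Nonempty (Fin m)] (hα : α < 1)
    {ν : Measure (Mat d m)} (h : IsStaircaseLaminate K A ν) :
    ∃ S : Staircase α K A, ∀ φ : Mat d m → ℝ, (∀ X, 0 ≤ φ X) →
      Tendsto (fun N => ENNReal.ofReal (moment φ (S.trunc N))) atTop
        (𝓝 (∫⁻ X, ENNReal.ofReal (φ X) ∂ν)) := by
  obtain ⟨⟨As, μ, γ, rfl, -, hμ, hγ, hω, -, -, hβ, hlim⟩, hbar⟩ := h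
  have hβ0 : ∀ n, 0 ≤ staircaseBeta γ n := fun n => (staircaseBeta_pos hγ n).le
  choose f hf hwf using fun n => (hω n).1.exists_isRealizable hα (hω n).2
  choose k hk using fun n => (hwf n).exists_of_le
    (ν' := ENNReal.ofReal (1 - γ n) • μ n) (Measure.le_add_right le_rfl)
  have hfk : ∀ n, f n = k n + Finsupp.single (As (n + 1)) (γ n) := fun n =>
    (hwf n).unique ((hk n).add (HasWeights.smul_dirac _ (hγ n).1.le))
  simp_rw [hfk] at hf
  have hsum := eq_sum_of_tendsto_staircaseStep hγ hβ hlim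
  have hmean : ∀ n, As n = Finsupp.linearCombination ℝ id (k n) + γ n • As (n + 1) := fun n => by
    simpa using (hf n).mean.symm
  have heq_zero : ∀ n, ∀ X ∉ K, k n X = 0 := fun n X hX => by
    have hX0 : μ n {X} = 0 := measure_mono_null (singleton_subset_iff.2 hX) (hμ n).2
    refine le_antisymm (ENNReal.ofReal_eq_zero.1 ?_) ((hk n).nonneg X)
    rw [← (hk n).singleton, Measure.smul_apply, hX0, smul_zero]
  let S : Staircase α K (As 0) := ⟨As, k, γ, rfl, fun n => (hk n).nonneg, heq_zero, hγ, hf, hβ,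
    tendsto_staircaseBeta_mul_norm hbar hγ hk hsum hmean,
    summable_staircaseBeta_mul_moment_norm hbar hβ0 hk hsum⟩
  exact ⟨S, fun φ hφ => S.tendsto_moment_trunc hk hsum hφ⟩

end Staircase

/-! ### Mixtures of staircases and the price of a gradient -/

section Mixture

variable {d m : ℕ} {α : ℝ≥0} {K : Set (Mat d m)} {X : Mat d m}

theorem sum_single_nonneg {ι κ : Type*} (s : Finset ι) (C : ι → κ) {kap : ι → ℝ}
    (hkap : ∀ j, 0 ≤ kap j) (y : κ) : 0 ≤ (∑ j ∈ s, Finsupp.single (C j) (kap j)) y := by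
  rw [Finsupp.finsetSum_apply]
  exact Finset.sum_nonneg fun j _ => Finsupp.single_nonneg.2 (hkap j) y

theorem IsRealizable.subst_sum [Nonempty (Fin m)] {ι : Type*} (s : Finset ι)
    {C : ι → Mat d m} {kap : ι → ℝ} {ω : ι → Mat d m →₀ ℝ} {h : Mat d m →₀ ℝ}
    (hX : IsRealizable α X (h + ∑ j ∈ s, Finsupp.single (C j) (kap j))) (hh : ∀ Y, 0 ≤ h Y)
    (hkap : ∀ j, 0 ≤ kap j) (hω : ∀ j, IsRealizable α (C j) (ω j)) :
    IsRealizable α X (h + ∑ j ∈ s, kap j • ω j) := by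
  classical
  induction s using Finset.induction_on generalizing h with
  | empty => simpa using hX
  | insert a s ha ih =>
    rw [Finset.sum_insert ha] at hX ⊢
    rw [add_left_comm] at hX
    have hsubst := hX.subst (hkap a)
      (fun Y => add_nonneg (hh Y) (sum_single_nonneg s C hkap Y)) (hω a)
    rw [← add_assoc] at hsubst
    have hrest := ih hsubst fun Y => add_nonneg (mul_nonneg (hkap a) ((hω a).nonneg Y)) (hh Y)
    rwa [add_comm (kap a • ω a) h, add_assoc] at hrest

/-- The combinatorial data of an extended staircase laminate supported in `K` with barycenter `X`:
a finite mixture of Dirac masses on `K` and of staircases. -/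
structure Mixture (α : ℝ≥0) (K : Set (Mat d m)) (X : Mat d m) where
  I : ℕ
  J : ℕ
  lam : Fin I → ℝ
  B : Fin I → Mat d m
  kap : Fin J → ℝ
  C : Fin J → Mat d m
  staircase : ∀ j, Staircase α K (C j)
  lam_nonneg : ∀ i, 0 ≤ lam i
  kap_nonneg : ∀ j, 0 ≤ kap j
  mem : ∀ i, B i ∈ K
  isRealizable : IsRealizable α X
    (∑ i, Finsupp.single (B i) (lam i) + ∑ j, Finsupp.single (C j) (kap j))

/-- A staircase, as a mixture without Dirac masses. -/
def Staircase.toMixture (S : Staircase α K X) : Mixture α K X where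
  I := 0
  J := 1
  lam := Fin.elim0
  B := Fin.elim0
  kap _ := 1
  C _ := X
  staircase _ := S
  lam_nonneg i := i.elim0
  kap_nonneg _ := zero_le_one
  mem i := i.elim0
  isRealizable := by simpa using isRealizable_single α X

namespace Mixture

/-- The first moment of the mixture. -/
noncomputable def cost (M : Mixture α K X) : ℝ :=
  ∑ i, M.lam i * ‖M.B i‖ + ∑ j, M.kap j * (M.staircase j).cost

theorem cost_nonneg (M : Mixture α K X) : 0 ≤ M.cost :=
  add_nonneg (Finset.sum_nonneg fun i _ => mul_nonneg (M.lam_nonneg i) (norm_nonneg _))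
    (Finset.sum_nonneg fun j _ => mul_nonneg (M.kap_nonneg j) (M.staircase j).cost_nonneg)

/-- The part on `K` of the mixture, with each staircase truncated after `N` steps. -/
noncomputable def trunc (M : Mixture α K X) (N : ℕ) : Mat d m →₀ ℝ :=
  ∑ i, Finsupp.single (M.B i) (M.lam i) + ∑ j, M.kap j • (M.staircase j).trunc N

/-- The Dirac masses at the `N`-th nodes which remain after `N` steps of each staircase. -/
noncomputable def remainder (M : Mixture α K X) (N : ℕ) : Mat d m →₀ ℝ :=
  ∑ j, Finsupp.single ((M.staircase j).node N) (M.kap j * (M.staircase j).beta N)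

theorem isRealizable_trunc_add_remainder [Nonempty (Fin m)] (M : Mixture α K X) (N : ℕ) :
    IsRealizable α X (M.trunc N + M.remainder N) := by
  convert M.isRealizable.subst_sum Finset.univ (sum_single_nonneg _ M.B M.lam_nonneg) M.kap_nonneg
    fun j => (M.staircase j).isRealizable_trunc N using 1
  simp only [trunc, remainder, add_assoc, ← Finset.sum_add_distrib, smul_add, Finsupp.smul_single,
    smul_eq_mul]

theorem trunc_nonneg (M : Mixture α K X) (N : ℕ) (Y : Mat d m) : 0 ≤ M.trunc N Y := by
  rw [trunc, Finsupp.add_apply, Finsupp.finsetSum_apply Finset.univ fun j => M.kap j • _]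
  exact add_nonneg (sum_single_nonneg _ M.B M.lam_nonneg Y) (Finset.sum_nonneg fun j _ =>
    mul_nonneg (M.kap_nonneg j) ((M.staircase j).trunc_nonneg N Y))

theorem remainder_nonneg (M : Mixture α K X) (N : ℕ) (Y : Mat d m) : 0 ≤ M.remainder N Y :=
  sum_single_nonneg _ _ (fun j => mul_nonneg (M.kap_nonneg j) ((M.staircase j).beta_pos N).le) Y

theorem trunc_eq_zero (M : Mixture α K X) (N : ℕ) {Y : Mat d m} (hY : Y ∉ K) :
    M.trunc N Y = 0 := by
  rw [trunc, Finsupp.add_apply, Finsupp.finsetSum_apply, Finsupp.finsetSum_apply,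
    Finset.sum_eq_zero, Finset.sum_eq_zero, add_zero]
  · intro j _
    rw [Finsupp.smul_apply, (M.staircase j).trunc_eq_zero N hY, smul_zero]
  · intro i _
    rw [Finsupp.single_apply, if_neg]
    rintro rfl
    exact hY (M.mem i)

theorem moment_trunc (M : Mixture α K X) (φ : Mat d m → ℝ) (N : ℕ) :
    moment φ (M.trunc N) = ∑ i, M.lam i * φ (M.B i) +
      ∑ j, M.kap j * moment φ ((M.staircase j).trunc N) := by
  simp only [trunc, map_add, map_sum, map_smul, Finsupp.linearCombination_single, smul_eq_mul]

theorem moment_norm_trunc_le (M : Mixture α K X) (N : ℕ) : moment norm (M.trunc N) ≤ M.cost := by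
  rw [moment_trunc, cost]
  gcongr with j
  exacts [M.kap_nonneg j, (M.staircase j).moment_norm_trunc_le N]

end Mixture

theorem Staircase.cost_toMixture (S : Staircase α K X) : S.toMixture.cost = S.cost := by
  change ∑ i : Fin 0, _ + ∑ _ : Fin 1, 1 * S.cost = S.cost
  simp

/-- The price of resolving the gradient `X` into gradients in `K`: an upper bound for the first
moment of some mixture with barycenter `X`. (The infimum is `0` if there is no such mixture.) -/
noncomputable def price (α : ℝ≥0) (K : Set (Mat d m)) (X : Mat d m) : ℝ :=
  1 + ‖X‖ + ⨅ M : Mixture α K X, M.cost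

theorem one_add_norm_le_price (X : Mat d m) : 1 + ‖X‖ ≤ price α K X :=
  le_add_of_nonneg_right (Real.iInf_nonneg Mixture.cost_nonneg)

theorem norm_le_price (X : Mat d m) : ‖X‖ ≤ price α K X :=
  (le_add_of_nonneg_left zero_le_one).trans (one_add_norm_le_price X)

theorem price_nonneg (X : Mat d m) : 0 ≤ price α K X := (norm_nonneg X).trans (norm_le_price X)

theorem Mixture.price_le (M : Mixture α K X) : price α K X ≤ 1 + ‖X‖ + M.cost := by
  unfold price
  gcongr
  exact ciInf_le ⟨0, forall_mem_range.2 cost_nonneg⟩ M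

theorem exists_mixture_cost_le_price (h : Nonempty (Mixture α K X)) :
    ∃ M : Mixture α K X, M.cost ≤ price α K X := by
  obtain ⟨M, hM⟩ := exists_lt_of_ciInf_lt (lt_add_one (⨅ M : Mixture α K X, M.cost))
  exact ⟨M, hM.le.trans (by unfold price; linarith [norm_nonneg X])⟩

theorem Staircase.tendsto_price (S : Staircase α K X) :
    Tendsto (fun N => S.beta N * price α K (S.node N)) atTop (𝓝 0) := by
  have hlim := (S.tendsto_beta.add S.tendsto_norm).add
    (tendsto_sum_nat_add fun n => S.beta n * moment norm (S.weights n))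
  rw [add_zero, add_zero] at hlim
  refine tendsto_of_tendsto_of_tendsto_of_le_of_le tendsto_const_nhds hlim
    (fun N => mul_nonneg (S.beta_pos N).le (price_nonneg _)) fun N => ?_
  calc S.beta N * price α K (S.node N)
    _ ≤ S.beta N * (1 + ‖S.node N‖ + (S.shift N).cost) := by
        gcongr
        · exact (S.beta_pos N).le
        · exact (S.shift N).cost_toMixture ▸ (S.shift N).toMixture.price_le
    _ = _ := by rw [mul_add, mul_add, mul_one, S.beta_mul_cost_shift]

theorem Mixture.tendsto_moment_price_remainder (M : Mixture α K X) :
    Tendsto (fun N => moment (price α K) (M.remainder N)) atTop (𝓝 0) := by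
  have hlim := tendsto_finsetSum Finset.univ fun j _ =>
    (M.staircase j).tendsto_price.const_mul (M.kap j)
  simp only [mul_zero, Finset.sum_const_zero] at hlim
  refine hlim.congr fun N => ?_
  simp only [remainder, map_sum, Finsupp.linearCombination_single, smul_eq_mul, mul_assoc]

/-- The weights `k` on `K` together with the unresolved weights `g` are realizable at `X`; the
first moment of `k` is at most `c`, and the price of `g` is at most `ε`. -/
structure IsPartialResolution (α : ℝ≥0) (K : Set (Mat d m)) (X : Mat d m) (k g : Mat d m →₀ ℝ)
    (c ε : ℝ) : Prop where
  isRealizable : IsRealizable α X (k + g)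
  nonneg_left : ∀ Y, 0 ≤ k Y
  nonneg_right : ∀ Y, 0 ≤ g Y
  eq_zero : ∀ Y ∉ K, k Y = 0
  moment_norm_le : moment norm k ≤ c
  moment_price_le : moment (price α K) g ≤ ε

theorem Mixture.eventually_isPartialResolution [Nonempty (Fin m)] (M : Mixture α K X) {c ε : ℝ}
    (hc : M.cost ≤ c) (hε : 0 < ε) :
    ∀ᶠ N in atTop, IsPartialResolution α K X (M.trunc N) (M.remainder N) c ε := by
  filter_upwards [M.tendsto_moment_price_remainder.eventually (ge_mem_nhds hε)] with N hN
  exact ⟨M.isRealizable_trunc_add_remainder N, M.trunc_nonneg N, M.remainder_nonneg N,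
    fun _ => M.trunc_eq_zero N, (M.moment_norm_trunc_le N).trans hc, hN⟩

theorem exists_isPartialResolution_price [Nonempty (Fin m)] (hX : Nonempty (Mixture α K X))
    {ε : ℝ} (hε : 0 < ε) : ∃ k g, IsPartialResolution α K X k g (price α K X) ε := by
  obtain ⟨M, hM⟩ := exists_mixture_cost_le_price hX
  obtain ⟨N, hN⟩ := (M.eventually_isPartialResolution hM hε).exists
  exact ⟨_, _, hN⟩

theorem Mixture.tendsto_moment_trunc (M : Mixture α K X) {ν' : Fin M.J → Measure (Mat d m)}
    {φ : Mat d m → ℝ} (hφ : ∀ Y, 0 ≤ φ Y)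
    (hν' : ∀ j, Tendsto (fun N => ENNReal.ofReal (moment φ ((M.staircase j).trunc N))) atTop
      (𝓝 (∫⁻ Y, ENNReal.ofReal (φ Y) ∂ν' j))) :
    Tendsto (fun N => ENNReal.ofReal (moment φ (M.trunc N))) atTop
      (𝓝 (∫⁻ Y, ENNReal.ofReal (φ Y) ∂(∑ i, ENNReal.ofReal (M.lam i) • Measure.dirac (M.B i) +
        ∑ j, ENNReal.ofReal (M.kap j) • ν' j))) := by
  rw [lintegral_add_measure, lintegral_finsetSum_measure, lintegral_finsetSum_measure]
  simp only [lintegral_smul_measure, lintegral_dirac, smul_eq_mul]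
  refine (tendsto_const_nhds.add (tendsto_finsetSum _ fun j _ =>
    ENNReal.Tendsto.const_mul (hν' j) (Or.inr ENNReal.ofReal_ne_top))).congr fun N => ?_
  have hatom : ∀ i, 0 ≤ M.lam i * φ (M.B i) := fun i => mul_nonneg (M.lam_nonneg i) (hφ _)
  have hstair : ∀ j, 0 ≤ M.kap j * moment φ ((M.staircase j).trunc N) := fun j =>
    mul_nonneg (M.kap_nonneg j) (linearCombination_nonneg hφ ((M.staircase j).trunc_nonneg N))
  rw [M.moment_trunc, ENNReal.ofReal_add (Finset.sum_nonneg fun i _ => hatom i)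
    (Finset.sum_nonneg fun j _ => hstair j), ENNReal.ofReal_sum_of_nonneg fun i _ => hatom i,
    ENNReal.ofReal_sum_of_nonneg fun j _ => hstair j]
  simp only [ENNReal.ofReal_mul (M.lam_nonneg _), ENNReal.ofReal_mul (M.kap_nonneg _)]

theorem IsExtendedStaircaseLaminate.exists_mixture [Nonempty (Fin m)] (hα : α < 1)
    {ν : Measure (Mat d m)} (h : IsExtendedStaircaseLaminate K X ν) :
    ∃ M : Mixture α K X, ∀ φ : Mat d m → ℝ, (∀ Y, 0 ≤ φ Y) →
      Tendsto (fun N => ENNReal.ofReal (moment φ (M.trunc N))) atTop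
        (𝓝 (∫⁻ Y, ENNReal.ofReal (φ Y) ∂ν)) := by
  obtain ⟨I, J, lam, B, kap, C, ν', hlam, hkap, hfin, hbar, hB, hstair, rfl⟩ := h
  choose S hS using fun j => (hstair j).exists_staircase hα
  obtain ⟨f, hf, hw⟩ := hfin.exists_isRealizable hα hbar
  obtain rfl := hw.unique ((HasWeights.sum _ fun i _ => HasWeights.smul_dirac _ (hlam i)).add
    (HasWeights.sum _ fun j _ => HasWeights.smul_dirac _ (hkap j)))
  let M : Mixture α K X := ⟨I, J, lam, B, kap, C, S, hlam, hkap, hB, hf⟩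
  exact ⟨M, fun φ hφ => M.tendsto_moment_trunc hφ fun j => hS j φ hφ⟩

theorem IsExtendedStaircaseLaminate.exists_isPartialResolution [Nonempty (Fin m)] (hα : α < 1)
    {ν : Measure (Mat d m)} (h : IsExtendedStaircaseLaminate K X ν) {φ : Mat d m → ℝ}
    (hφ : ∀ Y, 0 ≤ φ Y) (hν : ∫⁻ Y, ENNReal.ofReal (φ Y) ∂ν = ⊤) :
    ∃ c, 0 ≤ c ∧ ∀ ε : ℝ, 0 < ε → ∀ L : ℝ, ∃ k g, IsPartialResolution α K X k g c ε ∧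
      L ≤ moment φ k := by
  obtain ⟨M, hM⟩ := h.exists_mixture hα
  refine ⟨M.cost, M.cost_nonneg, fun ε hε L => ?_⟩
  have hlarge : ∀ᶠ N in atTop, ENNReal.ofReal L < ENNReal.ofReal (moment φ (M.trunc N)) :=
    (hν ▸ hM φ hφ).eventually (lt_mem_nhds ENNReal.ofReal_lt_top)
  obtain ⟨N, hN, hL⟩ := ((M.eventually_isPartialResolution le_rfl hε).and hlarge).exists
  exact ⟨_, _, hN, (ENNReal.ofReal_lt_ofReal_iff'.1 hL).1.le⟩

end Mixture

/-! ### Piecewise affine maps and partial resolutions -/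

section PiecewiseAffine

variable {d m : ℕ} {Ω U : Set (Euc m)} {u v w : Euc m → Euc d} {F : Finset (Mat d m)}

/-- Near almost every point of `Ω`, the map `u` is affine with a gradient in the finite set `F`. -/
def IsPiecewiseAffineOn (Ω : Set (Euc m)) (u : Euc m → Euc d) (F : Finset (Mat d m)) : Prop :=
  ∀ᵐ x ∂volume.restrict Ω, ∃ X ∈ F, x ∈ affineSet u X

namespace IsPiecewiseAffineOn

theorem setLIntegral_eq (h : IsPiecewiseAffineOn Ω u F) (hΩ : MeasurableSet Ω)
    (f : Euc m → ℝ≥0∞) : ∫⁻ x in Ω, f x = ∑ X ∈ F, ∫⁻ x in Ω ∩ affineSet u X, f x := by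
  rw [← lintegral_biUnion_finset]
  · refine setLIntegral_congr ?_
    filter_upwards [(ae_restrict_iff' hΩ).1 h] with x hx
    refine propext ⟨fun hxΩ => ?_, fun hx' => ?_⟩
    · obtain ⟨X, hX, hxX⟩ := hx hxΩ
      exact mem_biUnion (Finset.mem_coe.2 hX) ⟨hxΩ, hxX⟩
    · obtain ⟨X, -, hxX⟩ := mem_iUnion₂.1 hx'
      exact hxX.1
  · exact fun X _ Y _ hXY =>
      (disjoint_affineSet u hXY).mono inter_subset_right inter_subset_right
  · exact fun X _ => hΩ.inter (measurableSet_affineSet u X)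

theorem lintegral_comp_grad (h : IsPiecewiseAffineOn Ω u F) (hΩ : MeasurableSet Ω)
    (ψ : Mat d m → ℝ≥0∞) :
    ∫⁻ x in Ω, ψ (grad u x) = ∑ X ∈ F, ψ X * volume (Ω ∩ affineSet u X) := by
  rw [h.setLIntegral_eq hΩ]
  refine Finset.sum_congr rfl fun X _ => ?_
  rw [← setLIntegral_const]
  refine setLIntegral_congr_fun (hΩ.inter (measurableSet_affineSet u X)) fun x hx => ?_
  simp only [grad_eq_of_mem_affineSet hx.2]

theorem sum_volume (h : IsPiecewiseAffineOn Ω u F) (hΩ : MeasurableSet Ω) :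
    ∑ X ∈ F, volume (Ω ∩ affineSet u X) = volume Ω := by
  simpa using (h.lintegral_comp_grad hΩ fun _ => 1).symm

theorem lintegral_ofReal_comp_grad (h : IsPiecewiseAffineOn Ω u F) (hΩ : MeasurableSet Ω)
    (hfin : volume Ω ≠ ⊤) {ψ : Mat d m → ℝ} (hψ : ∀ X, 0 ≤ ψ X) :
    ∫⁻ x in Ω, ENNReal.ofReal (ψ (grad u x)) =
      ENNReal.ofReal (∑ X ∈ F, ψ X * volume.real (Ω ∩ affineSet u X)) := by
  rw [h.lintegral_comp_grad hΩ fun X => ENNReal.ofReal (ψ X),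
    ENNReal.ofReal_sum_of_nonneg fun X _ => mul_nonneg (hψ X) measureReal_nonneg]
  refine Finset.sum_congr rfl fun X _ => ?_
  rw [ENNReal.ofReal_mul (hψ X),
    ofReal_measureReal (measure_ne_top_of_subset inter_subset_left hfin)]

theorem sum_measureReal (h : IsPiecewiseAffineOn Ω u F) (hΩ : MeasurableSet Ω)
    (hfin : volume Ω ≠ ⊤) : ∑ X ∈ F, volume.real (Ω ∩ affineSet u X) = volume.real Ω := by
  simp only [measureReal_def, ← h.sum_volume hΩ]
  exact (ENNReal.toReal_sum fun X _ => measure_ne_top_of_subset inter_subset_left hfin).symm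

end IsPiecewiseAffineOn

theorem le_add_mul_of_sum_eq {ι : Type*} {s : Finset ι} {f v : ι → ℝ} {ε V : ℝ} (hε : 0 ≤ ε)
    (hV : 0 ≤ V) (hf : ∀ i, 0 ≤ f i) (hsum : ∑ i ∈ s, f i = 1) (hvsum : ∑ i ∈ s, v i = V)
    (hv : ∀ i, (1 - ε) * f i * V ≤ v i) {i : ι} (hi : i ∈ s) : v i ≤ (f i + ε) * V := by
  classical
  have hle : ∑ j ∈ s.erase i, (1 - ε) * f j * V ≤ ∑ j ∈ s.erase i, v j :=
    Finset.sum_le_sum fun j _ => hv j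
  rw [← Finset.sum_mul, ← Finset.mul_sum] at hle
  have hrest : ∑ j ∈ s.erase i, f j = 1 - f i := by
    rw [← hsum, ← Finset.sum_erase_add s f hi, add_sub_cancel_right]
  rw [hrest] at hle
  have hpos : 0 ≤ ε * f i * V := mul_nonneg (mul_nonneg hε (hf i)) hV
  nlinarith [Finset.sum_erase_add s v hi]

end PiecewiseAffine

section PartialResolution

variable {d m : ℕ} {α : ℝ≥0} {K : Set (Mat d m)} {X : Mat d m} {φ : Mat d m → ℝ}

theorem moment_eq_sum_of_subset {ι : Type*} {f : ι →₀ ℝ} {s : Finset ι} (hs : f.support ⊆ s)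
    (ψ : ι → ℝ) : moment ψ f = ∑ i ∈ s, f i * ψ i := by
  rw [moment, Finsupp.linearCombination_apply, Finsupp.sum_of_support_subset f hs _ (by simp)]
  simp only [smul_eq_mul]

theorem IsRealizable.exists_isPerturbation_affineSet {f : Mat d m →₀ ℝ} (hf : IsRealizable α X f) :
    ∃ F : Finset (Mat d m), f.support ⊆ F ∧ ∀ (ε : ℝ) (τ : ℝ≥0) (U : Set (Euc m))
      (u : Euc m → Euc d), 0 < ε → 0 < τ → IsOpen U → Bornology.IsBounded U →
      U ⊆ affineSet u X → ∃ w, IsPerturbation α τ U w ∧ IsPiecewiseAffineOn U (u + w) F ∧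
        ∀ Y, (1 - ε) * f Y * volume.real U ≤ volume.real (U ∩ affineSet (u + w) Y) := by
  obtain ⟨F, hF, hex⟩ := hf.exists_isPerturbation
  refine ⟨F, hF, fun ε τ U u hε hτ hU hUb hUX => ?_⟩
  obtain ⟨w, hw, hae, hvol⟩ := hex ε τ U hε hτ hU hUb
  have hadd : ∀ x ∈ U, ∀ Y, x ∈ affineSet w (Y - X) → x ∈ affineSet (u + w) Y := fun x hx Y hY => by
    simpa only [add_sub_cancel] using add_mem_affineSet (hUX hx) hY
  refine ⟨w, hw, ?_, fun Y => (hvol Y).trans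
    (measureReal_mono (fun x hx => ⟨hx.1, hadd x hx.1 Y hx.2⟩)
      (measure_ne_top_of_subset inter_subset_left hUb.measure_lt_top.ne))⟩
  unfold IsPiecewiseAffineOn
  filter_upwards [hae, ae_restrict_mem hU.measurableSet] with x ⟨Y, hY, hxY⟩ hx
  exact ⟨Y, hY, hadd x hx Y hxY⟩

theorem IsRealizable.exists_isPerturbation_lintegral {f : Mat d m →₀ ℝ} (hf : IsRealizable α X f) :
    ∃ F : Finset (Mat d m), ∀ (ε : ℝ) (τ : ℝ≥0) (U : Set (Euc m)) (u : Euc m → Euc d),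
      0 < ε → 0 < τ → IsOpen U → Bornology.IsBounded U → U ⊆ affineSet u X →
      ∃ w, IsPerturbation α τ U w ∧ IsPiecewiseAffineOn U (u + w) F ∧
        ∀ ψ : Mat d m → ℝ, (∀ Y, 0 ≤ ψ Y) →
          ENNReal.ofReal ((1 - ε) * moment ψ f) * volume U ≤
            ∫⁻ x in U, ENNReal.ofReal (ψ (grad (u + w) x)) ∧
          ∫⁻ x in U, ENNReal.ofReal (ψ (grad (u + w) x)) ≤
            ENNReal.ofReal (moment ψ f + ε * ∑ Y ∈ F, ψ Y) * volume U := by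
  obtain ⟨F, hF, hex⟩ := hf.exists_isPerturbation_affineSet
  refine ⟨F, fun ε τ U u hε hτ hU hUb hUX => ?_⟩
  obtain ⟨w, hw, hpw, hvol⟩ := hex ε τ U u hε hτ hU hUb hUX
  have hfin : volume U ≠ ⊤ := hUb.measure_lt_top.ne
  have hmass : ∑ Y ∈ F, f Y = 1 := by
    simpa using (moment_eq_sum_of_subset hF fun _ => 1).symm.trans hf.mass
  have hup : ∀ Y ∈ F, volume.real (U ∩ affineSet (u + w) Y) ≤ (f Y + ε) * volume.real U :=
    fun Y => le_add_mul_of_sum_eq hε.le measureReal_nonneg hf.nonneg hmass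
      (hpw.sum_measureReal hU.measurableSet hfin) hvol
  refine ⟨w, hw, hpw, fun ψ hψ => ?_⟩
  rw [hpw.lintegral_ofReal_comp_grad hU.measurableSet hfin hψ, ← ofReal_measureReal hfin,
    ← ENNReal.ofReal_mul' measureReal_nonneg, ← ENNReal.ofReal_mul' measureReal_nonneg,
    moment_eq_sum_of_subset hF]
  refine ⟨ENNReal.ofReal_le_ofReal ?_, ENNReal.ofReal_le_ofReal ?_⟩
  · rw [Finset.mul_sum, Finset.sum_mul]
    exact Finset.sum_le_sum fun Y _ => by nlinarith [mul_le_mul_of_nonneg_left (hvol Y) (hψ Y)]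
  · rw [Finset.mul_sum, ← Finset.sum_add_distrib, Finset.sum_mul]
    exact Finset.sum_le_sum fun Y hY => by nlinarith [mul_le_mul_of_nonneg_left (hup Y hY) (hψ Y)]

theorem IsRealizable.exists_isPerturbation_lintegral_of_le {f : Mat d m →₀ ℝ}
    (hf : IsRealizable α X f) (hφ : ∀ Y, 0 ≤ φ Y) {ε : ℝ} (hε : 0 < ε) {τ : ℝ≥0} (hτ : 0 < τ)
    {U : Set (Euc m)} (hU : IsOpen U) (hUb : Bornology.IsBounded U) {u : Euc m → Euc d}
    (hUX : U ⊆ affineSet u X) :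
    ∃ (w : Euc m → Euc d) (F : Finset (Mat d m)), IsPerturbation α τ U w ∧
      IsPiecewiseAffineOn U (u + w) F ∧
      (∀ ψ : Mat d m → ℝ, (∀ Y, 0 ≤ ψ Y) → (∀ Y, ψ Y ≤ φ Y) →
        ∫⁻ x in U, ENNReal.ofReal (ψ (grad (u + w) x)) ≤
          ENNReal.ofReal (moment ψ f + ε) * volume U) ∧
      ∀ ψ : Mat d m → ℝ, (∀ Y, 0 ≤ ψ Y) → ENNReal.ofReal (moment ψ f / 2) * volume U ≤
        ∫⁻ x in U, ENNReal.ofReal (ψ (grad (u + w) x)) := by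
  obtain ⟨F, hF⟩ := hf.exists_isPerturbation_lintegral
  set S := ∑ Y ∈ F, φ Y with hS
  have hS0 : 0 ≤ S := Finset.sum_nonneg fun Y _ => hφ Y
  set ε' := min (1 / 2) (ε / (1 + S))
  have hε'0 : 0 < ε' := by positivity
  obtain ⟨w, hw, hpw, hint⟩ := hF ε' τ U u hε'0 hτ hU hUb hUX
  refine ⟨w, F, hw, hpw, fun ψ hψ hle => (hint ψ hψ).2.trans ?_,
    fun ψ hψ => le_trans ?_ (hint ψ hψ).1⟩
  · gcongr
    calc ε' * ∑ Y ∈ F, ψ Y ≤ ε' * S := by rw [hS]; gcongr with Y; exact hle Y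
      _ ≤ ε / (1 + S) * (1 + S) := by gcongr; exacts [min_le_right _ _, by linarith]
      _ = ε := div_mul_cancel₀ ε (by positivity)
  · gcongr
    have hpos : 0 ≤ moment ψ f := linearCombination_nonneg hψ hf.nonneg
    have hhalf : ε' ≤ 1 / 2 := min_le_left _ _
    nlinarith

/-- The price of a gradient outside of `K`; gradients in `K` are free. -/
noncomputable def pending (α : ℝ≥0) (K : Set (Mat d m)) : Mat d m → ℝ := Kᶜ.indicator (price α K)

theorem pending_nonneg (X : Mat d m) : 0 ≤ pending α K X :=
  indicator_nonneg (fun Y _ => price_nonneg Y) X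

theorem pending_le_price (X : Mat d m) : pending α K X ≤ price α K X :=
  indicator_le_self' (fun Y _ => price_nonneg Y) X

theorem pending_of_mem (h : X ∈ K) : pending α K X = 0 := indicator_of_notMem (not_not.2 h) _

theorem pending_of_notMem (h : X ∉ K) : pending α K X = price α K X := indicator_of_mem h _

theorem moment_mono {ι : Type*} {φ ψ : ι → ℝ} {f : ι →₀ ℝ} (hf : ∀ i, 0 ≤ f i)
    (h : ∀ i, f i ≠ 0 → φ i ≤ ψ i) : moment φ f ≤ moment ψ f := by
  rw [moment_eq_sum_of_subset subset_rfl, moment_eq_sum_of_subset subset_rfl]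
  exact Finset.sum_le_sum fun i hi =>
    mul_le_mul_of_nonneg_left (h i (Finsupp.mem_support_iff.1 hi)) (hf i)

namespace IsPartialResolution

variable {k g : Mat d m →₀ ℝ} {c ε : ℝ}

theorem mem_of_ne_zero (h : IsPartialResolution α K X k g c ε) {Y : Mat d m} (hY : k Y ≠ 0) :
    Y ∈ K := by_contra fun hYK => hY (h.eq_zero Y hYK)

theorem moment_pending_le (h : IsPartialResolution α K X k g c ε) :
    moment (pending α K) (k + g) ≤ ε := by
  have hk : moment (pending α K) k ≤ moment (fun _ => 0) k :=
    moment_mono h.nonneg_left fun Y hY => (pending_of_mem (h.mem_of_ne_zero hY)).le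
  have hg : moment (pending α K) g ≤ moment (price α K) g :=
    moment_mono h.nonneg_right fun Y _ => pending_le_price Y
  have hzero : moment (fun _ => 0) k = 0 := by simp [moment_eq_sum_of_subset subset_rfl]
  rw [moment, map_add]
  linarith [h.moment_price_le]

theorem moment_norm_add_le (h : IsPartialResolution α K X k g c ε) :
    moment norm (k + g) ≤ c + ε := by
  rw [moment, map_add]
  exact add_le_add h.moment_norm_le
    ((moment_mono h.nonneg_right fun Y _ => norm_le_price Y).trans h.moment_price_le)

theorem le_moment_indicator (h : IsPartialResolution α K X k g c ε) (hφ : ∀ Y, 0 ≤ φ Y) :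
    moment φ k ≤ moment (K.indicator φ) (k + g) := by
  have hk : moment φ k ≤ moment (K.indicator φ) k :=
    moment_mono h.nonneg_left fun Y hY => (indicator_of_mem (h.mem_of_ne_zero hY) φ).ge
  have hg : 0 ≤ moment (K.indicator φ) g :=
    linearCombination_nonneg (indicator_nonneg fun Y _ => hφ Y) h.nonneg_right
  rw [moment, moment, map_add]
  linarith

theorem exists_isPerturbation (h : IsPartialResolution α K X k g c ε) (hc : 0 ≤ c) (hε : 0 < ε)
    (hφ : ∀ Y, 0 ≤ φ Y) {τ : ℝ≥0} (hτ : 0 < τ) {U : Set (Euc m)} (hU : IsOpen U)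
    (hUb : Bornology.IsBounded U) {u : Euc m → Euc d} (hUX : U ⊆ affineSet u X) :
    ∃ (w : Euc m → Euc d) (F : Finset (Mat d m)), IsPerturbation α τ U w ∧
      IsPiecewiseAffineOn U (u + w) F ∧
      ∫⁻ x in U, ENNReal.ofReal (pending α K (grad (u + w) x)) ≤
        ENNReal.ofReal (2 * ε) * volume U ∧
      ∫⁻ x in U, ENNReal.ofReal ‖grad (u + w) x - X‖ ≤
        ENNReal.ofReal (c + 2 * ε + ‖X‖) * volume U ∧
      ENNReal.ofReal (moment φ k / 2) * volume U ≤
        ∫⁻ x in U, ENNReal.ofReal (K.indicator φ (grad (u + w) x)) := by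
  obtain ⟨w, F, hw, hpw, hle, hge⟩ := h.isRealizable.exists_isPerturbation_lintegral_of_le
    price_nonneg hε hτ hU hUb hUX
  refine ⟨w, F, hw, hpw, (hle _ pending_nonneg pending_le_price).trans ?_, ?_,
    le_trans ?_ (hge _ (indicator_nonneg fun Y _ => hφ Y))⟩
  · gcongr
    linarith [h.moment_pending_le]
  · calc ∫⁻ x in U, ENNReal.ofReal ‖grad (u + w) x - X‖
        ≤ ∫⁻ x in U, (ENNReal.ofReal ‖grad (u + w) x‖ + ENNReal.ofReal ‖X‖) :=
          lintegral_mono fun x => (ENNReal.ofReal_le_ofReal (norm_sub_le _ X)).trans_eq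
            (ENNReal.ofReal_add (norm_nonneg _) (norm_nonneg _))
      _ = (∫⁻ x in U, ENNReal.ofReal ‖grad (u + w) x‖) + ENNReal.ofReal ‖X‖ * volume U := by
          rw [lintegral_add_right _ measurable_const, setLIntegral_const]
      _ ≤ ENNReal.ofReal (c + ε + ε) * volume U + ENNReal.ofReal ‖X‖ * volume U := by
          refine add_le_add ((hle norm norm_nonneg norm_le_price).trans ?_) le_rfl
          gcongr
          exact h.moment_norm_add_le
      _ = _ := by
          rw [← add_mul, ← ENNReal.ofReal_add (by positivity) (norm_nonneg X), add_assoc c, two_mul]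
  · gcongr
    exact h.le_moment_indicator hφ

end IsPartialResolution

end PartialResolution

/-! ### The two steps of the construction -/

section Gluing

variable {d m : ℕ} {α τ : ℝ≥0} {Ω U B : Set (Euc m)} {u v w : Euc m → Euc d}
  {F G : Finset (Mat d m)}

theorem mem_affineSet_add_congr {X : Mat d m} {x : Euc m} (h : v =ᶠ[𝓝 x] w) :
    x ∈ affineSet (u + v) X ↔ x ∈ affineSet (u + w) X :=
  affineSet_congr (EventuallyEq.rfl.add h)

theorem grad_add_congr {x : Euc m} (h : v =ᶠ[𝓝 x] w) : grad (u + v) x = grad (u + w) x :=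
  grad_congr (EventuallyEq.rfl.add h)

theorem grad_add_of_eventuallyEq_zero {x : Euc m} (h : v =ᶠ[𝓝 x] 0) :
    grad (u + v) x = grad u x := by
  rw [grad_add_congr h, add_zero]

theorem exists_glue (hΩ : IsOpen Ω) (F : Finset (Mat d m)) (hτ : 0 < τ) :
    ∃ τ' : ℝ≥0, 0 < τ' ∧ ∀ W : Mat d m → Euc m → Euc d,
      (∀ X ∈ F, IsPerturbation α τ' (Ω ∩ affineSet u X) (W X)) →
      ∃ v, IsPerturbation α τ Ω v ∧ ∀ X ∈ F, ∀ x ∈ Ω ∩ affineSet u X, v =ᶠ[𝓝 x] W X := by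
  refine ⟨τ / (F.card + 1), by positivity, fun W hW => ⟨∑ X ∈ F, W X, ?_, fun X hX x hx => ?_⟩⟩
  · refine (IsPerturbation.sum F fun X hX => (hW X hX).mono le_rfl inter_subset_left).mono ?_ le_rfl
    rw [Finset.sum_const, nsmul_eq_mul, mul_div_assoc', div_le_iff₀ (by positivity), mul_comm]
    gcongr
    exact le_add_of_nonneg_right zero_le_one
  · filter_upwards [(hΩ.inter (isOpen_affineSet u X)).mem_nhds hx] with y hy
    rw [Finset.sum_apply]
    exact Finset.sum_eq_single_of_mem X hX fun Y hY hYX =>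
      (hW Y hY).zero y fun hy' => hYX (affineSet_unique hy'.2 hy.2)

theorem IsPiecewiseAffineOn.biUnion [DecidableEq (Mat d m)] (hΩ : MeasurableSet Ω)
    (hu : IsPiecewiseAffineOn Ω u F) {G : Mat d m → Finset (Mat d m)}
    (hv : ∀ X ∈ F, IsPiecewiseAffineOn (Ω ∩ affineSet u X) v (G X)) :
    IsPiecewiseAffineOn Ω v (F.biUnion G) := by
  have hv' : ∀ᵐ x, ∀ X ∈ F, x ∈ Ω ∩ affineSet u X → ∃ Y ∈ G X, x ∈ affineSet v Y :=
    (eventually_all_finset F).2 fun X hX =>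
      (ae_restrict_iff' (hΩ.inter (measurableSet_affineSet u X))).1 (hv X hX)
  unfold IsPiecewiseAffineOn at hu ⊢
  filter_upwards [hu, ae_restrict_of_ae hv', ae_restrict_mem hΩ] with x ⟨X, hX, hxX⟩ hx hxΩ
  obtain ⟨Y, hY, hxY⟩ := hx X hX ⟨hxΩ, hxX⟩
  exact ⟨Y, Finset.mem_biUnion.2 ⟨X, hX, hY⟩, hxY⟩

theorem IsPiecewiseAffineOn.add_congr (hU : MeasurableSet U)
    (hw : IsPiecewiseAffineOn U (u + w) F) (h : ∀ x ∈ U, v =ᶠ[𝓝 x] w) :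
    IsPiecewiseAffineOn U (u + v) F := by
  unfold IsPiecewiseAffineOn at hw ⊢
  filter_upwards [hw, ae_restrict_mem hU] with x ⟨X, hX, hxX⟩ hx
  exact ⟨X, hX, (mem_affineSet_add_congr (h x hx)).2 hxX⟩

theorem IsPerturbation.ae_eventuallyEq_zero (hw : IsPerturbation α τ B w) (hB : IsOpen B)
    (hfr : volume (frontier B) = 0) : ∀ᵐ x, x ∉ B → w =ᶠ[𝓝 x] 0 := by
  filter_upwards [measure_eq_zero_iff_ae_notMem.1 hfr] with x hx hxB
  refine hw.eventuallyEq_zero fun hcl => hx ⟨hcl, ?_⟩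
  rwa [hB.interior_eq]

theorem IsPiecewiseAffineOn.union [DecidableEq (Mat d m)] (hB : MeasurableSet B)
    (hu : IsPiecewiseAffineOn Ω u F) (hv : IsPiecewiseAffineOn B (u + w) G)
    (hw : ∀ᵐ x, x ∉ B → w =ᶠ[𝓝 x] 0) : IsPiecewiseAffineOn Ω (u + w) (F ∪ G) := by
  have hv' := ae_restrict_of_ae (s := Ω) ((ae_restrict_iff' hB).1 hv)
  unfold IsPiecewiseAffineOn at hu ⊢
  filter_upwards [hu, hv', ae_restrict_of_ae hw] with x ⟨X, hX, hxX⟩ hxB hx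
  by_cases hxmem : x ∈ B
  · obtain ⟨Y, hY, hxY⟩ := hxB hxmem
    exact ⟨Y, Finset.mem_union_right _ hY, hxY⟩
  · refine ⟨X, Finset.mem_union_left _ hX, ?_⟩
    rwa [mem_affineSet_add_congr (hx hxmem), add_zero]

theorem IsPiecewiseAffineOn.exists_mem_affineSet (hu : IsPiecewiseAffineOn Ω u F) (hU : IsOpen U)
    (hne : U.Nonempty) (hUΩ : U ⊆ Ω) : ∃ x ∈ U, ∃ X ∈ F, x ∈ affineSet u X := by
  have hae : ∀ᵐ x ∂volume.restrict U, ∃ X ∈ F, x ∈ affineSet u X :=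
    ae_mono (Measure.restrict_mono hUΩ le_rfl) hu
  have : (ae (volume.restrict U)).NeBot := by
    rw [ae_neBot, Ne, Measure.restrict_eq_zero]
    exact (hU.measure_pos volume hne).ne'
  obtain ⟨x, hx, hxU⟩ := (hae.and (ae_restrict_mem hU.measurableSet)).exists
  exact ⟨x, hxU, hx⟩

theorem exists_ball_subset_measure_le [Nonempty (Fin m)] (hU : IsOpen U) {x : Euc m} (hx : x ∈ U)
    {η : ℝ≥0∞} (hη : 0 < η) : ∃ r > 0, Metric.ball x r ⊆ U ∧ volume (Metric.ball x r) ≤ η := by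
  obtain ⟨O, hxO, hO, hOη⟩ := Set.exists_isOpen_lt_of_lt ({x} : Set (Euc m)) η
    (by rwa [measure_singleton]) (μ := volume)
  obtain ⟨r, hr, hsub⟩ := Metric.isOpen_iff.1 (hU.inter hO) x ⟨hx, hxO rfl⟩
  exact ⟨r, hr, hsub.trans inter_subset_left,
    (measure_mono (hsub.trans inter_subset_right)).trans hOη.le⟩

end Gluing

section Step

variable {d m : ℕ} {α τ : ℝ≥0} {K : Set (Mat d m)} {Ω U : Set (Euc m)} {u : Euc m → Euc d}
  {F : Finset (Mat d m)} {X : Mat d m} {φ : Mat d m → ℝ} {ε : ℝ}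

theorem exists_resolve_piece [Nonempty (Fin m)] (hX : Nonempty (Mixture α K X)) (hε : 0 < ε)
    (hτ : 0 < τ) (hU : IsOpen U) (hUb : Bornology.IsBounded U) (hUX : U ⊆ affineSet u X) :
    ∃ (w : Euc m → Euc d) (F : Finset (Mat d m)), IsPerturbation α τ U w ∧
      IsPiecewiseAffineOn U (u + w) F ∧ (X ∈ K → w = 0) ∧
      ∫⁻ x in U, ENNReal.ofReal (pending α K (grad (u + w) x)) ≤ ENNReal.ofReal ε * volume U ∧
      ∫⁻ x in U, ENNReal.ofReal ‖grad (u + w) x - grad u x‖ ≤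
        ENNReal.ofReal (2 * pending α K X + ε) * volume U := by
  have hgrad : ∀ x ∈ U, grad u x = X := fun x hx => grad_eq_of_mem_affineSet (hUX hx)
  by_cases hXK : X ∈ K
  · refine ⟨0, {X}, .of_zero, ?_, fun _ => rfl, ?_, ?_⟩
    · exact (ae_restrict_iff' hU.measurableSet).2
        (ae_of_all _ fun x hx => ⟨X, Finset.mem_singleton_self X, by simpa using hUX hx⟩)
    · rw [setLIntegral_congr_fun (g := fun _ => 0) hU.measurableSet fun x hx => by
        simp [hgrad x hx, pending_of_mem hXK]]
      simp
    · simp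
  · obtain ⟨k, g, hres⟩ := exists_isPartialResolution_price hX (half_pos hε)
    obtain ⟨w, F, hw, hpw, hpend, hdiff, -⟩ := hres.exists_isPerturbation (price_nonneg X)
      (half_pos hε) (φ := 0) (fun _ => le_rfl) hτ hU hUb hUX
    refine ⟨w, F, hw, hpw, fun h => absurd h hXK, ?_, ?_⟩
    · rwa [mul_div_cancel₀ ε two_ne_zero] at hpend
    · rw [setLIntegral_congr_fun hU.measurableSet fun x hx => by simp only [hgrad x hx]; rfl]
      refine hdiff.trans ?_
      gcongr ENNReal.ofReal ?_ * _
      rw [pending_of_notMem hXK]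
      linarith [norm_le_price (α := α) (K := K) X]

theorem IsPiecewiseAffineOn.exists_resolve_step [Nonempty (Fin m)]
    (hK : ∀ X : Mat d m, Nonempty (Mixture α K X)) (hΩ : IsOpen Ω) (hΩb : Bornology.IsBounded Ω)
    (hu : IsPiecewiseAffineOn Ω u F) (hε : 0 < ε) (hτ : 0 < τ) :
    ∃ (v : Euc m → Euc d) (G : Finset (Mat d m)), IsPerturbation α τ Ω v ∧
      IsPiecewiseAffineOn Ω (u + v) G ∧
      (∀ᵐ x ∂volume.restrict Ω, grad u x ∈ K → grad (u + v) x = grad u x) ∧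
      ∫⁻ x in Ω, ENNReal.ofReal (pending α K (grad (u + v) x)) ≤ ENNReal.ofReal ε ∧
      ∫⁻ x in Ω, ENNReal.ofReal ‖grad (u + v) x - grad u x‖ ≤
        2 * (∫⁻ x in Ω, ENNReal.ofReal (pending α K (grad u x))) + ENNReal.ofReal ε := by
  classical
  obtain ⟨ε', hε', hsmall⟩ : ∃ ε' > 0, ENNReal.ofReal ε' * volume Ω ≤ ENNReal.ofReal ε := by
    refine ⟨ε / (1 + volume.real Ω), by positivity, ?_⟩
    rw [← ofReal_measureReal hΩb.measure_lt_top.ne, ← ENNReal.ofReal_mul (by positivity),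
      div_mul_eq_mul_div]
    exact ENNReal.ofReal_le_ofReal (div_le_of_le_mul₀ (by positivity) hε.le (by gcongr; linarith))
  have hUo : ∀ X, IsOpen (Ω ∩ affineSet u X) := fun X => hΩ.inter (isOpen_affineSet u X)
  have hUm := fun X => (hUo X).measurableSet
  obtain ⟨τ', hτ', hglue⟩ := exists_glue (α := α) (u := u) hΩ F hτ
  choose w G hw hpw hwK hpend hdiff using fun X => exists_resolve_piece (hK X) hε' hτ' (hUo X)
    (hΩb.subset inter_subset_left) inter_subset_right
  obtain ⟨v, hv, hvw⟩ := hglue w fun X _ => hw X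
  have hgrad : ∀ X ∈ F, ∀ x ∈ Ω ∩ affineSet u X, grad (u + v) x = grad (u + w X) x :=
    fun X hX x hx => grad_add_congr (hvw X hX x hx)
  refine ⟨v, F.biUnion G, hv, hu.biUnion hΩ.measurableSet fun X hX =>
    (hpw X).add_congr (hUm X) (hvw X hX), ?_, le_trans ?_ hsmall,
    le_trans ?_ (add_le_add le_rfl hsmall)⟩
  · filter_upwards [hu, ae_restrict_mem hΩ.measurableSet] with x ⟨X, hX, hxX⟩ hxΩ hxK
    rw [grad_eq_of_mem_affineSet hxX] at hxK
    rw [hgrad X hX x ⟨hxΩ, hxX⟩, hwK X hxK, add_zero]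
  · rw [hu.setLIntegral_eq hΩ.measurableSet, ← hu.sum_volume hΩ.measurableSet, Finset.mul_sum]
    refine Finset.sum_le_sum fun X hX => le_of_eq_of_le ?_ (hpend X)
    exact setLIntegral_congr_fun (hUm X) fun x hx => by simp only [hgrad X hX x hx]
  · rw [hu.setLIntegral_eq hΩ.measurableSet, ← hu.sum_volume hΩ.measurableSet, Finset.mul_sum,
      hu.lintegral_comp_grad hΩ.measurableSet fun X => ENNReal.ofReal (pending α K X),
      Finset.mul_sum, ← Finset.sum_add_distrib]
    refine Finset.sum_le_sum fun X hX => (le_of_eq_of_le ?_ (hdiff X)).trans_eq ?_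
    · exact setLIntegral_congr_fun (hUm X) fun x hx => by simp only [hgrad X hX x hx]
    · rw [ENNReal.ofReal_add (mul_nonneg zero_le_two (pending_nonneg X)) hε'.le,
        ENNReal.ofReal_mul zero_le_two, ENNReal.ofReal_ofNat, add_mul, mul_assoc]

theorem exists_energy_ball [Nonempty (Fin m)] (hφ : ∀ Y, 0 ≤ φ Y)
    (hX : ∃ c, 0 ≤ c ∧ ∀ ε : ℝ, 0 < ε → ∀ L : ℝ, ∃ k g,
      IsPartialResolution α K X k g c ε ∧ L ≤ moment φ k)
    (hU : IsOpen U) {x : Euc m} (hx : x ∈ U) (hUX : U ⊆ affineSet u X) (hε : 0 < ε) (hτ : 0 < τ) :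
    ∃ r, Metric.ball x r ⊆ U ∧ volume (Metric.ball x r) ≤ ENNReal.ofReal ε ∧
      ∃ (w : Euc m → Euc d) (F : Finset (Mat d m)), IsPerturbation α τ (Metric.ball x r) w ∧
        IsPiecewiseAffineOn (Metric.ball x r) (u + w) F ∧
        ∫⁻ y in Metric.ball x r, ENNReal.ofReal (pending α K (grad (u + w) y)) ≤
          ENNReal.ofReal ε ∧
        ∫⁻ y in Metric.ball x r, ENNReal.ofReal ‖grad (u + w) y - grad u y‖ ≤ ENNReal.ofReal ε ∧
        2 ≤ ∫⁻ y in Metric.ball x r, ENNReal.ofReal (K.indicator φ (grad (u + w) y)) := by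
  obtain ⟨c, hc, hres⟩ := hX
  set C := c + 1 + ‖X‖
  have hC1 : 1 ≤ C := by linarith [norm_nonneg X]
  obtain ⟨r, hr, hrU, hvol⟩ := exists_ball_subset_measure_le hU hx
    (ENNReal.ofReal_pos.2 (show 0 < ε / C by positivity))
  set B := Metric.ball x r
  have hbound : ∀ t ≤ C, ENNReal.ofReal t * volume B ≤ ENNReal.ofReal ε := fun t ht =>
    calc ENNReal.ofReal t * volume B ≤ ENNReal.ofReal C * ENNReal.ofReal (ε / C) := by gcongr
      _ = ENNReal.ofReal ε := by
        rw [← ENNReal.ofReal_mul (by positivity), mul_div_cancel₀ ε (by positivity)]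
  have hBX : B ⊆ affineSet u X := hrU.trans hUX
  have hBpos : 0 < volume.real B :=
    ENNReal.toReal_pos (Metric.measure_ball_pos volume x hr).ne' measure_ball_lt_top.ne
  obtain ⟨k, g, hkg, hL⟩ := hres (1 / 2) (by norm_num) (4 / volume.real B)
  obtain ⟨w, F, hw, hpw, hpend, hdiff, hen⟩ := hkg.exists_isPerturbation hc (by norm_num) hφ hτ
    Metric.isOpen_ball Metric.isBounded_ball hBX
  refine ⟨r, hrU, ?_, w, F, hw, hpw, hpend.trans (hbound _ (by linarith)), ?_, ?_⟩
  · simpa using hbound 1 hC1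
  · rw [setLIntegral_congr_fun measurableSet_ball fun y hy => by
      simp only [grad_eq_of_mem_affineSet (hBX hy)]; rfl]
    exact hdiff.trans (hbound _ (by linarith))
  · refine le_trans ?_ hen
    rw [div_le_iff₀ hBpos] at hL
    calc (2 : ℝ≥0∞) = ENNReal.ofReal 2 := ENNReal.ofReal_ofNat 2 |>.symm
      _ ≤ ENNReal.ofReal (moment φ k / 2 * volume.real B) :=
        ENNReal.ofReal_le_ofReal (by linarith)
      _ = ENNReal.ofReal (moment φ k / 2) * volume B := by
        rw [ENNReal.ofReal_mul' hBpos.le, ofReal_measureReal measure_ball_lt_top.ne]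

theorem IsPiecewiseAffineOn.exists_energy_step [Nonempty (Fin m)] (hφ : ∀ Y, 0 ≤ φ Y)
    (hK : ∀ X : Mat d m, ∃ c, 0 ≤ c ∧ ∀ ε : ℝ, 0 < ε → ∀ L : ℝ, ∃ k g,
      IsPartialResolution α K X k g c ε ∧ L ≤ moment φ k)
    (hΩ : IsOpen Ω) (hu : IsPiecewiseAffineOn Ω u F) (hU : IsOpen U) (hne : U.Nonempty)
    (hUΩ : U ⊆ Ω) (hε : 0 < ε) (hτ : 0 < τ) :
    ∃ (v : Euc m → Euc d) (G : Finset (Mat d m)) (B : Set (Euc m)), IsPerturbation α τ Ω v ∧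
      IsPiecewiseAffineOn Ω (u + v) G ∧ MeasurableSet B ∧ B ⊆ U ∧ volume B ≤ ENNReal.ofReal ε ∧
      (∀ᵐ x ∂volume.restrict Ω, x ∉ B → grad (u + v) x = grad u x) ∧
      ∫⁻ x in Ω, ENNReal.ofReal (pending α K (grad (u + v) x)) ≤
        (∫⁻ x in Ω, ENNReal.ofReal (pending α K (grad u x))) + ENNReal.ofReal ε ∧
      ∫⁻ x in Ω, ENNReal.ofReal ‖grad (u + v) x - grad u x‖ ≤ ENNReal.ofReal ε ∧
      2 ≤ ∫⁻ x in B, ENNReal.ofReal (K.indicator φ (grad (u + v) x)) := by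
  classical
  obtain ⟨x, hxU, X, -, hxX⟩ := hu.exists_mem_affineSet hU hne hUΩ
  obtain ⟨r, hrU, hvol, w, G, hw, hpw, hpend, hdiff, hen⟩ := exists_energy_ball hφ (hK X)
    (hU.inter (isOpen_affineSet u X)) ⟨hxU, hxX⟩ inter_subset_right hε hτ
  set B := Metric.ball x r
  have hBm : MeasurableSet B := measurableSet_ball
  have hBU : B ⊆ U := hrU.trans inter_subset_left
  have hsplit : ∀ f : Euc m → ℝ≥0∞, ∫⁻ y in Ω, f y = (∫⁻ y in Ω \ B, f y) + ∫⁻ y in B, f y :=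
    fun f => by
      rw [← lintegral_inter_add_sdiff f Ω hBm, inter_eq_right.2 (hBU.trans hUΩ), add_comm]
  have hzero := hw.ae_eventuallyEq_zero Metric.isOpen_ball
    ((convex_ball x r).addHaar_frontier volume)
  have hout : ∀ᵐ y, y ∉ B → grad (u + w) y = grad u y :=
    hzero.mono fun y hy hyB => grad_add_of_eventuallyEq_zero (hy hyB)
  have hdiffm : MeasurableSet (Ω \ B) := hΩ.measurableSet.diff hBm
  refine ⟨w, F ∪ G, B, hw.mono le_rfl (hBU.trans hUΩ), hu.union hBm hpw hzero, hBm, hBU, hvol,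
    ae_restrict_of_ae hout, ?_, ?_, hen⟩
  · rw [hsplit]
    refine add_le_add ?_ hpend
    rw [setLIntegral_congr_fun_ae hdiffm (hout.mono fun y hy hyB => by rw [hy hyB.2])]
    exact lintegral_mono_set sdiff_subset
  · rw [hsplit, setLIntegral_congr_fun_ae (g := fun _ => 0) hdiffm
      (hout.mono fun y hy hyB => by simp [hy hyB.2])]
    simpa using hdiff

end Step

/-! ### The sequence of maps -/

section Iteration

theorem exists_open_seq_frequently_subset {S : Type*} [TopologicalSpace S]
    [SecondCountableTopology S] {Ω : Set S} (hΩ : IsOpen Ω) (hne : Ω.Nonempty) :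
    ∃ D : ℕ → Set S, (∀ k, IsOpen (D k) ∧ (D k).Nonempty ∧ D k ⊆ Ω) ∧
      ∀ U, IsOpen U → U.Nonempty → U ⊆ Ω → ∃ᶠ k in atTop, D k ⊆ U := by
  have hbasis := TopologicalSpace.isBasis_countableBasis S
  set C := {V ∈ TopologicalSpace.countableBasis S | V.Nonempty ∧ V ⊆ Ω}
  have hC : ∀ U, IsOpen U → U.Nonempty → U ⊆ Ω → ∃ V ∈ C, V ⊆ U := by
    rintro U hU ⟨x, hx⟩ hUΩ
    obtain ⟨V, hV, hxV, hVU⟩ := hbasis.exists_subset_of_mem_open hx hU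
    exact ⟨V, ⟨hV, ⟨x, hxV⟩, hVU.trans hUΩ⟩, hVU⟩
  obtain ⟨V₀, hV₀, -⟩ := hC Ω hΩ hne Subset.rfl
  obtain ⟨E, hE⟩ := ((TopologicalSpace.countable_countableBasis S).mono
    (sep_subset _ _)).exists_eq_range (s := C) ⟨V₀, hV₀⟩
  refine ⟨fun k => E k.unpair.1, fun k => ?_, fun U hU hUne hUΩ => ?_⟩
  · obtain ⟨hk, hk'⟩ : E k.unpair.1 ∈ C := hE ▸ mem_range_self _
    exact ⟨hbasis.isOpen hk, hk'⟩
  · obtain ⟨V, hV, hVU⟩ := hC U hU hUne hUΩ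
    obtain ⟨i, rfl⟩ : V ∈ range E := hE ▸ hV
    exact frequently_atTop.2 fun n => ⟨Nat.pair i n, Nat.right_le_pair i n, by simpa using hVU⟩

theorem measurable_frobenius_norm (d m : ℕ) : Measurable fun X : Mat d m => ‖X‖ := by
  have (i : Fin d) (j : Fin m) : Measurable fun X : Mat d m => X i j :=
    (measurable_pi_apply j).comp (measurable_pi_apply (X := fun _ : Fin d => Fin m → ℝ) i)
  simp_rw [Matrix.frobenius_norm_def]
  fun_prop

variable {d m : ℕ} {α τ : ℝ≥0} {K : Set (Mat d m)} {φ : Mat d m → ℝ} {Ω U : Set (Euc m)}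
  {u v : Euc m → Euc d} {F F' : Finset (Mat d m)} {ε : ℝ}

theorem measurable_norm_grad_sub (hu : Continuous u) (hv : Continuous v) :
    Measurable fun x => ENNReal.ofReal ‖grad u x - grad v x‖ := by
  have hentry : ∀ {w : Euc m → Euc d}, Continuous w → ∀ i j, Measurable fun x => grad w x i j :=
    fun hw i j => measurable_pi_iff.1 (measurable_pi_iff.1 (measurable_grad hw) i) j
  refine ENNReal.measurable_ofReal.comp ((measurable_frobenius_norm d m).comp ?_)
  exact measurable_pi_iff.2 fun i => measurable_pi_iff.2 fun j =>
    (hentry hu i j).sub (hentry hv i j)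

theorem IsPiecewiseAffineOn.mono (h : IsPiecewiseAffineOn Ω u F) (hF : F ⊆ F') :
    IsPiecewiseAffineOn Ω u F' :=
  Eventually.mono h fun _ ⟨X, hX, hx⟩ => ⟨X, hF hX, hx⟩

/-- One stage of the construction: `u'` is a perturbation of `u` at scale `τ` with error `ε`. The
gradients of `u` that belong to `K` are changed only in the small set `B ⊆ D`, where the gradients
of `u'` in `K` have energy `∫ φ ≥ 2`, and little of the gradient of `u'` is left outside of `K`. -/
structure IsStage (α : ℝ≥0) (K : Set (Mat d m)) (φ : Mat d m → ℝ) (Ω D : Set (Euc m)) (τ : ℝ≥0)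
    (ε : ℝ) (u u' : Euc m → Euc d) (B : Set (Euc m)) : Prop where
  isPerturbation : IsPerturbation α τ Ω (u' - u)
  measurableSet : MeasurableSet B
  subset : B ⊆ D
  volume_le : volume B ≤ ENNReal.ofReal ε
  stable : ∀ᵐ x ∂volume.restrict Ω, x ∉ B → grad u x ∈ K → grad u' x = grad u x
  pending_le : ∫⁻ x in Ω, ENNReal.ofReal (pending α K (grad u' x)) ≤ ENNReal.ofReal ε
  diff_le : ∫⁻ x in Ω, ENNReal.ofReal ‖grad u' x - grad u x‖ ≤
    2 * (∫⁻ x in Ω, ENNReal.ofReal (pending α K (grad u x))) + 4 * ENNReal.ofReal ε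
  two_le_energy : 2 ≤ ∫⁻ x in B, ENNReal.ofReal (K.indicator φ (grad u' x))

theorem lintegral_norm_grad_sub_le {w : Euc m → Euc d} (hv : Continuous v) (hw : Continuous w) :
    ∫⁻ x in Ω, ENNReal.ofReal ‖grad u x - grad w x‖ ≤
      (∫⁻ x in Ω, ENNReal.ofReal ‖grad u x - grad v x‖) +
        ∫⁻ x in Ω, ENNReal.ofReal ‖grad v x - grad w x‖ := by
  rw [← lintegral_add_right _ (measurable_norm_grad_sub hv hw)]
  refine lintegral_mono fun x => ?_
  rw [← ENNReal.ofReal_add (norm_nonneg _) (norm_nonneg _)]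
  exact ENNReal.ofReal_le_ofReal (norm_sub_le_norm_sub_add_norm_sub _ _ _)

theorem lintegral_indicator_grad_mono {B : Set (Euc m)} (hφ : ∀ Y, 0 ≤ φ Y)
    (h : ∀ᵐ x ∂volume.restrict B, grad u x ∈ K → grad v x = grad u x) :
    ∫⁻ x in B, ENNReal.ofReal (K.indicator φ (grad u x)) ≤
      ∫⁻ x in B, ENNReal.ofReal (K.indicator φ (grad v x)) := by
  refine lintegral_mono_ae (h.mono fun x hx => ENNReal.ofReal_le_ofReal ?_)
  by_cases hxK : grad u x ∈ K
  · rw [hx hxK]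
  · rw [indicator_of_notMem hxK]
    exact indicator_nonneg (fun Y _ => hφ Y) _

theorem IsPiecewiseAffineOn.exists_isStage [Nonempty (Fin m)] (hφ : ∀ Y, 0 ≤ φ Y)
    (hK : ∀ X : Mat d m, Nonempty (Mixture α K X))
    (hK' : ∀ X : Mat d m, ∃ c, 0 ≤ c ∧ ∀ ε : ℝ, 0 < ε → ∀ L : ℝ, ∃ k g,
      IsPartialResolution α K X k g c ε ∧ L ≤ moment φ k)
    (hΩ : IsOpen Ω) (hΩb : Bornology.IsBounded Ω) (hu : IsPiecewiseAffineOn Ω u F)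
    (huc : Continuous u) (hU : IsOpen U) (hne : U.Nonempty) (hUΩ : U ⊆ Ω) (hε : 0 < ε)
    (hτ : 0 < τ) :
    ∃ (u' : Euc m → Euc d) (F' : Finset (Mat d m)) (B : Set (Euc m)),
      IsPiecewiseAffineOn Ω u' F' ∧ IsStage α K φ Ω U τ ε u u' B := by
  obtain ⟨v, F₁, B, hv, hF₁, hB, hBU, hBvol, hstable, hpend, hdiff, hen⟩ :=
    hu.exists_energy_step hφ hK' hΩ hU hne hUΩ hε (half_pos hτ)
  obtain ⟨w, F₂, hw, hF₂, hstable', hpend', hdiff'⟩ :=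
    hF₁.exists_resolve_step hK hΩ hΩb hε (half_pos hτ)
  have huv : Continuous (u + v) := by
    obtain ⟨L, hL⟩ := hv.lip
    exact huc.add hL.continuous
  refine ⟨u + v + w, F₂, B, hF₂, ?_, hB, hBU, hBvol, ?_, hpend', ?_, hen.trans ?_⟩
  · rw [add_assoc, add_sub_cancel_left]
    exact (hv.add hw).mono (add_halves τ).le le_rfl
  · filter_upwards [hstable, hstable'] with x hx hx' hxB hxK
    rw [hx' (by rwa [hx hxB]), hx hxB]
  · calc ∫⁻ x in Ω, ENNReal.ofReal ‖grad (u + v + w) x - grad u x‖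
      _ ≤ 2 * ((∫⁻ x in Ω, ENNReal.ofReal (pending α K (grad u x))) + ENNReal.ofReal ε)
            + ENNReal.ofReal ε + ENNReal.ofReal ε :=
          (lintegral_norm_grad_sub_le huv huc).trans (add_le_add (hdiff'.trans (by gcongr)) hdiff)
      _ = 2 * (∫⁻ x in Ω, ENNReal.ofReal (pending α K (grad u x))) + 4 * ENNReal.ofReal ε := by
          ring
  · exact lintegral_indicator_grad_mono hφ
      (ae_mono (Measure.restrict_mono (hBU.trans hUΩ) le_rfl) hstable')

/-- The error allowed in the `k`-th stage, if `F` contains the gradients of the current map: a set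
whose volume is at most this number carries little of the energy of that map. -/
noncomputable def stageError (φ : Mat d m → ℝ) (k : ℕ) (F : Finset (Mat d m)) : ℝ :=
  2⁻¹ ^ (k + 1) / (1 + ∑ X ∈ F, φ X)

theorem stageError_pos (hφ : ∀ Y, 0 ≤ φ Y) (k : ℕ) (F : Finset (Mat d m)) :
    0 < stageError φ k F :=
  div_pos (by positivity) (by linarith [Finset.sum_nonneg fun X (_ : X ∈ F) => hφ X])

theorem ofReal_two_inv_pow (k : ℕ) : ENNReal.ofReal (2⁻¹ ^ k) = 2⁻¹ ^ k := by
  rw [ENNReal.ofReal_pow (by norm_num), ENNReal.ofReal_inv_of_pos two_pos, ENNReal.ofReal_ofNat]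

theorem ofReal_stageError_le (hφ : ∀ Y, 0 ≤ φ Y) (k : ℕ) (F : Finset (Mat d m)) :
    ENNReal.ofReal (stageError φ k F) ≤ 2⁻¹ ^ (k + 1) := by
  rw [← ofReal_two_inv_pow]
  exact ENNReal.ofReal_le_ofReal (div_le_self (by positivity)
    (by linarith [Finset.sum_nonneg fun X (_ : X ∈ F) => hφ X]))

theorem ofReal_sum_mul_stageError_le (hφ : ∀ Y, 0 ≤ φ Y) (k : ℕ) (hF : F ⊆ F') :
    ENNReal.ofReal (∑ X ∈ F, φ X) * ENNReal.ofReal (stageError φ k F') ≤ 2⁻¹ ^ (k + 1) := by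
  have hF' : 0 ≤ ∑ X ∈ F', φ X := Finset.sum_nonneg fun X _ => hφ X
  have hle : ∑ X ∈ F, φ X ≤ 1 + ∑ X ∈ F', φ X := by
    linarith [Finset.sum_le_sum_of_subset_of_nonneg hF fun X _ _ => hφ X]
  rw [← ENNReal.ofReal_mul (Finset.sum_nonneg fun X _ => hφ X), ← ofReal_two_inv_pow]
  refine ENNReal.ofReal_le_ofReal ?_
  calc (∑ X ∈ F, φ X) * stageError φ k F'
    _ ≤ (1 + ∑ X ∈ F', φ X) * stageError φ k F' := by
        gcongr
        exact (stageError_pos hφ k F').le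
    _ = 2⁻¹ ^ (k + 1) := mul_div_cancel₀ _ (by positivity)

/-- A sequence of Lipschitz maps `u k` that are piecewise affine with gradients in `F k`, each of
which is obtained from the previous one by a stage that adds energy inside of `D k`. -/
structure IsStageSeq (α : ℝ≥0) (K : Set (Mat d m)) (φ : Mat d m → ℝ) (Ω : Set (Euc m))
    (D : ℕ → Set (Euc m)) (τ : ℝ≥0) (u : ℕ → Euc m → Euc d) (F : ℕ → Finset (Mat d m))
    (B : ℕ → Set (Euc m)) : Prop where
  lipschitz : ∀ k, ∃ L, LipschitzWith L (u k)
  isPiecewiseAffineOn : ∀ k, IsPiecewiseAffineOn Ω (u k) (F k)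
  monotone : Monotone F
  isStage : ∀ k, IsStage α K φ Ω (D k) (τ * 2⁻¹ ^ (k + 1)) (stageError φ k (F k)) (u k) (u (k + 1))
    (B k)

theorem exists_isStageSeq [Nonempty (Fin m)] (hφ : ∀ Y, 0 ≤ φ Y)
    (hK : ∀ X : Mat d m, Nonempty (Mixture α K X))
    (hK' : ∀ X : Mat d m, ∃ c, 0 ≤ c ∧ ∀ ε : ℝ, 0 < ε → ∀ L : ℝ, ∃ k g,
      IsPartialResolution α K X k g c ε ∧ L ≤ moment φ k)
    (hΩ : IsOpen Ω) (hΩb : Bornology.IsBounded Ω) {D : ℕ → Set (Euc m)}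
    (hD : ∀ k, IsOpen (D k) ∧ (D k).Nonempty ∧ D k ⊆ Ω) (hτ : 0 < τ)
    (hu : IsPiecewiseAffineOn Ω u F) (hlip : ∃ L, LipschitzWith L u) :
    ∃ v F B, IsStageSeq α K φ Ω D τ v F B ∧ v 0 = u := by
  classical
  let S := {q : (Euc m → Euc d) × Finset (Mat d m) //
    (∃ L, LipschitzWith L q.1) ∧ IsPiecewiseAffineOn Ω q.1 q.2}
  have hstep : ∀ (k : ℕ) (q : S), ∃ (q' : S) (B : Set (Euc m)), q.1.2 ⊆ q'.1.2 ∧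
      IsStage α K φ Ω (D k) (τ * 2⁻¹ ^ (k + 1)) (stageError φ k q.1.2) q.1.1 q'.1.1 B := by
    rintro k ⟨⟨u, F⟩, ⟨L, hL⟩, hu⟩
    obtain ⟨hDo, hDne, hDΩ⟩ := hD k
    obtain ⟨u', F', B, hF', hB⟩ := hu.exists_isStage hφ hK hK' hΩ hΩb hL.continuous hDo hDne hDΩ
      (stageError_pos hφ k F) (τ := τ * 2⁻¹ ^ (k + 1)) (by positivity)
    obtain ⟨L', hL'⟩ := hB.isPerturbation.lip
    refine ⟨⟨⟨u', F ∪ F'⟩, ⟨L' + L, ?_⟩, hF'.mono Finset.subset_union_right⟩, B,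
      Finset.subset_union_left, hB⟩
    simpa using hL'.add hL
  choose next B hF hstage using hstep
  let q : ℕ → S := fun k => Nat.rec ⟨⟨u, F⟩, hlip, hu⟩ next k
  exact ⟨fun k => (q k).1.1, fun k => (q k).1.2, fun k => B k (q k),
    ⟨fun k => (q k).2.1, fun k => (q k).2.2, monotone_nat_of_le_succ fun k => hF k (q k),
      fun k => hstage k (q k)⟩, rfl⟩

end Iteration

/-! ### The limit map -/

section Limit

theorem integrable_of_tendsto_of_norm_le {S E : Type*} [MeasurableSpace S] [NormedAddCommGroup E]
    {μ : Measure S} {f : ℕ → S → E} {g : S → E} {H : S → ℝ} (hH : Integrable H μ)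
    (hf : ∀ k, AEStronglyMeasurable (f k) μ) (hle : ∀ k, ∀ᵐ x ∂μ, ‖f k x‖ ≤ H x)
    (hlim : ∀ᵐ x ∂μ, Tendsto (fun k => f k x) atTop (𝓝 (g x))) : Integrable g μ :=
  ⟨aestronglyMeasurable_of_tendsto_ae atTop hf hlim,
    hasFiniteIntegral_of_dominated_convergence hH.hasFiniteIntegral hle hlim⟩

theorem tendsto_integral_mul {S : Type*} [MeasurableSpace S] {μ : Measure S} {f : ℕ → S → ℝ}
    {g H ψ : S → ℝ} {C : ℝ} (hH : Integrable H μ) (hf : ∀ k, AEStronglyMeasurable (f k) μ)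
    (hle : ∀ k, ∀ᵐ x ∂μ, ‖f k x‖ ≤ H x)
    (hlim : ∀ᵐ x ∂μ, Tendsto (fun k => f k x) atTop (𝓝 (g x))) (hψ : AEStronglyMeasurable ψ μ)
    (hC : ∀ x, ‖ψ x‖ ≤ C) :
    Tendsto (fun k => ∫ x, f k x * ψ x ∂μ) atTop (𝓝 (∫ x, g x * ψ x ∂μ)) := by
  refine tendsto_integral_of_dominated_convergence (fun x => H x * C) (fun k => (hf k).mul hψ)
    (hH.mul_const C) (fun k => (hle k).mono fun x hx => ?_) (hlim.mono fun x hx => hx.mul_const _)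
  rw [norm_mul]
  exact mul_le_mul hx (hC x) (norm_nonneg _) ((norm_nonneg _).trans hx)

theorem exists_mem_eventually_eq_of_stable {T : Type*} {a : ℕ → T} {K : Set T} {p : ℕ → Prop}
    (hp : ∀ᶠ k in atTop, ¬p k) (hK : ∃ᶠ k in atTop, a k ∈ K)
    (hstable : ∀ k, ¬p k → a k ∈ K → a (k + 1) = a k) :
    ∃ Y ∈ K, (∀ᶠ k in atTop, a k = Y) ∧ ∀ n, (∀ k ≥ n, ¬p k) → a n ∈ K → a n = Y := by
  have hconst : ∀ n, (∀ k ≥ n, ¬p k) → a n ∈ K → ∀ k ≥ n, a k = a n := by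
    intro n hn hnK k hk
    induction k, hk using Nat.le_induction with
    | base => rfl
    | succ k hk ih => rw [← ih, hstable k (hn k hk) (by rwa [ih])]
  obtain ⟨N, hN⟩ := eventually_atTop.1 hp
  obtain ⟨n, hNn, hnK⟩ := frequently_atTop.1 hK N
  have hn := hconst n (fun k hk => hN k (hNn.trans hk)) hnK
  refine ⟨a n, hnK, eventually_atTop.2 ⟨n, hn⟩, fun i hi hiK => ?_⟩
  rw [← hn _ (le_max_left n i), hconst i hi hiK _ (le_max_right n i)]

theorem ofReal_norm_le_add_sum {E : Type*} [SeminormedAddCommGroup E] (f : ℕ → E) (k : ℕ) :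
    ENNReal.ofReal ‖f k‖ ≤
      ENNReal.ofReal ‖f 0‖ + ∑ i ∈ Finset.range k, ENNReal.ofReal ‖f (i + 1) - f i‖ := by
  rw [← ENNReal.ofReal_sum_of_nonneg fun i _ => norm_nonneg _,
    ← ENNReal.ofReal_add (norm_nonneg _) (Finset.sum_nonneg fun i _ => norm_nonneg _)]
  refine ENNReal.ofReal_le_ofReal ?_
  calc ‖f k‖ = ‖f 0 + ∑ i ∈ Finset.range k, (f (i + 1) - f i)‖ := by
        rw [Finset.sum_range_sub, add_sub_cancel]
    _ ≤ ‖f 0‖ + ∑ i ∈ Finset.range k, ‖f (i + 1) - f i‖ :=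
        (norm_add_le _ _).trans (add_le_add le_rfl (norm_sum_le _ _))

theorem tsum_two_inv_pow_succ : ∑' k : ℕ, (2⁻¹ : ℝ≥0∞) ^ (k + 1) = 1 := by
  rw [ENNReal.tsum_geometric_add_one, ENNReal.one_sub_inv_two, inv_inv]
  exact ENNReal.inv_mul_cancel two_ne_zero ENNReal.ofNat_ne_top

theorem sum_range_two_inv_pow_succ_le (k : ℕ) :
    ∑ i ∈ Finset.range k, (2⁻¹ : ℝ≥0) ^ (i + 1) ≤ 1 := by
  have hsum : ∑ i ∈ Finset.range k, (2⁻¹ : ℝ≥0) ^ (i + 1) + 2⁻¹ ^ k = 1 := by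
    induction k with
    | zero => simp
    | succ k ih =>
      rw [Finset.sum_range_succ, add_assoc, ← ih, pow_succ, ← mul_add]
      norm_num
  exact le_of_add_le_left hsum.le

theorem isPerturbation_sub_of_forall_succ {E V : Type*} [PseudoMetricSpace E]
    [SeminormedAddCommGroup V] {α τ : ℝ≥0} {Ω : Set E} {u : ℕ → E → V}
    (h : ∀ k, IsPerturbation α (τ * 2⁻¹ ^ (k + 1)) Ω (u (k + 1) - u k)) (k : ℕ) :
    IsPerturbation α τ Ω (u k - u 0) := by
  rw [← Finset.sum_range_sub u k]
  refine (IsPerturbation.sum (Finset.range k) fun i _ => h i).mono ?_ le_rfl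
  rw [← Finset.mul_sum]
  exact mul_le_of_le_one_right' (sum_range_two_inv_pow_succ_le k)

theorem exists_tendsto_of_isPerturbation {E V : Type*} [PseudoMetricSpace E]
    [NormedAddCommGroup V] [CompleteSpace V] {α τ : ℝ≥0} {Ω : Set E} {u : ℕ → E → V}
    (h : ∀ k, IsPerturbation α (τ * 2⁻¹ ^ (k + 1)) Ω (u (k + 1) - u k)) :
    ∃ w : E → V, Continuous w ∧ (∀ x ∉ Ω, w x = 0) ∧ (∀ x, ‖w x‖ ≤ τ) ∧ HolderWith τ α w ∧
      ∀ x, Tendsto (fun k => u k x) atTop (𝓝 (u 0 x + w x)) := by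
  have hpart := isPerturbation_sub_of_forall_succ h
  have hsum : Summable fun k : ℕ => (τ : ℝ) * 2⁻¹ ^ (k + 1) :=
    ((summable_nat_add_iff 1).2 (summable_geometric_of_lt_one (by norm_num)
      (by norm_num : (2⁻¹ : ℝ) < 1))).mul_left _
  have hbound : ∀ k x, ‖u (k + 1) x - u k x‖ ≤ τ * 2⁻¹ ^ (k + 1) := fun k x => by
    simpa using (h k).bound x
  set w : E → V := fun x => ∑' k, (u (k + 1) x - u k x)
  have hlim : ∀ x, Tendsto (fun k => u k x - u 0 x) atTop (𝓝 (w x)) := fun x => by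
    simpa only [Finset.sum_range_sub fun k => u k x] using
      (Summable.of_norm_bounded hsum fun k => hbound k x).hasSum.tendsto_sum_nat
  refine ⟨w, ?_, fun x hx => ?_, fun x => ?_, fun x y => ?_, fun x => ?_⟩
  · refine continuous_tsum (fun k => ?_) hsum hbound
    obtain ⟨L, hL⟩ := (h k).lip
    exact hL.continuous
  · exact tendsto_nhds_unique (hlim x)
      (tendsto_const_nhds.congr fun k => ((hpart k).zero x hx).symm)
  · exact le_of_tendsto (hlim x).norm (.of_forall fun k => (hpart k).bound x)
  · exact le_of_tendsto ((hlim x).edist (hlim y)) (.of_forall fun k => (hpart k).holder x y)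
  · simpa using (hlim x).const_add (u 0 x)

variable {d m : ℕ} {α τ : ℝ≥0} {K : Set (Mat d m)} {φ : Mat d m → ℝ} {Ω : Set (Euc m)}

theorem abs_apply_le_frobenius_norm (X : Mat d m) (i : Fin d) (j : Fin m) : |X i j| ≤ ‖X‖ :=
  (PiLp.norm_apply_le (WithLp.toLp 2 (X i)) j).trans
    (PiLp.norm_apply_le (WithLp.toLp 2 fun i => (WithLp.toLp 2 (X i) : Euc m)) i)

theorem setIntegral_grad_mul_of_lipschitzWith {v : Euc m → Euc d} {L : ℝ≥0}
    (hv : LipschitzWith L v) {ψ : Euc m → ℝ} (hψ : ContDiff ℝ (⊤ : ℕ∞) ψ)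
    (hc : HasCompactSupport ψ) (hs : tsupport ψ ⊆ Ω) (i : Fin d) (j : Fin m) :
    ∫ x in Ω, v x i * fderiv ℝ ψ x (EuclideanSpace.single j 1) =
      -∫ x in Ω, grad v x i j * ψ x := by
  obtain ⟨L', hL'⟩ := hψ.lipschitzWith_of_hasCompactSupport hc (by simp)
  have hvi : LipschitzWith _ fun x => v x i :=
    (EuclideanSpace.proj i : Euc d →L[ℝ] ℝ).lipschitz.comp hv
  have hout : ∀ x ∉ Ω, x ∉ tsupport ψ := fun x hx hx' => hx (hs hx')
  rw [setIntegral_eq_integral_of_forall_compl_eq_zero fun x hx => by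
      rw [fderiv_of_notMem_tsupport ℝ (hout x hx), zero_apply, mul_zero],
    setIntegral_eq_integral_of_forall_compl_eq_zero fun x hx => by
      rw [image_eq_zero_of_notMem_tsupport (hout x hx), mul_zero]]
  refine Eq.trans ?_ (congrArg Neg.neg (hvi.integral_lineDeriv_mul_eq (μ := volume) hL' hc
    (EuclideanSpace.single j (1 : ℝ)))).symm
  rw [← integral_neg]
  refine integral_congr_ae (.of_forall fun x => ?_)
  have hd : DifferentiableAt ℝ ψ x := (hψ.differentiable (by simp)).differentiableAt
  simp only [hd.lineDeriv_eq_fderiv, map_neg]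
  ring

theorem isSobolevW11_of_tendsto {u : ℕ → Euc m → Euc d} {U : Euc m → Euc d} {G : Euc m → Mat d m}
    {H H' : Euc m → ℝ} (hu : ∀ k, ∃ L, LipschitzWith L (u k)) (hH : IntegrableOn H Ω)
    (hH' : IntegrableOn H' Ω) (hle : ∀ k, ∀ᵐ x ∂volume.restrict Ω, ‖u k x‖ ≤ H x)
    (hle' : ∀ k, ∀ᵐ x ∂volume.restrict Ω, ‖grad (u k) x‖ ≤ H' x)
    (hlim : ∀ᵐ x ∂volume.restrict Ω, Tendsto (fun k => u k x) atTop (𝓝 (U x)))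
    (hlim' : ∀ i j, ∀ᵐ x ∂volume.restrict Ω,
      Tendsto (fun k => grad (u k) x i j) atTop (𝓝 (G x i j))) :
    IsSobolevW11 Ω U G := by
  have hcont : ∀ k, Continuous (u k) := fun k => (hu k).elim fun L hL => hL.continuous
  have hmeas : ∀ k i j, AEStronglyMeasurable (fun x => grad (u k) x i j) (volume.restrict Ω) :=
    fun k i j => (measurable_pi_iff.1 (measurable_pi_iff.1
      (measurable_grad (hcont k)) i) j).aestronglyMeasurable
  have hle'' : ∀ i j k, ∀ᵐ x ∂volume.restrict Ω, ‖grad (u k) x i j‖ ≤ H' x := fun i j k =>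
    (hle' k).mono fun x hx => (abs_apply_le_frobenius_norm _ i j).trans hx
  refine ⟨integrable_of_tendsto_of_norm_le hH (fun k => (hcont k).aestronglyMeasurable) hle hlim,
    fun i j => integrable_of_tendsto_of_norm_le hH' (fun k => hmeas k i j) (hle'' i j) (hlim' i j),
    fun ψ hψ hc hs i j => ?_⟩
  have hderiv : Continuous fun x => fderiv ℝ ψ x (EuclideanSpace.single j 1) :=
    (hψ.continuous_fderiv (by simp)).clm_apply continuous_const
  obtain ⟨C, hC⟩ := hc.exists_bound_of_continuous hψ.continuous
  obtain ⟨C', hC'⟩ := (hc.fderiv_apply ℝ _).exists_bound_of_continuous hderiv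
  have hmap := tendsto_integral_mul (f := fun k x => u k x i) (g := fun x => U x i) hH
    (fun k => by have := hcont k; fun_prop)
    (fun k => (hle k).mono fun x hx => (PiLp.norm_apply_le (u k x) i).trans hx)
    (hlim.mono fun x hx => ((EuclideanSpace.proj i : Euc d →L[ℝ] ℝ).continuous.tendsto _).comp hx)
    hderiv.aestronglyMeasurable hC'
  have hgrad := tendsto_integral_mul hH' (fun k => hmeas k i j) (hle'' i j) (hlim' i j)
    hψ.continuous.aestronglyMeasurable hC
  refine tendsto_nhds_unique hmap (hgrad.neg.congr fun k => ?_)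
  obtain ⟨L, hL⟩ := hu k
  exact (setIntegral_grad_mul_of_lipschitzWith hL hψ hc hs i j).symm

theorem IsPiecewiseAffineOn.lintegral_comp_grad_ne_top {u : Euc m → Euc d} {F : Finset (Mat d m)}
    (h : IsPiecewiseAffineOn Ω u F) (hΩ : MeasurableSet Ω) (hfin : volume Ω ≠ ⊤)
    {ψ : Mat d m → ℝ≥0∞} (hψ : ∀ X, ψ X ≠ ⊤) : ∫⁻ x in Ω, ψ (grad u x) ≠ ⊤ := by
  rw [h.lintegral_comp_grad hΩ]
  exact ENNReal.sum_ne_top.2 fun X _ =>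
    ENNReal.mul_ne_top (hψ X) (measure_ne_top_of_subset inter_subset_left hfin)

theorem IsPiecewiseAffineOn.measure_grad_notMem_le {u : Euc m → Euc d} {F : Finset (Mat d m)}
    (h : IsPiecewiseAffineOn Ω u F) (hΩ : MeasurableSet Ω) :
    volume.restrict Ω {x | grad u x ∉ K} ≤
      ∫⁻ x in Ω, ENNReal.ofReal (pending α K (grad u x)) := by
  classical
  have hsub : {x | grad u x ∉ K} ≤ᵐ[volume.restrict Ω] ⋃ X ∈ F.filter (· ∉ K), affineSet u X := by
    unfold IsPiecewiseAffineOn at h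
    filter_upwards [h] with x ⟨X, hX, hx⟩ hxK
    have hXK : X ∉ K := grad_eq_of_mem_affineSet hx ▸ hxK
    exact mem_biUnion (Finset.mem_coe.2 (Finset.mem_filter.2 ⟨hX, hXK⟩)) hx
  rw [h.lintegral_comp_grad hΩ fun X => ENNReal.ofReal (pending α K X)]
  refine ((measure_mono_ae hsub).trans (measure_biUnion_finset_le _ _)).trans
    ((Finset.sum_le_sum fun X hX => ?_).trans
      (Finset.sum_le_sum_of_subset (Finset.filter_subset (· ∉ K) F)))
  rw [Measure.restrict_apply (measurableSet_affineSet u X), inter_comm]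
  refine le_mul_of_one_le_left bot_le ?_
  rw [pending_of_notMem (Finset.mem_filter.1 hX).2, ENNReal.one_le_ofReal]
  linarith [norm_nonneg X, one_add_norm_le_price (α := α) (K := K) X]

variable {D : ℕ → Set (Euc m)} {u : ℕ → Euc m → Euc d} {F : ℕ → Finset (Mat d m)}
  {B : ℕ → Set (Euc m)}

namespace IsStageSeq

theorem continuous (h : IsStageSeq α K φ Ω D τ u F B) (k : ℕ) : Continuous (u k) :=
  (h.lipschitz k).elim fun _ hL => hL.continuous

theorem volume_le (h : IsStageSeq α K φ Ω D τ u F B) (hφ : ∀ Y, 0 ≤ φ Y) (k : ℕ) :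
    volume (B k) ≤ 2⁻¹ ^ (k + 1) :=
  (h.isStage k).volume_le.trans (ofReal_stageError_le hφ k (F k))

theorem pending_le (h : IsStageSeq α K φ Ω D τ u F B) (hφ : ∀ Y, 0 ≤ φ Y) (k : ℕ) :
    ∫⁻ x in Ω, ENNReal.ofReal (pending α K (grad (u (k + 1)) x)) ≤ 2⁻¹ ^ (k + 1) :=
  (h.isStage k).pending_le.trans (ofReal_stageError_le hφ k (F k))

theorem exists_grad (h : IsStageSeq α K φ Ω D τ u F B) (hφ : ∀ Y, 0 ≤ φ Y)
    (hΩ : MeasurableSet Ω) :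
    ∃ G : Euc m → Mat d m, ∀ᵐ x ∂volume.restrict Ω, G x ∈ K ∧
      (∀ᶠ k in atTop, grad (u k) x = G x) ∧
      ∀ n, (∀ k ≥ n, x ∉ B k) → grad (u n) x ∈ K → grad (u n) x = G x := by
  have hsum : ∑' k : ℕ, (2⁻¹ : ℝ≥0∞) ^ (k + 1) ≠ ⊤ :=
    tsum_two_inv_pow_succ ▸ ENNReal.one_ne_top
  have hB : ∀ᵐ x ∂volume.restrict Ω, ∀ᶠ k in atTop, x ∉ B k :=
    ae_eventually_notMem (ne_top_of_le_ne_top hsum (ENNReal.tsum_le_tsum fun k =>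
      (Measure.restrict_apply_le _ _).trans (h.volume_le hφ k)))
  have hK : ∀ᵐ x ∂volume.restrict Ω, ∀ᶠ k in atTop, x ∉ {x | grad (u (k + 1)) x ∉ K} :=
    ae_eventually_notMem (ne_top_of_le_ne_top hsum (ENNReal.tsum_le_tsum fun k =>
      ((h.isPiecewiseAffineOn (k + 1)).measure_grad_notMem_le hΩ).trans (h.pending_le hφ k)))
  have hpoint : ∀ᵐ x ∂volume.restrict Ω, ∃ Y, Y ∈ K ∧ (∀ᶠ k in atTop, grad (u k) x = Y) ∧
      ∀ n, (∀ k ≥ n, x ∉ B k) → grad (u n) x ∈ K → grad (u n) x = Y := by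
    filter_upwards [hB, hK, ae_all_iff.2 fun k => (h.isStage k).stable] with x hxB hxK hstable
    exact exists_mem_eventually_eq_of_stable hxB
      (((eventually_map (m := (· + 1))).2 (hxK.mono fun _ => not_not.1)).frequently.filter_mono
        (tendsto_add_atTop_nat 1)) hstable
  rcases (ae (volume.restrict Ω)).eq_or_neBot with hbot | hne
  · exact ⟨0, by simp only [hbot, eventually_bot]⟩
  · exact hpoint.choice

theorem tsum_lintegral_pending_ne_top (h : IsStageSeq α K φ Ω D τ u F B) (hφ : ∀ Y, 0 ≤ φ Y)
    (hΩ : MeasurableSet Ω) (hfin : volume Ω ≠ ⊤) :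
    ∑' k, ∫⁻ x in Ω, ENNReal.ofReal (pending α K (grad (u k) x)) ≠ ⊤ := by
  rw [tsum_eq_zero_add' ENNReal.summable]
  refine ENNReal.add_ne_top.2 ⟨(h.isPiecewiseAffineOn 0).lintegral_comp_grad_ne_top hΩ hfin
    (ψ := fun X => ENNReal.ofReal (pending α K X)) fun X => ENNReal.ofReal_ne_top, ?_⟩
  exact ne_top_of_le_ne_top ENNReal.one_ne_top
    ((ENNReal.tsum_le_tsum (h.pending_le hφ)).trans_eq tsum_two_inv_pow_succ)

theorem tsum_lintegral_norm_grad_sub_ne_top (h : IsStageSeq α K φ Ω D τ u F B)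
    (hφ : ∀ Y, 0 ≤ φ Y) (hΩ : MeasurableSet Ω) (hfin : volume Ω ≠ ⊤) :
    ∑' k, ∫⁻ x in Ω, ENNReal.ofReal ‖grad (u (k + 1)) x - grad (u k) x‖ ≠ ⊤ := by
  have hpend := h.tsum_lintegral_pending_ne_top hφ hΩ hfin
  refine ne_top_of_le_ne_top
    (b := 2 * (∑' k, ∫⁻ x in Ω, ENNReal.ofReal (pending α K (grad (u k) x))) + 4 * 1)
    (by finiteness) ?_
  rw [← tsum_two_inv_pow_succ, ← ENNReal.tsum_mul_left, ← ENNReal.tsum_mul_left, ← ENNReal.tsum_add]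
  refine ENNReal.tsum_le_tsum fun k => (h.isStage k).diff_le.trans ?_
  gcongr
  exact ofReal_stageError_le hφ k (F k)

theorem exists_integrableOn_norm_grad_le (h : IsStageSeq α K φ Ω D τ u F B) (hφ : ∀ Y, 0 ≤ φ Y)
    (hΩ : MeasurableSet Ω) (hfin : volume Ω ≠ ⊤) :
    ∃ H : Euc m → ℝ, IntegrableOn H Ω ∧
      ∀ k, ∀ᵐ x ∂volume.restrict Ω, ‖grad (u k) x‖ ≤ H x := by
  have hmeas : ∀ k, Measurable fun x => ENNReal.ofReal ‖grad (u (k + 1)) x - grad (u k) x‖ :=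
    fun k => measurable_norm_grad_sub (h.continuous _) (h.continuous _)
  have hmeas₀ : Measurable fun x => ENNReal.ofReal ‖grad (u 0) x‖ :=
    ENNReal.measurable_ofReal.comp
      ((measurable_frobenius_norm d m).comp (measurable_grad (h.continuous 0)))
  set S : Euc m → ℝ≥0∞ := fun x => ENNReal.ofReal ‖grad (u 0) x‖ +
    ∑' k, ENNReal.ofReal ‖grad (u (k + 1)) x - grad (u k) x‖
  have hS : Measurable S := hmeas₀.add (Measurable.tsum hmeas)
  have hSint : ∫⁻ x in Ω, S x ≠ ⊤ := by
    rw [lintegral_add_left hmeas₀, lintegral_tsum fun k => (hmeas k).aemeasurable]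
    exact ENNReal.add_ne_top.2 ⟨(h.isPiecewiseAffineOn 0).lintegral_comp_grad_ne_top hΩ hfin
      (ψ := fun X => ENNReal.ofReal ‖X‖) fun X => ENNReal.ofReal_ne_top,
      h.tsum_lintegral_norm_grad_sub_ne_top hφ hΩ hfin⟩
  refine ⟨fun x => (S x).toReal, integrable_toReal_of_lintegral_ne_top hS.aemeasurable hSint,
    fun k => ?_⟩
  filter_upwards [ae_lt_top hS hSint] with x hx
  rw [← ENNReal.ofReal_le_iff_le_toReal hx.ne]
  exact (ofReal_norm_le_add_sum (fun k => grad (u k) x) k).trans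
    (add_le_add le_rfl (ENNReal.sum_le_tsum _))

theorem isSobolevW11 (h : IsStageSeq α K φ Ω D τ u F B) (hφ : ∀ Y, 0 ≤ φ Y)
    (hΩ : MeasurableSet Ω) (hΩb : Bornology.IsBounded Ω) {U : Euc m → Euc d}
    (hlim : ∀ x, Tendsto (fun k => u k x) atTop (𝓝 (U x))) {G : Euc m → Mat d m}
    (hG : ∀ᵐ x ∂volume.restrict Ω, ∀ᶠ k in atTop, grad (u k) x = G x) : IsSobolevW11 Ω U G := by
  obtain ⟨H, hH, hle⟩ := h.exists_integrableOn_norm_grad_le hφ hΩ hΩb.measure_lt_top.ne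
  have hbound : ∀ k x, ‖u k x‖ ≤ ‖u 0 x‖ + τ := fun k x =>
    calc ‖u k x‖ = ‖u 0 x + (u k - u 0) x‖ := by rw [Pi.sub_apply, add_sub_cancel]
      _ ≤ ‖u 0 x‖ + τ := (norm_add_le _ _).trans (by
        gcongr
        exact (isPerturbation_sub_of_forall_succ (fun k => (h.isStage k).isPerturbation) k).bound x)
  have hint : IntegrableOn (fun x => ‖u 0 x‖ + (τ : ℝ)) Ω :=
    (((h.continuous 0).norm.add continuous_const).continuousOn.integrableOn_compact
      hΩb.isCompact_closure).mono_set subset_closure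
  refine isSobolevW11_of_tendsto h.lipschitz hint hH (fun k => .of_forall (hbound k)) hle
    (.of_forall hlim) fun i j => hG.mono fun x hx => ?_
  exact tendsto_const_nhds.congr' (hx.mono fun k hk => (congrFun (congrFun hk i) j).symm)

theorem energy_grad_le (h : IsStageSeq α K φ Ω D τ u F B) (hφ : ∀ Y, 0 ≤ φ Y) (k : ℕ) :
    ∀ᵐ x ∂volume.restrict Ω, K.indicator φ (grad (u k) x) ≤ ∑ X ∈ F k, φ X :=
  Eventually.mono (h.isPiecewiseAffineOn k) fun x ⟨X, hX, hx⟩ => by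
    rw [grad_eq_of_mem_affineSet hx]
    exact (indicator_le_self' (fun Y _ => hφ Y) X).trans
      (Finset.single_le_sum (fun Y _ => hφ Y) hX)

theorem ofReal_sum_mul_volume_iUnion_le (h : IsStageSeq α K φ Ω D τ u F B) (hφ : ∀ Y, 0 ≤ φ Y)
    (k : ℕ) : ENNReal.ofReal (∑ X ∈ F k, φ X) * volume (⋃ j, B (k + j)) ≤ 1 := by
  refine (mul_le_mul_right (measure_iUnion_le _) _).trans ?_
  rw [← ENNReal.tsum_mul_left, ← tsum_two_inv_pow_succ]
  refine ENNReal.tsum_le_tsum fun j => ?_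
  calc ENNReal.ofReal (∑ X ∈ F k, φ X) * volume (B (k + j))
    _ ≤ ENNReal.ofReal (∑ X ∈ F k, φ X) * ENNReal.ofReal (stageError φ (k + j) (F (k + j))) := by
        gcongr
        exact (h.isStage (k + j)).volume_le
    _ ≤ 2⁻¹ ^ (k + j + 1) :=
        ofReal_sum_mul_stageError_le hφ (k + j) (h.monotone (Nat.le_add_right k j))
    _ ≤ 2⁻¹ ^ (j + 1) := pow_le_pow_of_le_one bot_le (by simp) (by omega)

theorem one_le_lintegral (h : IsStageSeq α K φ Ω D τ u F B) (hφ : ∀ Y, 0 ≤ φ Y)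
    {G : Euc m → Mat d m} (hG : ∀ᵐ x ∂volume.restrict Ω, ∀ n, (∀ k ≥ n, x ∉ B k) →
      grad (u n) x ∈ K → grad (u n) x = G x) {k : ℕ} (hk : B k ⊆ Ω) :
    1 ≤ ∫⁻ x in B k, ENNReal.ofReal (φ (G x)) := by
  set T := ⋃ j, B (k + 1 + j)
  set R := ENNReal.ofReal (∑ X ∈ F (k + 1), φ X)
  have hTm : MeasurableSet T := MeasurableSet.iUnion fun j => (h.isStage _).measurableSet
  have hae : ae (volume.restrict (B k)) ≤ ae (volume.restrict Ω) :=
    ae_mono (Measure.restrict_mono hk le_rfl)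
  have hpoint : ∀ᵐ x ∂volume.restrict (B k), ENNReal.ofReal (K.indicator φ (grad (u (k + 1)) x)) ≤
      ENNReal.ofReal (φ (G x)) + T.indicator (fun _ => R) x := by
    filter_upwards [hae hG, hae (h.energy_grad_le hφ (k + 1))] with x hx hxR
    by_cases hxT : x ∈ T
    · rw [indicator_of_mem hxT]
      exact le_add_left (ENNReal.ofReal_le_ofReal hxR)
    · have hxB : ∀ j ≥ k + 1, x ∉ B j := fun j hj hxj =>
        hxT (mem_iUnion.2 ⟨j - (k + 1), by rwa [Nat.add_sub_cancel' hj]⟩)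
      rw [indicator_of_notMem hxT, add_zero]
      refine ENNReal.ofReal_le_ofReal ?_
      by_cases hxK : grad (u (k + 1)) x ∈ K
      · rw [indicator_of_mem hxK, hx (k + 1) hxB hxK]
      · rw [indicator_of_notMem hxK]
        exact hφ _
  refine (ENNReal.add_le_add_iff_right ENNReal.one_ne_top).1 ?_
  calc 1 + 1 ≤ ∫⁻ x in B k, ENNReal.ofReal (K.indicator φ (grad (u (k + 1)) x)) :=
        one_add_one_eq_two.trans_le (h.isStage k).two_le_energy
    _ ≤ ∫⁻ x in B k, (ENNReal.ofReal (φ (G x)) + T.indicator (fun _ => R) x) :=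
        lintegral_mono_ae hpoint
    _ = (∫⁻ x in B k, ENNReal.ofReal (φ (G x))) + R * volume.restrict (B k) T := by
        rw [lintegral_add_right _ (measurable_const.indicator hTm), lintegral_indicator_const hTm]
    _ ≤ (∫⁻ x in B k, ENNReal.ofReal (φ (G x))) + 1 := by
        gcongr
        exact (mul_le_mul_right (Measure.restrict_apply_le _ _) _).trans
          (h.ofReal_sum_mul_volume_iUnion_le hφ (k + 1))

theorem lintegral_eq_top (h : IsStageSeq α K φ Ω D τ u F B) (hφ : ∀ Y, 0 ≤ φ Y)
    {G : Euc m → Mat d m} (hG : ∀ᵐ x ∂volume.restrict Ω, ∀ n, (∀ k ≥ n, x ∉ B k) →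
      grad (u n) x ∈ K → grad (u n) x = G x) {U : Set (Euc m)} (hU : U ⊆ Ω)
    (hD : ∃ᶠ k in atTop, D k ⊆ U) :
    ∫⁻ x in U, ENNReal.ofReal (φ (G x)) = ⊤ := by
  by_contra hfin
  have hpow : Tendsto (fun k : ℕ => (2⁻¹ : ℝ≥0∞) ^ (k + 1)) atTop (𝓝 0) :=
    (tendsto_add_atTop_iff_nat 1).2 (ENNReal.tendsto_pow_atTop_nhds_zero_of_lt_one (by simp))
  have hvol : Tendsto (volume.restrict U ∘ B) atTop (𝓝 0) :=
    tendsto_of_tendsto_of_tendsto_of_le_of_le tendsto_const_nhds hpow (fun _ => bot_le)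
      fun k => (Measure.restrict_apply_le _ _).trans (h.volume_le hφ k)
  obtain ⟨k, hk, hlt⟩ := (hD.and_eventually
    ((tendsto_setLIntegral_zero hfin hvol).eventually (gt_mem_nhds zero_lt_one))).exists
  have hB : B k ⊆ U := (h.isStage k).subset.trans hk
  rw [Measure.restrict_restrict (h.isStage k).measurableSet, inter_eq_left.2 hB] at hlt
  exact (h.one_le_lintegral hφ hG (hB.trans hU)).not_gt hlt

end IsStageSeq

end Limit

/-! ### The Hölder norm and the energy of a heavy tail -/

section Holder

variable {d m : ℕ} {α τ : ℝ≥0}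

theorem holderNormOn_le {S : Set (Euc m)} {v : Euc m → Euc d} (hv : ∀ x ∈ S, ‖v x‖ ≤ τ)
    (hv' : HolderOnWith τ α v S) : holderNormOn α S v ≤ τ + τ := by
  refine add_le_add (iSup₂_le fun x hx => ?_) (HolderWith.restrict_iff.2 hv').eHolderNorm_le
  rw [← ofReal_norm, ← ENNReal.ofReal_coe_nnreal]
  exact ENNReal.ofReal_le_ofReal (hv x hx)

theorem memHolderOn_add_of_lipschitzWith {Ω : Set (Euc m)} (hΩ : Bornology.IsBounded Ω)
    (hα : α ≤ 1) {v w : Euc m → Euc d} {L : ℝ≥0} (hv : LipschitzWith L v) (hwc : Continuous w)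
    (hw : ∀ x, ‖w x‖ ≤ τ) (hw' : HolderWith τ α w) : MemHolderOn α (closure Ω) (v + w) := by
  obtain ⟨C, hC⟩ := HolderOnWith.exists_holderOnWith_of_le
    ⟨L, (hv.lipschitzOnWith (s := closure Ω)).holderOnWith⟩ hα hΩ.closure
  obtain ⟨C', hC'⟩ := hΩ.isCompact_closure.exists_bound_of_continuousOn hv.continuous.continuousOn
  refine ⟨(hv.continuous.add hwc).continuousOn, ?_⟩
  have hbound : ∀ x ∈ closure Ω, ‖(v + w) x‖ ≤ (C + C'.toNNReal + τ : ℝ≥0) := fun x hx => by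
    have hvx := (hC' x hx).trans (Real.le_coe_toNNReal C')
    rw [NNReal.coe_add, NNReal.coe_add]
    exact (norm_add_le _ _).trans (by linarith [hw x, C.coe_nonneg])
  have hholder : HolderOnWith (C + C'.toNNReal + τ) α (v + w) (closure Ω) :=
    HolderWith.restrict_iff.1 <| ((HolderWith.restrict_iff.2 hC).add
      (HolderWith.restrict_iff.2 (hw'.holderOnWith (closure Ω)))).mono (by
        gcongr
        exact le_self_add)
  exact (holderNormOn_le hbound hholder).trans_lt
    (ENNReal.add_lt_top.2 ⟨ENNReal.coe_lt_top, ENNReal.coe_lt_top⟩)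

end Holder

section Tail

theorem lintegral_Ioi_inv_eq_top {a : ℝ} (ha : 0 ≤ a) :
    ∫⁻ t in Ioi a, ENNReal.ofReal t⁻¹ = ⊤ := by
  by_contra hfin
  refine not_integrableOn_Ioi_inv (a := a) ⟨by fun_prop, ?_⟩
  rw [hasFiniteIntegral_iff_ofReal]
  · exact lt_top_iff_ne_top.2 hfin
  · filter_upwards [ae_restrict_mem measurableSet_Ioi] with t ht
      using (inv_pos.2 (ha.trans_lt ht)).le

variable {S : Type*} [MeasurableSpace S] {ν : Measure S}

theorem nontrivial_of_lintegral_eq_top [IsFiniteMeasure ν] {ψ : S → ℝ≥0∞} (hψ : ∀ x, ψ x ≠ ⊤)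
    (h : ∫⁻ x, ψ x ∂ν = ⊤) : Nontrivial S := by
  by_contra hS
  rw [not_nontrivial_iff_subsingleton] at hS
  rcases isEmpty_or_nonempty S with hempty | ⟨⟨x⟩⟩
  · simp only [lintegral_of_isEmpty, ENNReal.zero_ne_top] at h
  · refine ENNReal.mul_ne_top (hψ x) (measure_ne_top ν univ) ?_
    rw [← lintegral_const, ← h]
    exact lintegral_congr fun y => by rw [Subsingleton.elim y x]

theorem lintegral_rpow_eq_top {f : S → ℝ} (hf : Measurable f) (hf0 : ∀ x, 0 ≤ f x)
    {p c t₀ : ℝ} (hp : 0 < p) (hc : 0 < c)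
    (h : ∀ t, t₀ < t → c * t ^ (-p) ≤ ν.real {x | t < f x}) :
    ∫⁻ x, ENNReal.ofReal (f x ^ p) ∂ν = ⊤ := by
  set a := max t₀ 0
  have hle : ∀ t ∈ Ioi a, ENNReal.ofReal c * ENNReal.ofReal t⁻¹ ≤
      ν {x | t < f x} * ENNReal.ofReal (t ^ (p - 1)) := fun t ht => by
    have ht₀ : 0 < t := (le_max_right _ _).trans_lt ht
    calc ENNReal.ofReal c * ENNReal.ofReal t⁻¹
      _ = ENNReal.ofReal (c * t ^ (-p)) * ENNReal.ofReal (t ^ (p - 1)) := by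
          rw [← ENNReal.ofReal_mul hc.le, ← ENNReal.ofReal_mul (by positivity), mul_assoc,
            ← Real.rpow_add ht₀, ← Real.rpow_neg_one]
          ring_nf
      _ ≤ ν {x | t < f x} * ENNReal.ofReal (t ^ (p - 1)) := by
          gcongr
          exact (ENNReal.ofReal_le_ofReal (h t ((le_max_left _ _).trans_lt ht))).trans
            ENNReal.ofReal_toReal_le
  rw [lintegral_rpow_eq_lintegral_meas_lt_mul ν (.of_forall hf0) hf.aemeasurable hp,
    ENNReal.mul_eq_top]
  refine Or.inl ⟨by simpa using hp, top_unique ?_⟩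
  calc ⊤ = ∫⁻ t in Ioi a, ENNReal.ofReal c * ENNReal.ofReal t⁻¹ := by
        rw [lintegral_const_mul _ (by fun_prop), lintegral_Ioi_inv_eq_top (le_max_right _ _),
          ENNReal.mul_top (by simpa using hc)]
    _ ≤ ∫⁻ t in Ioi a, ν {x | t < f x} * ENNReal.ofReal (t ^ (p - 1)) :=
        setLIntegral_mono' measurableSet_Ioi hle
    _ ≤ ∫⁻ t in Ioi 0, ν {x | t < f x} * ENNReal.ofReal (t ^ (p - 1)) :=
        lintegral_mono_set (Ioi_subset_Ioi (le_max_right _ _))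

end Tail

theorem corollaryA4_general {d m : ℕ} {K : Set (Mat d m)} {φ : Mat d m → ℝ} (hφ : ∀ X, 0 ≤ φ X)
    (hK : ∀ X : Mat d m, ∃ ν : Measure (Mat d m), IsProbabilityMeasure ν ∧
      IsExtendedStaircaseLaminate K X ν ∧ ∫⁻ Y, ENNReal.ofReal (φ Y) ∂ν = ⊤)
    {Ω : Set (Euc m)} (hΩ : IsOpen Ω) (hΩb : Bornology.IsBounded Ω) (hne : Ω.Nonempty)
    (A : Mat d m) (b : Euc d) {δ : ℝ} (hδ : 0 < δ) {α : ℝ≥0} (hα : α < 1) :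
    ∃ (u : Euc m → Euc d) (G : Euc m → Mat d m),
      IsSobolevW11 Ω u G ∧
      MemHolderOn α (closure Ω) u ∧
      (∀ x ∈ frontier Ω, u x = affineMap A b x) ∧
      (∀ᵐ x ∂volume.restrict Ω, G x ∈ K) ∧
      holderNormOn α (closure Ω) (fun x => u x - affineMap A b x) < ENNReal.ofReal δ ∧
      ∀ U, IsOpen U → U.Nonempty → U ⊆ Ω → ∫⁻ x in U, ENNReal.ofReal (φ (G x)) = ⊤ := by
  have : Nonempty (Fin m) := by
    obtain ⟨ν, hν, -, hφν⟩ := hK A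
    have := nontrivial_of_lintegral_eq_top (fun _ => ENNReal.ofReal_ne_top) hφν
    exact not_isEmpty_iff.1 fun _ => not_subsingleton (Mat d m) inferInstance
  choose ν _ hlam hφν using hK
  obtain ⟨τ, hτ, hτδ⟩ : ∃ τ : ℝ≥0, 0 < τ ∧ (τ + τ : ℝ≥0∞) < ENNReal.ofReal δ :=
    ⟨(δ / 3).toNNReal, Real.toNNReal_pos.2 (by positivity), by
      change ENNReal.ofReal (δ / 3) + ENNReal.ofReal (δ / 3) < _
      rw [← ENNReal.ofReal_add (by positivity) (by positivity)]
      exact (ENNReal.ofReal_lt_ofReal_iff hδ).2 (by linarith)⟩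
  obtain ⟨D, hD, hfreq⟩ := exists_open_seq_frequently_subset hΩ hne
  obtain ⟨L, hL⟩ := exists_lipschitzWith_affineMap A b
  have haff : IsPiecewiseAffineOn Ω (affineMap A b) {A} :=
    ae_of_all _ fun x => ⟨A, Finset.mem_singleton_self A, mem_affineSet_affineMap A b x⟩
  obtain ⟨u, F, B, hu, hu₀⟩ := exists_isStageSeq hφ (fun X => ⟨((hlam X).exists_mixture hα).choose⟩)
    (fun X => (hlam X).exists_isPartialResolution hα hφ (hφν X)) hΩ hΩb hD hτ haff ⟨L, hL⟩
  obtain ⟨w, hwc, hw₀, hwτ, hwα, hlim⟩ :=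
    exists_tendsto_of_isPerturbation fun k => (hu.isStage k).isPerturbation
  obtain ⟨G, hG⟩ := hu.exists_grad hφ hΩ.measurableSet
  rw [hu₀] at hlim
  refine ⟨affineMap A b + w, G,
    hu.isSobolevW11 hφ hΩ.measurableSet hΩb hlim (hG.mono fun x hx => hx.2.1),
    memHolderOn_add_of_lipschitzWith hΩb hα.le hL hwc hwτ hwα, fun x hx => ?_,
    hG.mono fun x hx => hx.1, ?_, fun U hU hUne hUΩ =>
      hu.lintegral_eq_top hφ (hG.mono fun x hx => hx.2.2) hUΩ (hfreq U hU hUne hUΩ)⟩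
  · have hxΩ : x ∉ Ω := fun hxΩ => notMem_empty x (hΩ.inter_frontier_eq ▸ ⟨hxΩ, hx⟩)
    rw [Pi.add_apply, hw₀ x hxΩ, add_zero]
  · simp only [Pi.add_apply, add_sub_cancel_left]
    exact (holderNormOn_le (fun x _ => hwτ x) (hwα.holderOnWith _)).trans_lt hτδ

theorem corollaryA4 {d m : ℕ} (K : Set (Mat d m)) (p r ρ M : ℝ)
    (hp : 1 < p) (hpr : p ≤ r) (hρ : 0 ≤ ρ) (hρr : ρ ≤ r) (hM : 1 < M)
    (hK : ∀ A : Mat d m, ∃ ν : Measure (Mat d m),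
      IsProbabilityMeasure ν ∧ IsExtendedStaircaseLaminate K A ν ∧ HasBarycenter ν A ∧
      ν Kᶜ = 0 ∧
      ∀ t : ℝ, 1 + ‖A‖ < t →
        M ^ (-p) * (1 + ‖A‖ ^ ρ) * t ^ (-p) ≤ ν.real {X : Mat d m | t < ‖X‖} ∧
        ν.real {X : Mat d m | t < ‖X‖} ≤ M ^ p * (1 + ‖A‖ ^ r) * t ^ (-p))
    (Ω : Set (EuclideanSpace ℝ (Fin m))) (hΩ : IsRegularDomain Ω)
    (A : Mat d m) (b : EuclideanSpace ℝ (Fin d))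
    (δ : ℝ) (hδ : 0 < δ) (α : ℝ≥0) (hα : α < 1) :
    ∃ (u : EuclideanSpace ℝ (Fin m) → EuclideanSpace ℝ (Fin d))
      (G : EuclideanSpace ℝ (Fin m) → Mat d m),
      IsSobolevW11 Ω u G ∧
      MemHolderOn α (closure Ω) u ∧
      (∀ x ∈ frontier Ω, u x = affineMap A b x) ∧
      (∀ᵐ x ∂volume.restrict Ω, G x ∈ K) ∧
      holderNormOn α (closure Ω) (fun x => u x - affineMap A b x) < ENNReal.ofReal δ ∧
      ∀ (c : EuclideanSpace ℝ (Fin m)) (s : ℝ), 0 < s → Metric.ball c s ⊆ Ω →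
        ∫⁻ x in Metric.ball c s, ENNReal.ofReal (‖G x‖ ^ p) = ⊤ := by
  have hKφ : ∀ X : Mat d m, ∃ ν : Measure (Mat d m), IsProbabilityMeasure ν ∧
      IsExtendedStaircaseLaminate K X ν ∧ ∫⁻ Y, ENNReal.ofReal (‖Y‖ ^ p) ∂ν = ⊤ := fun X => by
    obtain ⟨ν, hprob, hν, -, -, htail⟩ := hK X
    have hc : 0 < M ^ (-p) * (1 + ‖X‖ ^ ρ) := by positivity
    exact ⟨ν, hprob, hν, lintegral_rpow_eq_top (measurable_frobenius_norm d m) norm_nonneg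
      (zero_lt_one.trans hp) hc fun t ht => (htail t ht).1⟩
  obtain ⟨u, G, hSob, hHol, hbdry, hGK, hclose, htop⟩ := corollaryA4_general
    (fun X => Real.rpow_nonneg (norm_nonneg X) p) hKφ hΩ.isOpen hΩ.isBounded
    hΩ.isConnected.nonempty A b hδ hα
  exact ⟨u, G, hSob, hHol, hbdry, hGK, hclose, fun c s hs hball =>
    htop _ Metric.isOpen_ball (Metric.nonempty_ball.2 hs) hball⟩
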